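/- Let $d\ge 2$, let $B$ be the open unit ball of $\mathbb{R}^d$, and let $|\partial B|$ be the surface measure of $\partial B$. Let $\mathcal{H}_\ell$ be the space of spherical harmonics of degree $\ell$ (restrictions to $\partial B$ of complex harmonic homogeneous polynomials of degree $\ell$), and for each $\ell\in\mathbb{N}_0$ let $\{f_{\ell,m}\}_{m\in\mathcal{I}_\ell}$ be a basis of $\mathcal{H}_\ell$ that is orthonormal in $L^2(\partial B)$. For $\ell,k\in\mathbb{N}_0$ put $$C_{\ell,k}=(-1)^k\sqrt{2\ell+4k+d}\,\binom{\ell+k+\frac{d-2}{2}}{k},\qquad R_{\ell,k}(r)=C_{\ell,k}\sum_{q=0}^k(-1)^q\binom kq\frac{(\ell+k+\frac d2)_q}{(\ell+\frac d2)_q}\,r^{\ell+2q},$$ where $(x)_q=x(x+1)\cdots(x+q-1)$ and $\binom{x}{k}=x(x-1)\cdots(x-k+1)/k!$. With $n=(\ell,m)$ let $f_n=f_{\ell,m}$, $g_{n,k}=R_{\ell,k}$, and let $\psi_{n,k}(r\theta)=R_{\ell,k}(r)f_{\ell,m}(\theta)$ be the Zernike functions. Say that scalars $(a_{n,k})$ are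 admissible if the following conditions (Assumption 1) hold: (i) $\{f_n\}_n$ is an orthonormal basis of $L^2(\partial B)$; (ii) for each $n$, $\{g_{n,k}\}_k$ is an orthonormal set in $L^2([0,1],r^{d-1}dr)$; (iii) each $g_{n,k}$ is continuous at $r=1$; (iv) $\inf_{n,k}|g_{n,k}(1)|>0$; (v) there is a spherical shell $U=\{1-\eta\le|x|\le1\}$, $0<\eta<1$, with $\|\psi_{n,k}\|_{L^\infty(U)}\le a_{n,k}$ for all $n,k$. Let $C_+(\overline B)$ be the set of continuous functions $\gamma:\overline B\to(0,\infty)$. Let $H^{1/2}(\partial B)$ be the space of traces of $H^1(B)$ (complex valued), that is $H^1(B)/H^1_0(B)$, with the norm $\|f\|=\inf\{\|u\|_{H^1(B)}: u|_{\partial B}=f\}$, and let $H^{-1/2}(\partial B)$ be its antidual. For $\gamma\in C_+(\overline B)$ let $\Lambda(\gamma):H^{1/2}(\partial B)\to H^{-1/2}(\partial B)$ be the Dirichlet-to-Neumann map: $\langle\Lambda(\gamma)u|_{\partial B},v|_{\partial B}\rangle=\int_B\gamma\nabla u\cdot\overline{\nabla v}\,dx$ for all weak solutions $u\in H^1(B)$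 of $-\nabla\cdot(\gamma\nabla u)=0$ and all $v\in H^1(B)$. Call $C_{\partial B}>0$ a boundary stability constant if $$\|\gamma_1-\gamma_2\|_{L^\infty(\partial B)}\le C_{\partial B}\|\Lambda(\gamma_1)-\Lambda(\gamma_2)\|\qquad\text{for all }\gamma_1,\gamma_2\in C_+(\overline B),$$ with the operator norm from $H^{1/2}(\partial B)$ to $H^{-1/2}(\partial B)$ on the right. Then: 1. Assumption 1 holds with $a_{n,k}=|C_{\ell,k}|\bigl(\dim\mathcal{H}_\ell/|\partial B|\bigr)^{1/2}$, and in fact $\|\psi_{n,k}\|_{L^\infty(B)}\le a_{n,k}$ for this choice and all $n,k$. 2. $\{\psi_{n,k}\}_{n,k}$ is an orthonormal set in $L^2(B)$, and its closed linear span $W$ is all of $L^2(B)$. 3. $\inf_{n,k}|g_{n,k}(1)|=\sqrt d$, and $\inf_n|g_{n,k}(1)|=\sqrt{4k+d}$ for each $k$. 4. A boundary stability constant exists. For every boundary stability constant $C_{\partial B}$, all admissible scalars $(a_{n,k})$ (in particular those in 1), every $k\in\mathbb{N}_0$ and all $\gamma_1,\gamma_2\in C_+(\overline B)$: if $\gamma_1-\gamma_2\in\mathcal{A}_k$,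 then $$\|\gamma_1-\gamma_2\|_{L^2(B)}\le\Bigl(\frac{|\partial B|}{4k+d}\Bigr)^{1/2}C_{\partial B}\,\|\Lambda(\gamma_1)-\Lambda(\gamma_2)\|.$$ Here $\mathcal{A}_k$ is the set of $h$ in the closed span of $\{\psi_{n,k}\}_n$ in $L^2(B)$ with $\sum_n|\langle h,\psi_{n,k}\rangle_{L^2(B)}|\,a_{n,k}<\infty$. -/

import Mathlib

open MeasureTheory Set Metric
open scoped ContDiff InnerProductSpace ENNReal

noncomputable section

namespace Calderon

/-! ### The unit ball, the unit sphere and their measures -/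

/-- Euclidean space `ℝ^d`. -/
abbrev Sp (d : ℕ) : Type := EuclideanSpace ℝ (Fin d)

/-- The unit sphere `∂B`. -/
abbrev Sph (d : ℕ) : Type := sphere (0 : Sp d) 1

/-- Lebesgue measure on the unit ball `B`. -/
abbrev ballMeasure (d : ℕ) : Measure (Sp d) := volume.restrict (ball 0 1)

/-- The surface measure on `∂B`. -/
abbrev sphereMeasure (d : ℕ) : Measure (Sph d) := (volume : Measure (Sp d)).toSphere

/-- The measure `r^(d-1) dr` on `[0,1]`. -/
def radialMeasure (d : ℕ) : Measure ℝ :=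
  (volume.restrict (Icc (0 : ℝ) 1)).withDensity fun r => ENNReal.ofReal (r ^ (d - 1))

/-! ### The space `H¹(B)` and its boundary trace space -/

/-- The coordinate derivative `∂φ/∂x_i`. -/
def pd {d : ℕ} (i : Fin d) (φ : Sp d → ℂ) (x : Sp d) : ℂ :=
  fderiv ℝ φ x (EuclideanSpace.single i 1)

/-- `φ ∈ C_c^∞(B)`. -/
structure IsTest {d : ℕ} (φ : Sp d → ℂ) : Prop where
  smooth : ContDiff ℝ ∞ φ
  compact : HasCompactSupport φ
  supp : tsupport φ ⊆ ball 0 1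

/-- `G` is the weak gradient of `u` in the unit ball. -/
def IsWeakGrad {d : ℕ} (u : Sp d → ℂ) (G : Sp d → EuclideanSpace ℂ (Fin d)) : Prop :=
  ∀ φ : Sp d → ℂ, IsTest φ → ∀ i : Fin d,
    ∫ x in ball 0 1, u x * pd i φ x = - ∫ x in ball 0 1, G x i * φ x

/-- The Hilbert space `L²(B) × L²(B; ℂ^d)`. -/
abbrev PairL2 (d : ℕ) : Type :=
  WithLp 2 (Lp ℂ 2 (ballMeasure d) × Lp (EuclideanSpace ℂ (Fin d)) 2 (ballMeasure d))

lemma IsTest.continuous_pd {d : ℕ} {φ : Sp d → ℂ} (h : IsTest φ) (i : Fin d) :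
    Continuous (pd i φ) :=
  (h.smooth.continuous_fderiv (by simp)).clm_apply continuous_const

lemma IsTest.compact_pd {d : ℕ} {φ : Sp d → ℂ} (h : IsTest φ) (i : Fin d) :
    HasCompactSupport (pd i φ) :=
  h.compact.fderiv_apply ℝ _

lemma IsTest.memLp_conj_pd {d : ℕ} {φ : Sp d → ℂ} (h : IsTest φ) (i : Fin d) :
    MemLp (fun x => starRingEnd ℂ (pd i φ x)) 2 (ballMeasure d) :=
  Continuous.memLp_of_hasCompactSupport (Complex.continuous_conj.comp (h.continuous_pd i))
    ((h.compact_pd i).comp_left (map_zero _))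

lemma IsTest.memLp_conj_single {d : ℕ} {φ : Sp d → ℂ} (h : IsTest φ) (i : Fin d) :
    MemLp (fun x => EuclideanSpace.single i (starRingEnd ℂ (φ x))) 2 (ballMeasure d) := by
  refine Continuous.memLp_of_hasCompactSupport ?_ ?_
  · have : Continuous fun z : ℂ => EuclideanSpace.single i z := by
      simp only [← PiLp.toLp_single]
      exact (PiLp.continuous_toLp 2 _).comp (continuous_single (A := fun _ : Fin d => ℂ) i)
    exact this.comp (Complex.continuous_conj.comp h.smooth.continuous)
  · exact h.compact.comp_left (g := fun z => EuclideanSpace.single i (starRingEnd ℂ z)) (by simp)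

/-- The weak gradient identity for one test function, as an orthogonality relation in `L²`. -/
lemma isWeakGrad_iff {d : ℕ} (p : PairL2 d) : IsWeakGrad p.fst p.snd ↔
    ∀ φ : Sp d → ℂ, ∀ h : IsTest φ, ∀ i : Fin d,
      ⟪(h.memLp_conj_pd i).toLp _, p.fst⟫_ℂ + ⟪(h.memLp_conj_single i).toLp _, p.snd⟫_ℂ = 0 := by
  refine forall_congr' fun φ => forall_congr' fun h => forall_congr' fun i => ?_
  rw [eq_neg_iff_add_eq_zero, L2.inner_def, L2.inner_def]
  have h1 : ∫ x in ball 0 1, p.fst x * pd i φ x =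
      ∫ x, ⟪(h.memLp_conj_pd i).toLp _ x, p.fst x⟫_ℂ ∂(ballMeasure d) := by
    refine integral_congr_ae ?_
    filter_upwards [(h.memLp_conj_pd i).coeFn_toLp] with x hx
    simp [hx]
  have h2 : ∫ x in ball 0 1, p.snd x i * φ x =
      ∫ x, ⟪(h.memLp_conj_single i).toLp _ x, p.snd x⟫_ℂ ∂(ballMeasure d) := by
    refine integral_congr_ae ?_
    filter_upwards [(h.memLp_conj_single i).coeFn_toLp] with x hx
    simp [hx, EuclideanSpace.inner_single_left]
    ring
  rw [h1, h2]

/-- The graph of the weak gradient in `L²(B) × L²(B; ℂ^d)`. -/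
def weakGradGraph (d : ℕ) : Submodule ℂ (PairL2 d) where
  carrier := {p | IsWeakGrad p.fst p.snd}
  zero_mem' := by
    simp only [mem_ofPred_eq, isWeakGrad_iff]; intro φ h i; simp
  add_mem' := by
    intro p q hp hq
    simp only [mem_ofPred_eq, isWeakGrad_iff] at *
    intro φ h i
    rw [WithLp.add_fst, WithLp.add_snd, inner_add_right, inner_add_right, add_add_add_comm,
      hp φ h i, hq φ h i, add_zero]
  smul_mem' := by
    intro c p hp
    simp only [mem_ofPred_eq, isWeakGrad_iff] at *
    intro φ h i
    rw [WithLp.smul_fst, WithLp.smul_snd, inner_smul_right, inner_smul_right, ← mul_add,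
      hp φ h i, mul_zero]

lemma isClosed_weakGradGraph (d : ℕ) : IsClosed (weakGradGraph d : Set (PairL2 d)) := by
  have : (weakGradGraph d : Set (PairL2 d)) = {p | IsWeakGrad p.fst p.snd} := rfl
  rw [this]
  simp only [isWeakGrad_iff, ofPred_forall]
  refine isClosed_iInter fun φ => isClosed_iInter fun h => isClosed_iInter fun i => ?_
  refine isClosed_eq ?_ continuous_const
  exact (continuous_const.inner (WithLp.fstL 2 ℂ (Lp ℂ 2 (ballMeasure d))
      (Lp (EuclideanSpace ℂ (Fin d)) 2 (ballMeasure d))).continuous).add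
    (continuous_const.inner (WithLp.sndL 2 ℂ (Lp ℂ 2 (ballMeasure d))
      (Lp (EuclideanSpace ℂ (Fin d)) 2 (ballMeasure d))).continuous)

/-- The Sobolev space `H¹(B)`: pairs `(u, ∇u)` of an `L²` function and its weak gradient in
`L²(B; ℂ^d)`, with the norm `(‖u‖² + ‖∇u‖²)^(1/2)`. -/
def H1 (d : ℕ) : Type := weakGradGraph d

instance (d : ℕ) : NormedAddCommGroup (H1 d) :=
  inferInstanceAs (NormedAddCommGroup (weakGradGraph d))

instance (d : ℕ) : InnerProductSpace ℂ (H1 d) :=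
  inferInstanceAs (InnerProductSpace ℂ (weakGradGraph d))

instance (d : ℕ) : CompleteSpace (H1 d) := (isClosed_weakGradGraph d).completeSpace_coe

/-- The function `u` underlying an element of `H¹(B)`. -/
def valL (d : ℕ) : H1 d →L[ℂ] Lp ℂ 2 (ballMeasure d) :=
  (WithLp.fstL 2 ℂ (Lp ℂ 2 (ballMeasure d))
    (Lp (EuclideanSpace ℂ (Fin d)) 2 (ballMeasure d))).comp (weakGradGraph d).subtypeL

/-- The weak gradient `∇u` of `u ∈ H¹(B)`. -/
def gradL (d : ℕ) : H1 d →L[ℂ] Lp (EuclideanSpace ℂ (Fin d)) 2 (ballMeasure d) :=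
  (WithLp.sndL 2 ℂ (Lp ℂ 2 (ballMeasure d))
    (Lp (EuclideanSpace ℂ (Fin d)) 2 (ballMeasure d))).comp (weakGradGraph d).subtypeL

/-- The (classical) gradient of a function, as a complex vector. -/
def classGrad {d : ℕ} (φ : Sp d → ℂ) (x : Sp d) : EuclideanSpace ℂ (Fin d) :=
  WithLp.toLp 2 fun i => pd i φ x

/-- `H¹₀(B)`, the closure of `C_c^∞(B)` in `H¹(B)`. -/
def H10 (d : ℕ) : Submodule ℂ (H1 d) :=
  (Submodule.span ℂ {u : H1 d | ∃ φ : Sp d → ℂ, IsTest φ ∧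
    valL d u =ᵐ[ballMeasure d] φ ∧ gradL d u =ᵐ[ballMeasure d] classGrad φ}).topologicalClosure

instance (d : ℕ) : IsClosed (H10 d : Set (H1 d)) := Submodule.isClosed_topologicalClosure _

instance (d : ℕ) : CompleteSpace (H10 d) :=
  (Submodule.isClosed_topologicalClosure _).completeSpace_coe

/-- The trace space `H^{1/2}(∂B)`. Two functions in `H¹(B)` have the same trace on `∂B` precisely
when they differ by an element of `H¹₀(B)`, so boundary values are classes in `H¹(B) / H¹₀(B)`,
with the quotient norm `‖f‖ = inf {‖u‖_{H¹(B)} | u = f on ∂B}`. -/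
def TraceSpace (d : ℕ) : Type := H1 d ⧸ H10 d

instance (d : ℕ) : NormedAddCommGroup (TraceSpace d) :=
  inferInstanceAs (NormedAddCommGroup (H1 d ⧸ H10 d))

instance (d : ℕ) : NormedSpace ℂ (TraceSpace d) :=
  inferInstanceAs (NormedSpace ℂ (H1 d ⧸ H10 d))

/-- The trace map `u ↦ u|_{∂B}`. -/
def trace (d : ℕ) : H1 d →L[ℂ] TraceSpace d := (H10 d).mkQL

/-- `H^{-1/2}(∂B)`: the bounded antilinear functionals on `H^{1/2}(∂B)`. -/
abbrev DualTraceSpace (d : ℕ) : Type := TraceSpace d →L⋆[ℂ] ℂ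

/-! ### The Dirichlet-to-Neumann map -/

/-- `C_+` of the closed unit ball. -/
def CPlus (d : ℕ) : Set (Sp d → ℝ) :=
  {γ | ContinuousOn γ (closedBall 0 1) ∧ ∀ x ∈ closedBall (0 : Sp d) 1, 0 < γ x}

/-- The form `∫_B γ ∇u · conj(∇v) dx`. -/
def energy {d : ℕ} (γ : Sp d → ℝ) (u v : H1 d) : ℂ :=
  ∫ x in ball 0 1, (γ x : ℂ) * ∑ i, gradL d u x i * starRingEnd ℂ (gradL d v x i)

/-- `u ∈ H¹(B)` is a weak solution of `-∇·(γ∇u) = 0` in `B`. -/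
def IsWeakSolution {d : ℕ} (γ : Sp d → ℝ) (u : H1 d) : Prop :=
  ∀ v ∈ H10 d, energy γ u v = 0

/-- `Λ` maps `u|_{∂B}` to `ν·(γ∇u)|_{∂B}` for weak solutions `u`, the conormal derivative being
defined weakly by `⟨ν·(γ∇u)|_{∂B}, v|_{∂B}⟩ = ∫_B γ ∇u · conj(∇v) dx`. -/
def IsDtN {d : ℕ} (γ : Sp d → ℝ) (Λ : TraceSpace d →L[ℂ] DualTraceSpace d) : Prop :=
  ∀ u v : H1 d, IsWeakSolution γ u → Λ (trace d u) (trace d v) = energy γ u v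

lemma IsTest.integrable_pd_sq {d : ℕ} {φ : Sp d → ℂ} (h : IsTest φ) (i : Fin d) :
    Integrable fun x => ‖pd i φ x‖ ^ 2 :=
  Continuous.integrable_of_hasCompactSupport ((h.continuous_pd i).norm.pow 2)
    (HasCompactSupport.comp_left (g := fun z : ℂ => ‖z‖ ^ 2) (h.compact_pd i) (by simp))

/-- Poincaré inequality for test functions. -/
lemma IsTest.poincare {d : ℕ} {φ : Sp d → ℂ} (h : IsTest φ) (i : Fin d) :
    ∫ x in ball 0 1, ‖φ x‖ ^ 2 ≤ 4 * ∫ x in ball 0 1, ‖pd i φ x‖ ^ 2 := by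
  have hs0 : ∀ x ∉ ball (0 : Sp d) 1, φ x = 0 := fun x hx =>
    image_eq_zero_of_notMem_tsupport fun h' => hx (h.supp h')
  have hsp : ∀ x ∉ ball (0 : Sp d) 1, pd i φ x = 0 := fun x hx => by
    have : x ∉ tsupport (fderiv ℝ φ) := fun h' => hx (h.supp (tsupport_fderiv_subset ℝ h'))
    simp [pd, image_eq_zero_of_notMem_tsupport this]
  rw [setIntegral_eq_integral_of_forall_compl_eq_zero (fun x hx => by simp [hs0 x hx]),
    setIntegral_eq_integral_of_forall_compl_eq_zero (fun x hx => by simp [hsp x hx])]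
  have hdiff : Differentiable ℝ φ := h.smooth.differentiable (by simp)
  have hc := h.smooth.continuous
  have hcp := h.continuous_pd i
  have hd : ∀ x, HasFDerivAt (fun y => ‖φ y‖ ^ 2) (2 • (innerSL ℝ (φ x)).comp (fderiv ℝ φ x)) x :=
    fun x => (hdiff x).hasFDerivAt.norm_sq
  have hd' : ∀ x, fderiv ℝ (fun y => ‖φ y‖ ^ 2) x (EuclideanSpace.single i 1) =
      2 * ⟪φ x, pd i φ x⟫_ℝ := fun x => by rw [(hd x).fderiv]; simp [pd]; ring
  have hl : ∀ x : Sp d, fderiv ℝ (fun y : Sp d => y i) x (EuclideanSpace.single i 1) = 1 := by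
    intro x
    have : HasFDerivAt (fun y : Sp d => y i) (EuclideanSpace.proj (𝕜 := ℝ) i) x :=
      (EuclideanSpace.proj (𝕜 := ℝ) i).hasFDerivAt
    rw [this.fderiv]; simp
  have hci : Continuous fun y : Sp d => y i := (EuclideanSpace.proj (𝕜 := ℝ) i).continuous
  have hcs : HasCompactSupport fun x => ‖φ x‖ ^ 2 :=
    h.compact.comp_left (g := fun z : ℂ => ‖z‖ ^ 2) (by simp)
  have hI1 : Integrable fun x => ‖φ x‖ ^ 2 :=
    (hc.norm.pow 2).integrable_of_hasCompactSupport hcs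
  have hI2 : Integrable fun x => ‖pd i φ x‖ ^ 2 := h.integrable_pd_sq i
  have hI3 : Integrable fun x : Sp d => x i * (2 * ⟪φ x, pd i φ x⟫_ℝ) := by
    refine Continuous.integrable_of_hasCompactSupport
      (hci.mul (continuous_const.mul (hc.inner hcp))) ?_
    refine HasCompactSupport.mono' h.compact fun x hx => ?_
    refine subset_tsupport _ ?_
    intro h0
    simp [h0] at hx
  have key : ∫ x : Sp d, x i * fderiv ℝ (fun y => ‖φ y‖ ^ 2) x (EuclideanSpace.single i 1) =
      - ∫ x : Sp d, fderiv ℝ (fun y : Sp d => y i) x (EuclideanSpace.single i 1) * ‖φ x‖ ^ 2 := by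
    refine integral_mul_fderiv_eq_neg_fderiv_mul_of_integrable ?_ ?_ ?_ ?_ ?_
    · simpa only [hl, one_mul] using hI1
    · simpa only [hd'] using hI3
    · exact (hci.mul (hc.norm.pow 2)).integrable_of_hasCompactSupport hcs.mul_left
    · exact fun x _ => (EuclideanSpace.proj (𝕜 := ℝ) i).differentiableAt
    · exact fun x _ => (hd x).differentiableAt
  simp only [hl, hd', one_mul] at key
  have hb : - ∫ x : Sp d, x i * (2 * ⟪φ x, pd i φ x⟫_ℝ) ≤
      ∫ x : Sp d, (1 / 2 * ‖φ x‖ ^ 2 + 2 * ‖pd i φ x‖ ^ 2) := by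
    rw [← integral_neg]
    refine integral_mono hI3.neg ((hI1.const_mul _).add (hI2.const_mul _)) fun x => ?_
    by_cases hx : x ∈ ball (0 : Sp d) 1
    · have h1 : |x i| ≤ 1 := by
        have := PiLp.norm_apply_le x i
        rw [Real.norm_eq_abs] at this
        exact this.trans (by simpa using (mem_ball_zero_iff.1 hx).le)
      have h2 := abs_real_inner_le_norm (φ x) (pd i φ x)
      have h3 : |x i * (2 * ⟪φ x, pd i φ x⟫_ℝ)| ≤ 1 * (2 * (‖φ x‖ * ‖pd i φ x‖)) := by
        rw [abs_mul, abs_mul, abs_two]; gcongr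
      have h4 := neg_abs_le (x i * (2 * ⟪φ x, pd i φ x⟫_ℝ))
      nlinarith [sq_nonneg (‖φ x‖ - 2 * ‖pd i φ x‖)]
    · simp [hs0 x hx, hsp x hx]
  rw [integral_add (hI1.const_mul _) (hI2.const_mul _), integral_const_mul,
    integral_const_mul] at hb
  linarith

lemma norm_sq_eq_integral {d : ℕ} {F : Type*} [NormedAddCommGroup F] [InnerProductSpace ℂ F]
    (w : Lp F 2 (ballMeasure d)) : ‖w‖ ^ 2 = ∫ x in ball 0 1, ‖w x‖ ^ 2 := by
  have h1 := L2.inner_def (𝕜 := ℂ) w w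
  rw [inner_self_eq_norm_sq_to_K] at h1
  simp only [inner_self_eq_norm_sq_to_K] at h1
  have h2 : ∫ x in ball (0 : Sp d) 1, ((‖w x‖ : ℂ)) ^ 2 =
      ((∫ x in ball (0 : Sp d) 1, ‖w x‖ ^ 2 : ℝ) : ℂ) := by
    rw [← integral_complex_ofReal]; simp
  refine Complex.ofReal_injective ?_
  rw [← h2, Complex.ofReal_pow]
  exact h1

/-- `u` is (the class of) a test function. -/
def IsTestClass {d : ℕ} (u : H1 d) : Prop :=
  ∃ φ : Sp d → ℂ, IsTest φ ∧
    (valL d u) =ᵐ[ballMeasure d] φ ∧ (gradL d u) =ᵐ[ballMeasure d] classGrad φ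

lemma IsTestClass.add {d : ℕ} {a b : H1 d} (ha : IsTestClass a) (hb : IsTestClass b) :
    IsTestClass (a + b) := by
  obtain ⟨φ, hφ, h1, h2⟩ := ha
  obtain ⟨ψ, hψ, h3, h4⟩ := hb
  refine ⟨φ + ψ, ⟨hφ.smooth.add hψ.smooth, hφ.compact.add hψ.compact,
    (tsupport_add φ ψ).trans (union_subset hφ.supp hψ.supp)⟩,
    (Lp.coeFn_add (valL d a) (valL d b)).trans (h1.add h3),
    (Lp.coeFn_add (gradL d a) (gradL d b)).trans ((h2.add h4).trans ?_)⟩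
  filter_upwards with x
  ext j
  simp [classGrad, pd, fderiv_add
    (hφ.smooth.differentiable (by simp) x) (hψ.smooth.differentiable (by simp) x)]

lemma IsTestClass.smul {d : ℕ} (c : ℂ) {a : H1 d} (ha : IsTestClass a) :
    IsTestClass (c • a) := by
  obtain ⟨φ, hφ, h1, h2⟩ := ha
  refine ⟨c • φ, ⟨contDiff_const.smul hφ.smooth, hφ.compact.smul_left (f := fun _ => c),
    (tsupport_smul_subset_right (fun _ => c) φ).trans hφ.supp⟩,
    (Lp.coeFn_smul c (valL d a)).trans (h1.const_smul c),
    (Lp.coeFn_smul c (gradL d a)).trans ((h2.const_smul c).trans ?_)⟩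
  filter_upwards with x
  ext j
  simp [classGrad, pd, fderiv_const_smul (hφ.smooth.differentiable (by simp) x) c]

lemma IsTestClass.zero (d : ℕ) : IsTestClass (0 : H1 d) := by
  refine ⟨fun _ => 0, ⟨contDiff_const, HasCompactSupport.zero, by simp [tsupport]⟩,
    Lp.coeFn_zero _ _ _, (Lp.coeFn_zero _ _ _).trans ?_⟩
  filter_upwards with x
  ext j; simp [classGrad, pd]

lemma IsTestClass.poincare {d : ℕ} (hd : 0 < d) {u : H1 d} (hu : IsTestClass u) :
    ‖(valL d u)‖ ^ 2 ≤ 4 * ‖(gradL d u)‖ ^ 2 := by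
  obtain ⟨φ, hφ, h1, h2⟩ := hu
  have e1 : ∫ x in ball 0 1, ‖(valL d u) x‖ ^ 2 = ∫ x in ball 0 1, ‖φ x‖ ^ 2 :=
    integral_congr_ae (by filter_upwards [h1] with x hx; rw [hx])
  obtain ⟨i⟩ : Nonempty (Fin d) := ⟨⟨0, hd⟩⟩
  have e2 : ∫ x in ball 0 1, ‖pd i φ x‖ ^ 2 ≤ ∫ x in ball 0 1, ‖(gradL d u) x‖ ^ 2 := by
    refine integral_mono_ae ?_ ?_ ?_
    · exact (hφ.integrable_pd_sq i).restrict
    · exact (Lp.memLp (gradL d u)).integrable_norm_pow (by simp)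
    · filter_upwards [h2] with x hx
      have h3 : ‖pd i φ x‖ ≤ ‖classGrad φ x‖ := PiLp.norm_apply_le (classGrad φ x) i
      rw [hx]
      exact pow_le_pow_left₀ (norm_nonneg _) h3 2
  have e3 := hφ.poincare i
  rw [norm_sq_eq_integral, norm_sq_eq_integral, e1]
  linarith

/-- Poincaré inequality in `H¹₀(B)`. -/
lemma poincare {d : ℕ} (hd : 0 < d) (u : H1 d) (hu : u ∈ H10 d) :
    ‖valL d u‖ ^ 2 ≤ 4 * ‖gradL d u‖ ^ 2 := by
  have hcl : IsClosed {u : H1 d | ‖valL d u‖ ^ 2 ≤ 4 * ‖gradL d u‖ ^ 2} :=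
    isClosed_le ((valL d).continuous.norm.pow 2)
      (continuous_const.mul ((gradL d).continuous.norm.pow 2))
  refine closure_minimal (t := {u : H1 d | ‖valL d u‖ ^ 2 ≤ 4 * ‖gradL d u‖ ^ 2}) ?_ hcl hu
  intro u hu
  have hform : IsTestClass u :=
    Submodule.span_induction (p := fun u _ => IsTestClass u) (fun _ h => h)
      (IsTestClass.zero d) (fun _ _ _ _ h1 h2 => h1.add h2) (fun c _ _ h => h.smul c) hu
  exact hform.poincare hd

lemma norm_sq_le_grad {d : ℕ} (hd : 0 < d) (u : H1 d) (hu : u ∈ H10 d) :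
    ‖u‖ ^ 2 ≤ 5 * ‖gradL d u‖ ^ 2 := by
  have h1 : ‖u‖ ^ 2 = ‖valL d u‖ ^ 2 + ‖gradL d u‖ ^ 2 := WithLp.prod_norm_sq_eq_of_L2 (show weakGradGraph d from u).1
  linarith [poincare hd u hu]

/-! #### Multiplication by the conductivity and solvability of the Dirichlet problem -/

lemma CPlus.memLp {d : ℕ} {γ : Sp d → ℝ} (h : γ ∈ CPlus d) :
    MemLp (fun x => (γ x : ℂ)) ∞ (ballMeasure d) := by
  obtain ⟨C, hC⟩ := (isCompact_closedBall (0 : Sp d) 1).exists_bound_of_continuousOn h.1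
  refine memLp_top_of_bound ?_ C ?_
  · exact Complex.continuous_ofReal.comp_aestronglyMeasurable
      ((h.1.mono ball_subset_closedBall).aestronglyMeasurable measurableSet_ball)
  · refine (ae_restrict_iff' measurableSet_ball).2 (.of_forall fun x hx => ?_)
    simpa using hC x (ball_subset_closedBall hx)

/-- Multiplication by `γ` on `L²(B; ℂ^d)`. -/
def mulL {d : ℕ} {γ : Sp d → ℝ} (h : γ ∈ CPlus d) :
    Lp (EuclideanSpace ℂ (Fin d)) 2 (ballMeasure d) →L[ℂ]
      Lp (EuclideanSpace ℂ (Fin d)) 2 (ballMeasure d) :=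
  (ContinuousLinearMap.lsmul ℂ ℂ).holderL (ballMeasure d) ∞ 2 2 ((CPlus.memLp h).toLp _)

lemma coeFn_mulL {d : ℕ} {γ : Sp d → ℝ} (h : γ ∈ CPlus d)
    (F : Lp (EuclideanSpace ℂ (Fin d)) 2 (ballMeasure d)) :
    mulL h F =ᵐ[ballMeasure d] fun x => (γ x : ℂ) • F x := by
  refine ((ContinuousLinearMap.lsmul ℂ ℂ).coeFn_holder (r := 2) _ F).trans ?_
  filter_upwards [(CPlus.memLp h).coeFn_toLp] with x hx
  simp [hx]

lemma inner_mulL {d : ℕ} {γ : Sp d → ℝ} (h : γ ∈ CPlus d) (u v : H1 d) :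
    ⟪gradL d v, mulL h (gradL d u)⟫_ℂ = energy γ u v := by
  rw [L2.inner_def, energy]
  refine integral_congr_ae ?_
  filter_upwards [coeFn_mulL h (gradL d u)] with x hx
  rw [hx, inner_smul_right, PiLp.inner_apply]
  rfl

lemma energy_self_bound {d : ℕ} {γ : Sp d → ℝ} (h : γ ∈ CPlus d) :
    ∃ m : ℝ, 0 < m ∧ ∀ u : H1 d, m * ‖gradL d u‖ ^ 2 ≤ ‖energy γ u u‖ := by
  obtain ⟨x₀, hx₀, hmin⟩ := (isCompact_closedBall (0 : Sp d) 1).exists_isMinOn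
    ⟨0, by simp⟩ h.1
  refine ⟨γ x₀, h.2 x₀ hx₀, fun u => ?_⟩
  have e : energy γ u u = ((∫ x in ball 0 1, γ x * ‖gradL d u x‖ ^ 2 : ℝ) : ℂ) := by
    rw [energy, ← integral_complex_ofReal]
    refine integral_congr_ae (.of_forall fun x => ?_)
    simp only [Complex.ofReal_mul, Complex.mul_conj, Complex.normSq_eq_norm_sq]
    rw [EuclideanSpace.norm_sq_eq]
    push_cast
    rfl
  obtain ⟨C, hC⟩ := (isCompact_closedBall (0 : Sp d) 1).exists_bound_of_continuousOn h.1
  have hI : Integrable (fun x => ‖gradL d u x‖ ^ 2) (ballMeasure d) :=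
    (Lp.memLp (gradL d u)).integrable_norm_pow (by simp)
  have hI2 : Integrable (fun x => γ x * ‖gradL d u x‖ ^ 2) (ballMeasure d) := by
    refine hI.bdd_mul (c := C)
      ((h.1.mono ball_subset_closedBall).aestronglyMeasurable measurableSet_ball) ?_
    exact (ae_restrict_iff' measurableSet_ball).2
      (.of_forall fun x hx => hC x (ball_subset_closedBall hx))
  have hle : γ x₀ * ‖gradL d u‖ ^ 2 ≤ ∫ x in ball 0 1, γ x * ‖gradL d u x‖ ^ 2 := by
    rw [norm_sq_eq_integral, ← integral_const_mul]
    refine integral_mono_ae (hI.const_mul _) hI2 ?_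
    refine (ae_restrict_iff' measurableSet_ball).2 (.of_forall fun x hx => ?_)
    exact mul_le_mul_of_nonneg_right (hmin (ball_subset_closedBall hx)) (by positivity)
  rw [e, Complex.norm_real]
  exact hle.trans (le_abs_self _)

/-- The operator on `H¹(B)` representing the form `energy γ`. -/
def energyOp {d : ℕ} {γ : Sp d → ℝ} (h : γ ∈ CPlus d) : H1 d →L[ℂ] H1 d :=
  (ContinuousLinearMap.adjoint (gradL d)).comp ((mulL h).comp (gradL d))

lemma inner_energyOp {d : ℕ} {γ : Sp d → ℝ} (h : γ ∈ CPlus d) (u v : H1 d) :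
    ⟪v, energyOp h u⟫_ℂ = energy γ u v := by
  rw [energyOp, ContinuousLinearMap.comp_apply, ContinuousLinearMap.adjoint_inner_right]
  exact inner_mulL h u v

/-- The solution operator of the Dirichlet problem: `S u` is the weak solution with the same
boundary values as `u`. -/
lemma exists_solution_operator {d : ℕ} (hd : 0 < d) {γ : Sp d → ℝ} (h : γ ∈ CPlus d) :
    ∃ S : H1 d →L[ℂ] H1 d, (∀ u, IsWeakSolution γ (S u)) ∧ (∀ u, u - S u ∈ H10 d) ∧
      ∀ u ∈ H10 d, S u = 0 := by
  let ι : H10 d →L[ℂ] H1 d := (H10 d).subtypeL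
  let P : H1 d →L[ℂ] H10 d := ContinuousLinearMap.adjoint ι
  let A : H10 d →L[ℂ] H10 d := P.comp ((energyOp h).comp ι)
  have hA : ∀ φ w : H10 d, ⟪φ, A w⟫_ℂ = energy γ w φ := fun φ w => by
    show ⟪φ, P (energyOp h (ι w))⟫_ℂ = _
    rw [ContinuousLinearMap.adjoint_inner_right]
    exact inner_energyOp h _ _
  obtain ⟨m, hm, hmb⟩ := energy_self_bound h
  have hU : IsUnit A := by
    refine ContinuousLinearMap.isUnit_of_forall_le_norm_inner_map A
      (c := ⟨m / 5, by positivity⟩) (show (0 : ℝ) < m / 5 by positivity) fun w => ?_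
    have h1 : ‖⟪A w, w⟫_ℂ‖ = ‖energy γ (w : H1 d) w‖ := by rw [norm_inner_symm, hA]
    have h2 := norm_sq_le_grad hd (w : H1 d) w.2
    have h3 := hmb (w : H1 d)
    rw [h1]
    show ‖(w : H1 d)‖ ^ 2 * (m / 5) ≤ _
    nlinarith
  obtain ⟨U, hUA⟩ := hU
  have hinv1 : ∀ w, A ((↑U⁻¹ : H10 d →L[ℂ] H10 d) w) = w := fun w => by
    rw [← hUA]; exact DFunLike.congr_fun U.mul_inv w
  have hinv2 : ∀ w, (↑U⁻¹ : H10 d →L[ℂ] H10 d) (A w) = w := fun w => by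
    rw [← hUA]; exact DFunLike.congr_fun U.inv_mul w
  let K : H1 d →L[ℂ] H10 d := (↑U⁻¹ : H10 d →L[ℂ] H10 d).comp (P.comp (energyOp h))
  refine ⟨ContinuousLinearMap.id ℂ _ - ι.comp K, fun u v hv => ?_, fun u => ?_, fun u hu => ?_⟩
  · have e1 : energy γ (u - ι (K u)) v =
        ⟪(⟨v, hv⟩ : H10 d), P (energyOp h (u - ι (K u)))⟫_ℂ := by
      rw [ContinuousLinearMap.adjoint_inner_right]
      exact (inner_energyOp h _ _).symm
    have e2 : P (energyOp h (ι (K u))) = P (energyOp h u) := hinv1 _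
    show energy γ (u - ι (K u)) v = 0
    rw [e1, map_sub, map_sub, e2, sub_self, inner_zero_right]
  · have : u - (ContinuousLinearMap.id ℂ (H1 d) - ι.comp K) u = (K u : H1 d) := by
      simp [ι]
    rw [this]
    exact (K u).2
  · have e : K u = ⟨u, hu⟩ := hinv2 ⟨u, hu⟩
    show u - ι (K u) = 0
    rw [e]
    simp [ι]

lemma energy_add_mem {d : ℕ} {γ : Sp d → ℝ} (h : γ ∈ CPlus d) {u v w : H1 d}
    (hu : IsWeakSolution γ u) (hvw : v - w ∈ H10 d) : energy γ u v = energy γ u w := by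
  have := hu _ hvw
  rw [← inner_energyOp h, inner_sub_left, inner_energyOp h, inner_energyOp h] at this
  exact sub_eq_zero.1 this

/-- Well-posedness: the Dirichlet-to-Neumann map exists and is unique. -/
theorem existsUnique_isDtN {d : ℕ} {γ : Sp d → ℝ} (h : γ ∈ CPlus d) :
    ∃! Λ : TraceSpace d →L[ℂ] DualTraceSpace d, IsDtN γ Λ := by
  have hsol : ∃ S : H1 d →L[ℂ] H1 d, (∀ u, IsWeakSolution γ (S u)) ∧ (∀ u, u - S u ∈ H10 d) ∧
      ∀ u ∈ H10 d, energyOp h (S u) = 0 := by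
    rcases Nat.eq_zero_or_pos d with rfl | hd
    · have h0 : ∀ u v : H1 0, energy γ u v = 0 := fun u v => by simp [energy]
      refine ⟨ContinuousLinearMap.id ℂ _, fun u v _ => h0 _ _, fun u => by simp, fun u _ => ?_⟩
      rw [← inner_self_eq_zero (𝕜 := ℂ), inner_energyOp, h0]
    · obtain ⟨S, h1, h2, h3⟩ := exists_solution_operator hd h
      exact ⟨S, h1, h2, fun u hu => by rw [h3 u hu, map_zero]⟩
  obtain ⟨S, hS1, hS2, hS3⟩ := hsol
  let L : TraceSpace d →L[ℂ] H1 d := (H10 d).liftQL ((energyOp h).comp S) fun u hu => hS3 u hu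
  let Q : TraceSpace d →L[ℂ] H1 d :=
    (H10 d).liftQL (ContinuousLinearMap.id ℂ _ - (H10 d).starProjection) fun u hu => by
      simp [Submodule.starProjection_eq_self_iff.2 hu]
  let Λ : TraceSpace d →L[ℂ] DualTraceSpace d := LinearMap.mkContinuous₂
    (LinearMap.mk₂'ₛₗ (RingHom.id ℂ) (starRingEnd ℂ) (fun f g => ⟪Q g, L f⟫_ℂ)
      (fun f f' g => by rw [L.map_add]; exact inner_add_right _ _ _)
      (fun c f g => by rw [L.map_smul]; exact inner_smul_right _ _ _)
      (fun f g g' => by rw [Q.map_add]; exact inner_add_left _ _ _)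
      (fun c f g => by rw [Q.map_smul]; exact inner_smul_left _ _ _))
    (‖Q‖ * ‖L‖) fun f g => by
      refine (norm_inner_le_norm (𝕜 := ℂ) (Q g) (L f)).trans ?_
      have := mul_le_mul (Q.le_opNorm g) (L.le_opNorm f) (norm_nonneg _) (by positivity)
      calc _ ≤ _ := this
        _ = _ := by ring
  have hΛ : ∀ u v : H1 d, Λ (trace d u) (trace d v) = energy γ (S u) v := fun u v => by
    show ⟪v - (H10 d).starProjection v, energyOp h (S u)⟫_ℂ = _
    rw [inner_energyOp]
    refine energy_add_mem h (hS1 u) ?_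
    rw [sub_sub_cancel_left]
    exact (H10 d).neg_mem ((H10 d).starProjection_apply_mem v)
  refine ⟨Λ, fun u v hu => ?_, fun Λ' hΛ' => ?_⟩
  · rw [hΛ]
    have hw : IsWeakSolution γ (u - S u) := fun v hv => by
      rw [← inner_energyOp h, map_sub, inner_sub_right, inner_energyOp, inner_energyOp,
        hu v hv, hS1 u v hv, sub_zero]
    have h0 : energy γ (u - S u) (u - S u) = 0 := hw _ (hS2 u)
    obtain ⟨m, hm, hmb⟩ := energy_self_bound h
    have hg : gradL d (u - S u) = 0 := by
      have := hmb (u - S u)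
      rw [h0, norm_zero] at this
      have h3 : ‖gradL d (u - S u)‖ ^ 2 = 0 :=
        le_antisymm (by nlinarith) (by positivity)
      exact norm_eq_zero.1 (pow_eq_zero_iff (two_ne_zero) |>.1 h3)
    have h4 : energy γ (u - S u) v = 0 := by
      rw [← inner_mulL h, hg, map_zero, inner_zero_right]
    rw [← inner_energyOp h, map_sub, inner_sub_right, inner_energyOp, inner_energyOp] at h4
    exact (sub_eq_zero.1 h4).symm
  · ext f g
    obtain ⟨u, rfl⟩ := (H10 d).mkQ_surjective f
    obtain ⟨v, rfl⟩ := (H10 d).mkQ_surjective g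
    have hf : trace d u = trace d (S u) := (Submodule.Quotient.eq _).2 (hS2 u)
    show Λ' (trace d u) (trace d v) = Λ (trace d u) (trace d v)
    rw [hΛ, hf]
    exact hΛ' _ _ (hS1 u)

/-- The Dirichlet-to-Neumann map `Λ(γ) : H^{1/2}(∂B) → H^{-1/2}(∂B)`. -/
def dtn {d : ℕ} (γ : CPlus d) : TraceSpace d →L[ℂ] DualTraceSpace d :=
  (existsUnique_isDtN γ.2).choose

lemma dtn_spec {d : ℕ} (γ : CPlus d) : IsDtN γ.1 (dtn γ) :=
  (existsUnique_isDtN γ.2).choose_spec.1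

/-- `C` is an admissible constant in the Lipschitz stability estimate at the boundary:
`‖γ₁ - γ₂‖_{L^∞(∂B)} ≤ C ‖Λ(γ₁) - Λ(γ₂)‖` for all `γ₁, γ₂` in `C_+`. The norm on the right is the
operator norm from `H^{1/2}(∂B)` to `H^{-1/2}(∂B)`. -/
def IsBoundaryStabilityConstant (d : ℕ) (C : ℝ) : Prop :=
  ∀ γ₁ γ₂ : CPlus d,
    eLpNorm (fun θ : Sph d => γ₁.1 θ - γ₂.1 θ) ∞ (sphereMeasure d) ≤
      ENNReal.ofReal (C * ‖dtn γ₁ - dtn γ₂‖)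

/-! ### Orthonormal systems of product form and the coefficient classes -/

/-- The functions `f i` form an orthonormal set in `L²(μ)`. -/
structure IsOrthonormalSet {α ι : Type*} [MeasurableSpace α] (μ : Measure α)
    (f : ι → α → ℂ) : Prop where
  memLp : ∀ i, MemLp (f i) 2 μ
  norm_one : ∀ i, ∫ x, f i x * starRingEnd ℂ (f i x) ∂μ = 1
  ortho : ∀ i j, i ≠ j → ∫ x, f i x * starRingEnd ℂ (f j x) ∂μ = 0

/-- The closed linear span in `L²(μ)` of the functions `f i`. -/
def closedSpan {α ι : Type*} [MeasurableSpace α] (μ : Measure α) (f : ι → α → ℂ) :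
    Submodule ℂ (Lp ℂ 2 μ) :=
  (Submodule.span ℂ {F : Lp ℂ 2 μ | ∃ i, F =ᵐ[μ] f i}).topologicalClosure

/-- The function `ψ(rθ) = g(r) f(θ)` in polar coordinates `r = |x|`, `θ = x/|x|`
(with the immaterial value `0` at the origin). -/
def polarProd {d : ℕ} (g : ℝ → ℂ) (f : Sph d → ℂ) (x : Sp d) : ℂ :=
  open Classical in
  if h : x = 0 then 0
  else g ‖x‖ * f ⟨‖x‖⁻¹ • x, by simp [norm_smul, h]⟩

/-- The closed spherical shell `{x | 1 - η ≤ |x| ≤ 1}`. -/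
def shell (d : ℕ) (η : ℝ) : Set (Sp d) := {x | 1 - η ≤ ‖x‖ ∧ ‖x‖ ≤ 1}

/-- The standing assumptions on the angular functions `f n`, the radial functions `g n k` and the
bounds `a n k`. -/
structure BasisAssumption (d : ℕ) {N K : Type*} (f : N → Sph d → ℂ) (g : N → K → ℝ → ℂ)
    (a : N → K → ℝ) : Prop where
  /-- `f` is an orthonormal basis of `L²(∂B)`. -/
  f_orthonormal : IsOrthonormalSet (sphereMeasure d) f
  f_complete : closedSpan (sphereMeasure d) f = ⊤
  /-- For each `n`, the functions `g n k` form an orthonormal set in `L²([0,1], r^(d-1) dr)`. -/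
  g_orthonormal : ∀ n, IsOrthonormalSet (radialMeasure d) (g n)
  /-- Each `g n k` is continuous at `r = 1` (as a function on `[0,1]`). -/
  g_continuous : ∀ n k, ContinuousWithinAt (g n k) (Icc 0 1) 1
  /-- `inf |g n k 1| > 0`. -/
  g_lower : ∃ c : ℝ, 0 < c ∧ ∀ n k, c ≤ ‖g n k 1‖
  /-- `‖ψ n k‖_{L^∞(U)} ≤ a n k` on a spherical shell `U` that does not depend on `n` and `k`. -/
  a_nonneg : ∀ n k, 0 ≤ a n k
  a_bound : ∃ η : ℝ, 0 < η ∧ η < 1 ∧ ∀ n k,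
    eLpNorm (polarProd (g n k) (f n)) ∞ (volume.restrict (shell d η)) ≤ ENNReal.ofReal (a n k)

/-- `W`, the closed span in `L²(B)` of all `ψ n k`. -/
def spaceW (d : ℕ) {N K : Type*} (f : N → Sph d → ℂ) (g : N → K → ℝ → ℂ) :
    Submodule ℂ (Lp ℂ 2 (ballMeasure d)) :=
  closedSpan (ballMeasure d) fun nk : N × K => polarProd (g nk.1 nk.2) (f nk.1)

/-- `W_k`, the closed span in `L²(B)` of the `ψ n k` with `k` fixed. -/
def spaceWk (d : ℕ) {N K : Type*} (f : N → Sph d → ℂ) (g : N → K → ℝ → ℂ) (k : K) :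
    Submodule ℂ (Lp ℂ 2 (ballMeasure d)) :=
  closedSpan (ballMeasure d) fun n : N => polarProd (g n k) (f n)

/-- `𝒜_k`: functions `h` on `B` that belong to `W_k` and whose coefficients
`c n = ⟨h, ψ n k⟩_{L²(B)}` satisfy `∑ |c n| a n k < ∞`. -/
def classA (d : ℕ) {N K : Type*} (f : N → Sph d → ℂ) (g : N → K → ℝ → ℂ)
    (a : N → K → ℝ) (k : K) : Set (Sp d → ℂ) :=
  {h | (∃ F ∈ spaceWk d f g k, F =ᵐ[ballMeasure d] h) ∧
    Summable fun n : N =>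
      ‖∫ x in ball 0 1, h x * starRingEnd ℂ (polarProd (g n k) (f n) x)‖ * a n k}

/-! ### Spherical harmonics -/

/-- Harmonic homogeneous polynomials of degree `ℓ` on `ℝ^d` with complex coefficients. -/
def harmonicPoly (d ℓ : ℕ) : Submodule ℂ (MvPolynomial (Fin d) ℂ) :=
  MvPolynomial.homogeneousSubmodule (Fin d) ℂ ℓ ⊓
    LinearMap.ker (∑ i : Fin d,
      (MvPolynomial.pderiv (R := ℂ) i).toLinearMap ∘ₗ (MvPolynomial.pderiv (R := ℂ) i).toLinearMap)

/-- Restriction of a polynomial to the unit sphere. -/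
def restrictSphere (d : ℕ) : MvPolynomial (Fin d) ℂ →ₗ[ℂ] (Sph d → ℂ) :=
  LinearMap.pi fun θ => (MvPolynomial.aeval fun i => (θ.1 i : ℂ)).toLinearMap

/-- The space `ℋ_ℓ` of spherical harmonics of degree `ℓ`. -/
def sphericalHarmonics (d ℓ : ℕ) : Submodule ℂ (Sph d → ℂ) :=
  (harmonicPoly d ℓ).map (restrictSphere d)

/-- The functions `f m` form an orthonormal basis of `ℋ_ℓ` with respect to the inner product of
`L²(∂B)`. -/
structure IsHarmonicONB (d ℓ : ℕ) {I : Type*} (f : I → Sph d → ℂ) : Prop where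
  span_eq : Submodule.span ℂ (range f) = sphericalHarmonics d ℓ
  orthonormal : IsOrthonormalSet (sphereMeasure d) f

/-! ### Zernike functions -/

/-- The constant `C_{ℓ,k} = (-1)^k √(2ℓ+4k+d) binom(ℓ+k+(d-2)/2, k)`, with the generalized binomial
coefficient `binom(x, k) = x (x-1) ⋯ (x-k+1) / k!`. -/
def zernikeC (d ℓ k : ℕ) : ℝ :=
  (-1) ^ k * √(2 * ℓ + 4 * k + d) * Ring.choose ((ℓ : ℝ) + k + ((d : ℝ) - 2) / 2) k

/-- The radial Zernike polynomial
`R_{ℓ,k}(r) = C_{ℓ,k} ∑_q (-1)^q binom(k,q) (ℓ+k+d/2)_q / (ℓ+d/2)_q r^(ℓ+2q)`. -/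
def zernikeR (d ℓ k : ℕ) (r : ℝ) : ℝ :=
  zernikeC d ℓ k * ∑ q ∈ Finset.range (k + 1),
    (-1) ^ q * (k.choose q : ℝ) *
      ((ascPochhammer ℝ q).eval ((ℓ : ℝ) + k + (d : ℝ) / 2) /
        (ascPochhammer ℝ q).eval ((ℓ : ℝ) + (d : ℝ) / 2)) * r ^ (ℓ + 2 * q)

/-- The angular functions, indexed by `n = (ℓ, m)`. -/
def angular {d : ℕ} {I : ℕ → Type*} (f : (ℓ : ℕ) → I ℓ → Sph d → ℂ) :
    (Σ ℓ, I ℓ) → Sph d → ℂ := fun n => f n.1 n.2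

/-- The radial functions `g_{n,k} = R_{ℓ,k}` for `n = (ℓ, m)`. -/
def radial (d : ℕ) (I : ℕ → Type*) : (Σ ℓ, I ℓ) → ℕ → ℝ → ℂ :=
  fun n k r => (zernikeR d n.1 k r : ℂ)

/-- The bounds `a_{n,k} = |C_{ℓ,k}| (dim ℋ_ℓ / |∂B|)^(1/2)` for `n = (ℓ, m)`. -/
def zernikeBound (d : ℕ) (I : ℕ → Type*) : (Σ ℓ, I ℓ) → ℕ → ℝ := fun n k =>
  |zernikeC d n.1 k| *
    √((Module.finrank ℂ (sphericalHarmonics d n.1) : ℝ) / (sphereMeasure d).real univ)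

end Calderon

end

open Calderon

/-! Radial functions. With `c = ℓ + d/2` and `p = ₂F₁(-k, c+k; c; ·)` one has `R_{ℓ,k}(r) = C_{ℓ,k}
r^ℓ p(r²)`. The coefficients of `p` are alternating binomials times the polynomial `(x)_k` at `x = c
+ q`. Hence its moments and its value at 1 are `k`-th finite differences, which yield orthonormality
(`integral_zernikeR_mul`) and `R_{ℓ,k}(1) = √(2ℓ+4k+d)` (`zernikeR_one`). Sonin's argument gives
`|p| ≤ 1` on `[0,1]`, where `c ≥ 1`, that is `d ≥ 2`, enters (`abs_eval_radPoly_le`).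

Angular functions. Every polynomial is a sum of terms `|x|^(2q) h` with `h` harmonic homogeneous
(`span_rsq_pow_mul_harmonic`). With Stone–Weierstrass this gives completeness on the sphere and,
because the `R_{ℓ,k}` are triangular in the powers `r^(ℓ+2q)`, in the ball (`spaceW_eq_top`).
Different degrees are orthogonal by a Green identity in which a weight vanishing at the boundary
replaces the boundary integral (`integral_sphere_mul_eq_zero`). The sum `∑ |f_m|²` over a basis of
`ℋ_ℓ` is rotation invariant, hence constant, which bounds each `f_m` (`IsHarmonicONB.norm_le`).

Interior stability. Let `h = γ₁ - γ₂` lie in the closed span of the `ψ_{n,k}` with `k` fixed. The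
`n`-th angular coefficient of `h` on the sphere of radius `r` is `⟨h, ψ_{n,k}⟩ R_{ℓ,k}(r)` for
almost every `r`. Both sides are continuous up to `r = 1`, so this holds on `∂B`
(`integral_sphere_mul_conj_eq`). Since `R_{ℓ,k}(1)² ≥ 4k + d`, Parseval in the ball and Bessel on
the sphere give `(4k+d) ‖h‖²_{L²(B)} ≤ ‖h‖²_{L²(∂B)} ≤ |∂B| ‖h‖²_∞`
(`eLpNorm_le_of_boundary_bound`). The boundary stability estimate bounds the last factor.

Boundary stability. Take a dipole potential with pole `(1+ε) x₀` just outside the ball, `|x₀| = 1`.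
It is harmonic in `B`, and as `ε → 0` its gradient concentrates at `x₀`. Hence the quadratic form of
`Λ(γ)` at its trace is `γ(x₀) ‖∇u‖²` up to a relatively small error (`norm_dtn_sub_le`,
`IsDipoleAt.exists_concentration`). As `‖u‖²_{H¹} ≤ 10 ‖∇u‖²`, comparing two conductivities shows
that 10 is a stability constant (`abs_sub_le_dtn`). -/

noncomputable section

namespace Calderon

/-! ### The Zernike radial polynomials -/

/-! ### Alternating binomial sums as finite differences -/

open Polynomial in
-- Up to the sign `(-1)^k` the sum is the `k`-th forward difference of `P` at `c`, and each
-- difference lowers the degree by one.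
lemma sum_alternating_choose_eval_eq_zero {k : ℕ} {P : ℝ[X]} (hP : P.natDegree < k) (c : ℝ) :
    ∑ q ∈ Finset.range (k + 1), (-1 : ℝ) ^ q * k.choose q * P.eval (c + q) = 0 := by
  have h := congrFun (P.fwdDiff_iter_eq_zero_of_degree_lt hP) c
  rw [fwdDiff_iter_eq_sum_shift] at h
  -- The forward difference carries the sign `(-1)^(k-q)` instead of `(-1)^q`; the two differ by the
  -- constant factor `(-1)^k`.
  have h2 : ∀ q ∈ Finset.range (k + 1), (-1 : ℝ) ^ q * k.choose q * P.eval (c + q) =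
      (-1) ^ k * (((-1 : ℤ) ^ (k - q) * (k.choose q : ℤ)) • P.eval (c + q • (1 : ℝ))) := by
    intro q hq
    have hq' : q ≤ k := Nat.lt_succ_iff.1 (Finset.mem_range.1 hq)
    have e : (-1 : ℝ) ^ k = (-1) ^ q * (-1) ^ (k - q) := by rw [← pow_add]; congr 1; omega
    have e2 : (-1 : ℝ) ^ (k - q) * (-1) ^ (k - q) = 1 := by rw [← mul_pow]; simp
    simp only [zsmul_eq_mul, nsmul_eq_mul, mul_one]
    push_cast
    rw [e]
    linear_combination (-(-1 : ℝ) ^ q * k.choose q * P.eval (c + q)) * e2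
  rw [Finset.sum_congr rfl h2, ← Finset.mul_sum, h]
  simp

open Polynomial in
-- The same difference at the critical degree: only the leading term survives, and it contributes
-- `k!`.
lemma sum_alternating_choose_eval_monic {k : ℕ} {P : ℝ[X]} (hP : P.natDegree = k) (hm : P.Monic)
    (c : ℝ) :
    ∑ q ∈ Finset.range (k + 1), (-1 : ℝ) ^ q * k.choose q * P.eval (c + q) =
      (-1) ^ k * k.factorial := by
  have h := congrFun P.fwdDiff_iter_degree_eq_factorial c
  rw [hP, hm.leadingCoeff, fwdDiff_iter_eq_sum_shift] at h
  have h2 : ∀ q ∈ Finset.range (k + 1), (-1 : ℝ) ^ q * k.choose q * P.eval (c + q) =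
      (-1) ^ k * (((-1 : ℤ) ^ (k - q) * (k.choose q : ℤ)) • P.eval (c + q • (1 : ℝ))) := by
    intro q hq
    have hq' : q ≤ k := Nat.lt_succ_iff.1 (Finset.mem_range.1 hq)
    have e : (-1 : ℝ) ^ k = (-1) ^ q * (-1) ^ (k - q) := by rw [← pow_add]; congr 1; omega
    have e2 : (-1 : ℝ) ^ (k - q) * (-1) ^ (k - q) = 1 := by rw [← mul_pow]; simp
    simp only [zsmul_eq_mul, nsmul_eq_mul, mul_one]
    push_cast
    rw [e]
    linear_combination (-(-1 : ℝ) ^ q * k.choose q * P.eval (c + q)) * e2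
  rw [Finset.sum_congr rfl h2, ← Finset.mul_sum, h]
  simp

/-! ### Rising factorials and the partial fractions of their reciprocals -/

/-- The rising factorial `(x)_n`. -/
abbrev asc (n : ℕ) (x : ℝ) : ℝ := (ascPochhammer ℝ n).eval x

@[simp] lemma asc_zero (x : ℝ) : asc 0 x = 1 := by simp [asc]

@[simp] lemma asc_one (x : ℝ) : asc 1 x = x := by simp [asc]

lemma asc_pos (n : ℕ) {x : ℝ} (hx : 0 < x) : 0 < asc n x := ascPochhammer_pos n x hx

lemma asc_add (m n : ℕ) (x : ℝ) : asc (m + n) x = asc m x * asc n (x + m) := by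
  have := congrArg (Polynomial.eval x) (ascPochhammer_mul ℝ m n)
  rw [asc, ← this]
  simp

lemma asc_succ_right (n : ℕ) (x : ℝ) : asc (n + 1) x = asc n x * (x + n) :=
  ascPochhammer_succ_eval n x

lemma asc_succ_left (n : ℕ) (x : ℝ) : asc (n + 1) x = x * asc n (x + 1) := by
  rw [add_comm, asc_add, asc_one, Nat.cast_one]

lemma fwdDiff_iter_inv (k : ℕ) : ∀ {y : ℝ}, 0 < y →
    (fwdDiff 1)^[k] (fun x : ℝ => x⁻¹) y = (-1) ^ k * k.factorial / asc (k + 1) y := by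
  induction k with
  | zero => intro y hy; rw [asc_one]; simp
  | succ k ih =>
    intro y hy
    rw [Function.iterate_succ_apply', fwdDiff, ih hy, ih (by linarith : 0 < y + 1)]
    have h1 := (asc_pos (k + 1) hy).ne'
    have h2 := (asc_pos (k + 1) (by linarith : 0 < y + 1)).ne'
    have h3 : asc (k + 1 + 1) y = asc (k + 1) y * (y + (k + 1)) := by
      rw [asc_succ_right]; push_cast; ring
    have h4 := asc_succ_left (k + 1) y
    have h5 : y + (k + 1) ≠ 0 := by positivity
    have h6 : asc (k + 1) (y + 1) = asc (k + 1) y * (y + (k + 1)) / y := by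
      rw [eq_div_iff hy.ne', ← h3, h4]; ring
    rw [h3, h6, Nat.factorial_succ]
    field_simp
    push_cast
    ring

/-- This is the partial fraction expansion of `k! / (y)_{k+1}`, obtained as the `k`-th difference of
`1/x`. -/
lemma sum_alternating_choose_div (k : ℕ) {y : ℝ} (hy : 0 < y) :
    ∑ q ∈ Finset.range (k + 1), (-1 : ℝ) ^ q * k.choose q / (y + q) =
      k.factorial / asc (k + 1) y := by
  have h := fwdDiff_iter_inv k hy
  rw [fwdDiff_iter_eq_sum_shift] at h
  have h2 : ∀ q ∈ Finset.range (k + 1), (-1 : ℝ) ^ q * k.choose q / (y + q) =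
      (-1) ^ k * (((-1 : ℤ) ^ (k - q) * (k.choose q : ℤ)) • (y + q • (1 : ℝ))⁻¹) := by
    intro q hq
    have hq' : q ≤ k := Nat.lt_succ_iff.1 (Finset.mem_range.1 hq)
    have e : (-1 : ℝ) ^ k = (-1) ^ q * (-1) ^ (k - q) := by rw [← pow_add]; congr 1; omega
    have e2 : (-1 : ℝ) ^ (k - q) * (-1) ^ (k - q) = 1 := by rw [← mul_pow]; simp
    simp only [zsmul_eq_mul, nsmul_eq_mul, mul_one]
    push_cast
    rw [e, div_eq_mul_inv]
    linear_combination (-(-1 : ℝ) ^ q * k.choose q * (y + q)⁻¹) * e2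
  rw [Finset.sum_congr rfl h2, ← Finset.mul_sum, h]
  have e3 : (-1 : ℝ) ^ k * (-1) ^ k = 1 := by rw [← mul_pow]; simp
  rw [← mul_div_assoc, ← mul_assoc, e3, one_mul]

/-! ### The hypergeometric polynomials: values, moments, differential equation, sup bound -/

/-- The coefficients of the hypergeometric polynomial `₂F₁(-k, c+k; c; t)`. -/
def radCoeff (c : ℝ) (k q : ℕ) : ℝ :=
  (-1) ^ q * (k.choose q : ℝ) * (asc q (c + k) / asc q c)

/-- The hypergeometric polynomial `₂F₁(-k, c+k; c; t)`. -/
def radPoly (c : ℝ) (k : ℕ) : Polynomial ℝ :=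
  ∑ q ∈ Finset.range (k + 1), Polynomial.monomial q (radCoeff c k q)

/-- Both `(c)_q (c+q)_k` and `(c)_k (c+k)_q` equal `(c)_{q+k}`. In this form the `q`-dependence is
an alternating binomial times a polynomial in `c + q`, as the finite difference sums require. -/
lemma radCoeff_eq {c : ℝ} (hc : 0 < c) (k q : ℕ) :
    radCoeff c k q = (-1) ^ q * (k.choose q : ℝ) * asc k (c + q) / asc k c := by
  have h1 := asc_add q k c
  rw [add_comm, asc_add] at h1
  have h2 := (asc_pos q hc).ne'
  have h3 := (asc_pos k hc).ne'
  have : asc q (c + k) / asc q c = asc k (c + q) / asc k c := by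
    rw [div_eq_div_iff h2 h3]; linarith
  rw [radCoeff, this]; ring

lemma radCoeff_eq_zero (c : ℝ) {k q : ℕ} (h : k < q) : radCoeff c k q = 0 := by
  simp [radCoeff, Nat.choose_eq_zero_of_lt h]

lemma radCoeff_self_ne_zero {c : ℝ} (hc : 0 < c) (k : ℕ) : radCoeff c k k ≠ 0 := by
  have h1 := (asc_pos k hc).ne'
  have h2 := (asc_pos k (by positivity : 0 < c + k)).ne'
  simp only [radCoeff, Nat.choose_self, Nat.cast_one, mul_one]
  exact mul_ne_zero (pow_ne_zero _ (by norm_num)) (div_ne_zero h2 h1)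

/-- The ratio of consecutive terms of the hypergeometric series, cleared of denominators; it is the
coefficient form of `radPoly_ode`. -/
lemma radCoeff_succ {c : ℝ} (hc : 0 < c) (k q : ℕ) :
    (q + 1) * (c + q) * radCoeff c k (q + 1) = -((k - q) * (c + k + q)) * radCoeff c k q := by
  have h1 := (asc_pos q hc).ne'
  have h2 : c + q ≠ 0 := by positivity
  rw [radCoeff, radCoeff, asc_succ_right, asc_succ_right]
  have h3 : ((k.choose (q + 1) : ℕ) : ℝ) * (q + 1) = k.choose q * (k - q) := by
    rcases le_or_gt q k with h | h
    · have := Nat.choose_succ_right_eq k q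
      rw [← Nat.cast_sub h]; exact_mod_cast this
    · rw [Nat.choose_eq_zero_of_lt h, Nat.choose_eq_zero_of_lt (by omega)]; simp
  field_simp
  rw [pow_succ]
  linear_combination (-(-1 : ℝ) ^ q * asc q (c + k)) * h3

lemma coeff_radPoly (c : ℝ) (k q : ℕ) : (radPoly c k).coeff q = radCoeff c k q := by
  rw [radPoly, Polynomial.finsetSum_coeff]
  simp only [Polynomial.coeff_monomial]
  rw [Finset.sum_ite_eq']
  split_ifs with h
  · rfl
  · rw [radCoeff_eq_zero]
    simpa using h

lemma eval_radPoly (c : ℝ) (k : ℕ) (t : ℝ) :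
    (radPoly c k).eval t = ∑ q ∈ Finset.range (k + 1), radCoeff c k q * t ^ q := by
  simp [radPoly, Polynomial.eval_finsetSum]

lemma eval_one_radPoly {c : ℝ} (hc : 0 < c) (k : ℕ) :
    (radPoly c k).eval 1 = (-1) ^ k * k.factorial / asc k c := by
  rw [eval_radPoly]
  simp only [one_pow, mul_one, radCoeff_eq hc]
  rw [← Finset.sum_div, sum_alternating_choose_eval_monic (ascPochhammer_natDegree ℝ k)
    (monic_ascPochhammer ℝ k)]

lemma eval_zero_radPoly (c : ℝ) (k : ℕ) : (radPoly c k).eval 0 = 1 := by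
  rw [← Polynomial.coeff_zero_eq_eval_zero, coeff_radPoly]
  simp [radCoeff, asc_zero]

open Polynomial in
-- Division of `(x)_k` by `x + j`, the remainder being the value at `-j`. It vanishes for `j < k`
-- and is `(-1)^k k!` for `j = k`, the two cases needed for the moments.
lemma exists_ascPochhammer_eq (k j : ℕ) (hk : 0 < k) : ∃ Q : ℝ[X], Q.natDegree < k ∧
    ∀ x : ℝ, asc k x = (x + j) * Q.eval x + asc k (-j) := by
  refine ⟨ascPochhammer ℝ k /ₘ (X - C (-(j : ℝ))), ?_, fun x => ?_⟩
  · rw [natDegree_divByMonic _ (monic_X_sub_C _), ascPochhammer_natDegree, natDegree_X_sub_C]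
    omega
  · have := congrArg (eval x) (modByMonic_add_div (ascPochhammer ℝ k) (X - C (-(j : ℝ))))
    rw [modByMonic_X_sub_C_eq_C_eval] at this
    simp only [eval_add, eval_mul, eval_sub, eval_X, eval_C] at this
    rw [asc, asc, ← this]
    ring

/-- As `-j` is a root of `(x)_k`, the quotient `(c+q)_k / (c+q+j)` is a polynomial of degree below
`k` in `c + q`, so its `k`-th difference is zero. The sum is the integral of `t^(c-1+j)` times the
hypergeometric polynomial over `[0,1]`. -/
lemma sum_radCoeff_div_of_lt {c : ℝ} (hc : 0 < c) {k j : ℕ} (hj : j < k) :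
    ∑ q ∈ Finset.range (k + 1), radCoeff c k q / (c + q + j) = 0 := by
  obtain ⟨Q, hQ, hQ2⟩ := exists_ascPochhammer_eq k j (by omega)
  have h0 : asc k (-j) = 0 := ascPochhammer_eval_neg_coe_nat_of_lt hj
  have h : ∀ q ∈ Finset.range (k + 1), radCoeff c k q / (c + q + j) =
      ((-1 : ℝ) ^ q * k.choose q * Q.eval (c + q)) / asc k c := by
    intro q _
    have h1 := (asc_pos k hc).ne'
    have h2 : c + q + j ≠ 0 := by positivity
    rw [radCoeff_eq hc, hQ2 (c + q), h0]
    field_simp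
    ring
  rw [Finset.sum_congr rfl h, ← Finset.sum_div, sum_alternating_choose_eval_eq_zero hQ, zero_div]

lemma asc_neg_self (k : ℕ) : asc k (-k) = (-1) ^ k * k.factorial := by
  rw [asc, ascPochhammer_eval_neg_eq_descPochhammer, descPochhammer_eval_eq_descFactorial,
    Nat.descFactorial_self]

/-- The first nonvanishing moment: the polynomial part of the quotient drops out as before, and the
remainder leaves the partial fraction sum at `y = c + k`. -/
lemma sum_radCoeff_div_self {c : ℝ} (hc : 0 < c) (k : ℕ) :
    ∑ q ∈ Finset.range (k + 1), radCoeff c k q / (c + q + k) =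
      (-1) ^ k * (k.factorial : ℝ) ^ 2 / (asc k c * asc (k + 1) (c + k)) := by
  rcases Nat.eq_zero_or_pos k with rfl | hk
  · rw [zero_add, asc_one, asc_zero]
    simp [radCoeff, asc_zero]
  obtain ⟨Q, hQ, hQ2⟩ := exists_ascPochhammer_eq k k hk
  have h1 := (asc_pos k hc).ne'
  have h : ∀ q ∈ Finset.range (k + 1), radCoeff c k q / (c + q + k) =
      ((-1 : ℝ) ^ q * k.choose q * Q.eval (c + q)) / asc k c +
      (-1) ^ k * k.factorial / asc k c * ((-1 : ℝ) ^ q * k.choose q / (c + k + q)) := by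
    intro q _
    have h2 : c + q + k ≠ 0 := by positivity
    have h3 : c + k + q ≠ 0 := by positivity
    rw [radCoeff_eq hc, hQ2 (c + q), asc_neg_self]
    field_simp
    ring
  rw [Finset.sum_congr rfl h, Finset.sum_add_distrib, ← Finset.sum_div,
    sum_alternating_choose_eval_eq_zero hQ, zero_div, zero_add, ← Finset.mul_sum,
    sum_alternating_choose_div k (by positivity)]
  have h4 := (asc_pos (k + 1) (by positivity : 0 < c + k)).ne'
  field_simp

open Polynomial in
-- The hypergeometric equation with parameters `-k` and `c + k`. Their sum is `c`, which makes the
-- coefficient of `t p'` equal to `-(c+1)`.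
lemma radPoly_ode {c : ℝ} (hc : 0 < c) (k : ℕ) :
    X * (1 - X) * derivative (derivative (radPoly c k)) +
      (C c - C (c + 1) * X) * derivative (radPoly c k) + C (k * (c + k)) * radPoly c k = 0 := by
  set p := radPoly c k with hp
  have e : X * (1 - X) * derivative (derivative p) +
      (C c - C (c + 1) * X) * derivative p + C (k * (c + k)) * p =
    X * derivative (derivative p) - X * (X * derivative (derivative p)) + C c * derivative p -
      C (c + 1) * (X * derivative p) + C (k * (c + k)) * p := by ring
  rw [e]
  ext n
  have key := radCoeff_succ hc k n
  -- The first two coefficients are separate because `X p''` and `X² p''` start at degrees 1 and 2.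
  rcases n with _ | _ | n
  · simp only [coeff_add, coeff_sub, coeff_X_mul_zero, coeff_C_mul, coeff_derivative, hp,
      coeff_radPoly, coeff_zero]
    push_cast at key ⊢
    linear_combination key
  · simp only [coeff_add, coeff_sub, coeff_X_mul_zero, coeff_X_mul, coeff_C_mul, coeff_derivative,
      hp, coeff_radPoly, coeff_zero]
    push_cast at key ⊢
    linear_combination key
  · simp only [coeff_add, coeff_sub, coeff_X_mul, coeff_C_mul, coeff_derivative, hp,
      coeff_radPoly, coeff_zero]
    push_cast at key ⊢
    linear_combination key

/-- Factor by factor comparison with `(1)_k = k!`. This gives `|p(1)| ≤ 1` and is where `c ≥ 1` is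
needed. -/
lemma factorial_le_asc (k : ℕ) {c : ℝ} (hc : 1 ≤ c) : (k.factorial : ℝ) ≤ asc k c := by
  induction k with
  | zero => rw [asc_zero]; simp
  | succ k ih =>
    rw [asc_succ_right, Nat.factorial_succ, mul_comm]
    push_cast
    refine mul_le_mul ih (by linarith) (by positivity) (asc_pos k (by linarith)).le

open Polynomial in
/-- Sonin's argument: `y² + t (1 - t) y'² / (k (c + k))` is largest at an end point of `[0, 1]`. -/
lemma abs_eval_radPoly_le {c : ℝ} (hc : 1 ≤ c) (k : ℕ) {t : ℝ} (ht : t ∈ Icc (0 : ℝ) 1) :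
    |(radPoly c k).eval t| ≤ 1 := by
  rcases Nat.eq_zero_or_pos k with rfl | hk
  · rw [eval_radPoly]; simp [radCoeff]
  have hc0 : 0 < c := by linarith
  have hlam : 0 < (k : ℝ) * (c + k) := by positivity
  set lam := (k : ℝ) * (c + k) with hlamdef
  set p := radPoly c k with hp
  set G : ℝ[X] := p ^ 2 + C lam⁻¹ * (X * (1 - X) * derivative p ^ 2) with hG
  have hode := radPoly_ode hc0 k
  rw [← hp, ← hlamdef] at hode
  -- The equation eliminates `p''`, and the factor `lam⁻¹` is chosen so that the terms in `p p'`
  -- cancel; what remains has the sign of `1 - 2c(1 - s)`.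
  have hG' : ∀ s, (derivative G).eval s =
      lam⁻¹ * (1 - 2 * c * (1 - s)) * ((derivative p).eval s) ^ 2 := by
    intro s
    have h := congrArg (eval s) hode
    simp only [eval_add, eval_sub, eval_mul, eval_X, eval_C, eval_one, eval_zero] at h
    simp only [hG, derivative_add, derivative_mul, derivative_pow, derivative_X, derivative_C,
      derivative_one, derivative_sub, eval_add, eval_sub, eval_mul, eval_X, eval_C, eval_one,
      eval_zero, eval_pow]
    have hl : lam⁻¹ * lam = 1 := inv_mul_cancel₀ hlam.ne'
    norm_num
    linear_combination (2 * lam⁻¹ * (derivative p).eval s) * h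
      - 2 * p.eval s * (derivative p).eval s * hl
  have hG0 : G.eval 0 = 1 := by
    simp [hG, hp, eval_zero_radPoly]
  have hG1 : G.eval 1 ≤ 1 := by
    have h1 := asc_pos k hc0
    have h2 := factorial_le_asc k hc
    have : |p.eval 1| ≤ 1 := by
      rw [hp, eval_one_radPoly hc0, abs_div, abs_mul, abs_pow, abs_of_pos h1]
      simp only [abs_neg, abs_one, one_pow, one_mul, Nat.abs_cast]
      exact (div_le_one h1).2 h2
    simp only [hG, eval_add, eval_sub, eval_mul, eval_X, eval_C, eval_one, eval_pow, sub_self,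
      mul_zero, zero_mul, add_zero]
    exact (sq_le_one_iff_abs_le_one _).2 this
  have hGt : G.eval t ≤ 1 := by
    -- The zero of that sign factor: `G` decreases before it and increases after it, so `G(0)` and
    -- `G(1)` bound it.
    set s := 1 - 1 / (2 * c) with hs
    have hs2 : 2 * c * (1 - s) = 1 := by rw [hs]; field_simp; ring
    rcases le_total t s with h | h
    · have : AntitoneOn (fun x => G.eval x) (Icc 0 s) := by
        refine antitoneOn_of_deriv_nonpos (convex_Icc _ _) G.continuous.continuousOn
          G.differentiable.differentiableOn fun x hx => ?_
        rw [interior_Icc] at hx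
        rw [Polynomial.deriv, hG']
        refine mul_nonpos_of_nonpos_of_nonneg
          (mul_nonpos_of_nonneg_of_nonpos (by positivity) ?_) (sq_nonneg _)
        nlinarith [hx.2]
      have := this (left_mem_Icc.2 (ht.1.trans h)) ⟨ht.1, h⟩ ht.1
      simpa [hG0] using this
    · have : MonotoneOn (fun x => G.eval x) (Icc s 1) := by
        refine monotoneOn_of_deriv_nonneg (convex_Icc _ _) G.continuous.continuousOn
          G.differentiable.differentiableOn fun x hx => ?_
        rw [interior_Icc] at hx
        rw [Polynomial.deriv, hG']
        refine mul_nonneg (mul_nonneg (by positivity) ?_) (sq_nonneg _)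
        nlinarith [hx.1]
      exact (this ⟨h, ht.2⟩ (right_mem_Icc.2 (h.trans ht.2)) ht.2).trans hG1
  have h3 : 0 ≤ lam⁻¹ * (t * (1 - t) * ((derivative p).eval t) ^ 2) := by
    have := mul_nonneg ht.1 (sub_nonneg.2 ht.2)
    positivity
  simp only [hG, eval_add, eval_sub, eval_mul, eval_X, eval_C, eval_one, eval_pow] at hGt
  exact (sq_le_one_iff_abs_le_one _).1 (by linarith)

/-! ### The radial Zernike functions: boundary value, sup bound, orthonormality -/

lemma zernikeR_eq (d ℓ k : ℕ) (r : ℝ) :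
    zernikeR d ℓ k r = zernikeC d ℓ k * (r ^ ℓ * (radPoly (ℓ + d / 2) k).eval (r ^ 2)) := by
  rw [zernikeR, eval_radPoly, Finset.mul_sum _ _ (r ^ ℓ)]
  refine congrArg (zernikeC d ℓ k * ·) (Finset.sum_congr rfl fun q _ => ?_)
  rw [radCoeff, pow_add, pow_mul r 2 q, add_right_comm (ℓ : ℝ)]
  ring

/-- The falling factorial of `x` with `k` factors is the rising factorial of `x - k + 1`, and here
`x - k + 1 = ℓ + d/2`. -/
lemma ringChoose_eq_asc (d ℓ k : ℕ) :
    Ring.choose ((ℓ : ℝ) + k + ((d : ℝ) - 2) / 2) k = asc k (ℓ + d / 2) / k.factorial := by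
  rw [Ring.choose_eq_smul, Polynomial.descPochhammer_smeval_eq_ascPochhammer,
    Polynomial.ascPochhammer_smeval_eq_eval, smul_eq_mul, asc,
    div_eq_inv_mul (Polynomial.eval _ _)]
  ring_nf

lemma sq_zernikeC (d ℓ k : ℕ) :
    zernikeC d ℓ k ^ 2 = (2 * ℓ + 4 * k + d) * (asc k (ℓ + d / 2) / k.factorial) ^ 2 := by
  rw [zernikeC, ringChoose_eq_asc, mul_pow, mul_pow, Real.sq_sqrt (by positivity), ← pow_mul,
    mul_comm k 2, pow_mul]
  simp

/-- The sign and the binomial coefficient in `C_{ℓ,k}` are the reciprocal of the value of the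
hypergeometric polynomial at 1, so only the square root is left. -/
lemma zernikeR_one {d : ℕ} (hd : 0 < d) (ℓ k : ℕ) :
    zernikeR d ℓ k 1 = √(2 * ℓ + 4 * k + d) := by
  have hc : (0 : ℝ) < ℓ + d / 2 := by positivity
  have h1 := (asc_pos k hc).ne'
  have h2 : (k.factorial : ℝ) ≠ 0 := by positivity
  have h3 : (-1 : ℝ) ^ k * (-1) ^ k = 1 := by rw [← mul_pow]; simp
  rw [zernikeR_eq, one_pow, one_pow, eval_one_radPoly hc, zernikeC, ringChoose_eq_asc]
  generalize asc k (ℓ + d / 2) = A at *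
  generalize √(2 * ℓ + 4 * k + d : ℝ) = B at *
  have h4 : (-1) ^ k * B * (A / k.factorial) * ((-1) ^ k * k.factorial / A) =
      ((-1 : ℝ) ^ k * (-1) ^ k) * B := by field_simp
  rw [one_mul, h4, h3, one_mul]

lemma zernikeC_ne_zero {d : ℕ} (hd : 0 < d) (ℓ k : ℕ) : zernikeC d ℓ k ≠ 0 := by
  have hc : (0 : ℝ) < ℓ + d / 2 := by positivity
  have h1 := (asc_pos k hc).ne'
  have h2 : (k.factorial : ℝ) ≠ 0 := by positivity
  have h3 : (2 * ℓ + 4 * k + d : ℝ) ≠ 0 := by positivity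
  rw [← pow_ne_zero_iff two_ne_zero, sq_zernikeC]
  positivity

lemma abs_zernikeR_le {d : ℕ} (hd : 2 ≤ d) (ℓ k : ℕ) {r : ℝ} (hr : r ∈ Icc (0 : ℝ) 1) :
    |zernikeR d ℓ k r| ≤ |zernikeC d ℓ k| := by
  have hd' : (2 : ℝ) ≤ d := by exact_mod_cast hd
  have hc : (1 : ℝ) ≤ ℓ + d / 2 := by
    have : (0 : ℝ) ≤ ℓ := by positivity
    linarith
  rw [zernikeR_eq, abs_mul, abs_mul]
  refine mul_le_of_le_one_right (abs_nonneg _) (mul_le_one₀ ?_ (abs_nonneg _) ?_)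
  · rw [abs_of_nonneg (pow_nonneg hr.1 _)]
    exact pow_le_one₀ hr.1 hr.2
  · exact abs_eval_radPoly_le hc k ⟨sq_nonneg _, pow_le_one₀ hr.1 hr.2⟩

lemma continuous_zernikeR (d ℓ k : ℕ) : Continuous (zernikeR d ℓ k) := by
  unfold zernikeR; fun_prop

lemma integral_radialMeasure (d : ℕ) {F : Type*} [NormedAddCommGroup F] [NormedSpace ℝ F]
    (f : ℝ → F) :
    ∫ r, f r ∂radialMeasure d = ∫ r in (0 : ℝ)..1, r ^ (d - 1) • f r := by
  rw [radialMeasure, integral_withDensity_eq_integral_toReal_smul (by fun_prop) (by simp),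
    intervalIntegral.integral_of_le zero_le_one, ← integral_Icc_eq_integral_Ioc]
  refine setIntegral_congr_fun measurableSet_Icc fun r hr => ?_
  simp [ENNReal.toReal_ofReal (pow_nonneg hr.1 _)]

instance (d : ℕ) : IsFiniteMeasure (radialMeasure d) := by
  refine isFiniteMeasure_withDensity_ofReal (f := fun r : ℝ => r ^ (d - 1)) ?_
  exact ((continuous_pow _).integrableOn_Icc).2

/-- The exponent `2ℓ + d - 1` collects the density `r^(d-1)` and the factor `r^ℓ` of each of two
radial functions. -/
lemma integral_pow_mul_radPoly {d : ℕ} (hd : 0 < d) (ℓ k j : ℕ) :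
    ∫ r in (0 : ℝ)..1, r ^ (2 * ℓ + d - 1) * ((radPoly (ℓ + d / 2) k).eval (r ^ 2) * r ^ (2 * j)) =
      (∑ q ∈ Finset.range (k + 1), radCoeff (ℓ + d / 2) k q / (ℓ + d / 2 + q + j)) / 2 := by
  have h : ∀ r : ℝ, r ^ (2 * ℓ + d - 1) *
      ((radPoly (ℓ + d / 2) k).eval (r ^ 2) * r ^ (2 * j)) =
      ∑ q ∈ Finset.range (k + 1), radCoeff (ℓ + d / 2) k q * r ^ (2 * ℓ + d - 1 + 2 * q + 2 * j) := by
    intro r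
    rw [eval_radPoly, Finset.sum_mul, Finset.mul_sum]
    refine Finset.sum_congr rfl fun q _ => ?_
    rw [pow_add, pow_add, pow_mul r 2 q]
    ring
  simp only [h]
  rw [intervalIntegral.integral_finsetSum fun q _ => by
    apply Continuous.intervalIntegrable; fun_prop, Finset.sum_div]
  refine Finset.sum_congr rfl fun q _ => ?_
  -- The natural subtraction is genuine because `d > 0`.
  have h1 : ((2 * ℓ + d - 1 + 2 * q + 2 * j : ℕ) : ℝ) + 1 = 2 * (ℓ + d / 2 + q + j) := by
    have : 2 * ℓ + d - 1 + 2 * q + 2 * j + 1 = 2 * ℓ + d + 2 * q + 2 * j := by omega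
    have h2 : ((2 * ℓ + d - 1 + 2 * q + 2 * j : ℕ) : ℝ) + 1 =
      ((2 * ℓ + d + 2 * q + 2 * j : ℕ) : ℝ) := by rw [← this]; push_cast; ring
    rw [h2]; push_cast; ring
  rw [intervalIntegral.integral_const_mul, integral_pow, h1]
  have h3 : (ℓ + d / 2 + q + j : ℝ) ≠ 0 := by positivity
  field_simp
  simp

lemma integral_radPoly_mul {d : ℕ} (hd : 0 < d) (ℓ k j : ℕ) :
    ∫ r in (0 : ℝ)..1, r ^ (2 * ℓ + d - 1) *
      ((radPoly (ℓ + d / 2) k).eval (r ^ 2) * (radPoly (ℓ + d / 2) j).eval (r ^ 2)) =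
      ∑ p ∈ Finset.range (j + 1), radCoeff (ℓ + d / 2) j p *
        ((∑ q ∈ Finset.range (k + 1), radCoeff (ℓ + d / 2) k q / (ℓ + d / 2 + q + p)) / 2) := by
  simp only [← integral_pow_mul_radPoly hd]
  simp only [← intervalIntegral.integral_const_mul]
  rw [← intervalIntegral.integral_finsetSum fun q _ => by
    apply Continuous.intervalIntegrable; fun_prop]
  refine intervalIntegral.integral_congr fun r _ => ?_
  simp only [eval_radPoly (_ : ℝ) j, Finset.mul_sum]
  refine Finset.sum_congr rfl fun q _ => ?_
  rw [pow_mul r 2 q]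
  ring

lemma integral_zernikeR_mul {d : ℕ} (hd : 0 < d) (ℓ k j : ℕ) :
    ∫ r in (0 : ℝ)..1, r ^ (d - 1) * (zernikeR d ℓ k r * zernikeR d ℓ j r) =
      if k = j then 1 else 0 := by
  wlog hjk : j ≤ k generalizing k j
  · have := this j k (by omega)
    simp only [mul_comm (zernikeR d ℓ k _)]
    rw [this]
    simp only [eq_comm]
  have h : ∀ r : ℝ, r ^ (d - 1) * (zernikeR d ℓ k r * zernikeR d ℓ j r) =
      zernikeC d ℓ k * zernikeC d ℓ j * (r ^ (2 * ℓ + d - 1) *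
      ((radPoly (ℓ + d / 2) k).eval (r ^ 2) * (radPoly (ℓ + d / 2) j).eval (r ^ 2))) := by
    intro r
    rw [zernikeR_eq, zernikeR_eq, Nat.add_sub_assoc hd, pow_add, two_mul, pow_add]
    ring
  have hc : (0 : ℝ) < ℓ + d / 2 := by positivity
  simp only [h]
  -- The polynomial of smaller index `j` is expanded in powers. Powers below `k` are orthogonal to
  -- the other polynomial, so only the top one can contribute, and only when `j = k`.
  rw [intervalIntegral.integral_const_mul, integral_radPoly_mul hd, Finset.sum_range_succ,
    Finset.sum_eq_zero, zero_add]
  · rcases hjk.eq_or_lt with rfl | hlt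
    · rw [sum_radCoeff_div_self hc, if_pos rfl, ← sq, sq_zernikeC, radCoeff, asc_succ_right]
      have h1 := (asc_pos j hc).ne'
      have h2 : (j.factorial : ℝ) ≠ 0 := by positivity
      have h3 : (-1 : ℝ) ^ j * (-1) ^ j = 1 := by rw [← mul_pow]; simp
      have h4 := (asc_pos j (by positivity : (0 : ℝ) < ℓ + d / 2 + j)).ne'
      have h5 : (ℓ + d / 2 + j + j : ℝ) ≠ 0 := by positivity
      rw [Nat.choose_self]
      have h6 : (2 * ℓ + 4 * j + d : ℝ) = 2 * (ℓ + d / 2 + j + j) := by ring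
      rw [h6]
      generalize asc j (ℓ + d / 2 + j) = A' at *
      generalize asc j (ℓ + d / 2) = A at *
      generalize (ℓ + d / 2 + j + j : ℝ) = B at *
      have h7 : 2 * B * (A / j.factorial) ^ 2 * ((-1) ^ j * (1 : ℕ) * (A' / A) *
          ((-1) ^ j * (j.factorial : ℝ) ^ 2 / (A * (A' * B)) / 2)) =
          (-1 : ℝ) ^ j * (-1) ^ j := by push_cast; field_simp
      rw [h7, h3]
    · rw [sum_radCoeff_div_of_lt hc hlt, if_neg hlt.ne']
      simp
  · intro p hp
    rw [sum_radCoeff_div_of_lt hc (lt_of_lt_of_le (Finset.mem_range.1 hp) hjk)]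
    simp

lemma isOrthonormalSet_zernikeR {d : ℕ} (hd : 0 < d) (ℓ : ℕ) :
    IsOrthonormalSet (radialMeasure d) fun k r => (zernikeR d ℓ k r : ℂ) := by
  have key : ∀ k j, ∫ r, (zernikeR d ℓ k r : ℂ) * starRingEnd ℂ (zernikeR d ℓ j r : ℂ)
      ∂radialMeasure d = if k = j then 1 else 0 := by
    intro k j
    rw [integral_radialMeasure]
    have h := integral_zernikeR_mul hd ℓ k j
    have h2 : ∀ r : ℝ, r ^ (d - 1) • ((zernikeR d ℓ k r : ℂ) * starRingEnd ℂ (zernikeR d ℓ j r : ℂ))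
        = ((r ^ (d - 1) * (zernikeR d ℓ k r * zernikeR d ℓ j r) : ℝ) : ℂ) := by
      intro r
      rw [Complex.conj_ofReal, Complex.real_smul]
      push_cast; ring
    simp only [h2]
    rw [intervalIntegral.integral_ofReal, h]
    split_ifs <;> simp
  refine ⟨fun k => ?_, fun k => by rw [key, if_pos rfl], fun k j h => by rw [key, if_neg h]⟩
  have hmem : ∀ᵐ r ∂radialMeasure d, r ∈ Icc (0 : ℝ) 1 :=
    (withDensity_absolutelyContinuous _ _).ae_le (ae_restrict_mem measurableSet_Icc)
  obtain ⟨M, hM⟩ := isCompact_Icc.exists_bound_of_continuousOn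
    (continuous_zernikeR d ℓ k).continuousOn (s := Icc (0 : ℝ) 1)
  refine MemLp.of_bound
    (Complex.continuous_ofReal.comp (continuous_zernikeR d ℓ k)).aestronglyMeasurable M ?_
  filter_upwards [hmem] with r hr
  simpa using hM r hr

/-! ### Polar coordinates -/

lemma map_val_volumeIoiPow (d : ℕ) :
    ((Measure.volumeIoiPow (d - 1)).restrict (Subtype.val ⁻¹' Iio 1)).map Subtype.val =
      radialMeasure d := by
  refine Measure.ext fun s hs => ?_
  have h1 : MeasurableSet (Subtype.val ⁻¹' s ∩ Subtype.val ⁻¹' Iio 1 : Set (Ioi (0 : ℝ))) :=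
    (measurable_subtype_coe hs).inter (measurable_subtype_coe measurableSet_Iio)
  rw [Measure.map_apply measurable_subtype_coe hs,
    Measure.restrict_apply (measurable_subtype_coe hs), Measure.volumeIoiPow,
    withDensity_apply _ h1,
    setLIntegral_subtype measurableSet_Ioi _ fun a : ℝ => ENNReal.ofReal (a ^ (d - 1)),
    radialMeasure, withDensity_apply _ hs, Measure.restrict_restrict hs,
    ← preimage_inter, Subtype.image_preimage_coe]
  refine setLIntegral_congr ?_
  have : Ioi (0 : ℝ) ∩ (s ∩ Iio 1) = s ∩ Ioo 0 1 := by
    ext x; simp only [mem_inter_iff, mem_Ioi, mem_Iio, mem_Ioo]; tauto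
  rw [this]
  -- The open and closed unit intervals differ by two points, a null set.
  exact (ae_eq_refl s).inter Ioo_ae_eq_Icc

/-- Polar coordinates `(θ, r) ↦ r θ`. -/
def polarMap (d : ℕ) (p : Sph d × ℝ) : Sp d := p.2 • (p.1 : Sp d)

lemma continuous_polarMap (d : ℕ) : Continuous (polarMap d) := by
  unfold polarMap; fun_prop

/-- The polar homeomorphism covers the complement of the origin, which is a null set; restriction to
the ball then amounts to `r < 1`. -/
lemma measurePreserving_polarMap (d : ℕ) (hd : 0 < d) :
    MeasurePreserving (polarMap d) ((sphereMeasure d).prod (radialMeasure d)) (ballMeasure d) := by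
  have hd' : Nonempty (Fin d) := ⟨⟨0, hd⟩⟩
  have h1 := (volume : Measure (Sp d)).measurePreserving_homeomorphUnitSphereProd
  have h2 : MeasurePreserving (homeomorphUnitSphereProd (Sp d)).symm
      ((volume : Measure (Sp d)).toSphere.prod (Measure.volumeIoiPow (d - 1)))
      ((volume : Measure (Sp d)).comap (↑)) := by
    rw [finrank_euclideanSpace_fin] at h1
    exact h1.symm (homeomorphUnitSphereProd (Sp d)).toMeasurableEquiv
  have h3 : MeasurePreserving (Subtype.val : ({(0 : Sp d)}ᶜ : Set (Sp d)) → Sp d)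
      ((volume : Measure (Sp d)).comap (↑)) (volume : Measure (Sp d)) := by
    have := measurePreserving_subtype_coe (μa := (volume : Measure (Sp d)))
      (measurableSet_singleton (0 : Sp d)).compl
    rwa [restrict_compl_singleton] at this
  have h4 := (h3.comp h2).restrict_preimage (s := ball 0 1) measurableSet_ball
  have h5 : (Subtype.val ∘ (homeomorphUnitSphereProd (Sp d)).symm) ⁻¹' ball (0 : Sp d) 1 =
      univ ×ˢ (Subtype.val ⁻¹' Iio 1) := by
    ext ⟨θ, r⟩
    have hr : (0 : ℝ) < r := r.2
    simp [norm_smul, abs_of_pos hr]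
  rw [h5, ← Measure.prod_restrict, Measure.restrict_univ] at h4
  refine ⟨(continuous_polarMap d).measurable, ?_⟩
  rw [show ballMeasure d = _ from h4.map_eq.symm, ← map_val_volumeIoiPow,
    ← Measure.map_id (μ := sphereMeasure d),
    Measure.map_prod_map _ _ measurable_id measurable_subtype_coe,
    Measure.map_map (continuous_polarMap d).measurable
      (measurable_id.prodMap measurable_subtype_coe)]
  rfl

lemma ae_radialMeasure (d : ℕ) : ∀ᵐ r ∂radialMeasure d, 0 < r ∧ r ≤ 1 := by
  refine (withDensity_absolutelyContinuous _ _).ae_le ?_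
  have h0 : ∀ᵐ r ∂(volume.restrict (Icc (0 : ℝ) 1)), r ≠ 0 :=
    Measure.ae_ne _ 0
  filter_upwards [ae_restrict_mem measurableSet_Icc, h0] with r hr hr0
  exact ⟨lt_of_le_of_ne hr.1 (Ne.symm hr0), hr.2⟩

lemma polarProd_smul {d : ℕ} (g : ℝ → ℂ) (f : Sph d → ℂ) (θ : Sph d) {r : ℝ} (hr : 0 < r) :
    polarProd g f (r • (θ : Sp d)) = g r * f θ := by
  have hθ : ‖(θ : Sp d)‖ = 1 := by simp
  have h0 : r • (θ : Sp d) ≠ 0 := by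
    rw [← norm_pos_iff, norm_smul, hθ]; simp [hr.ne']
  have hn : ‖r • (θ : Sp d)‖ = r := by rw [norm_smul, hθ]; simp [abs_of_pos hr]
  rw [polarProd, dif_neg h0]
  refine congrArg₂ (· * ·) (congrArg g hn) (congrArg f (Subtype.ext ?_))
  simp only [hn, smul_smul, inv_mul_cancel₀ hr.ne', one_smul]

lemma ae_polarProd_polarMap {d : ℕ} (g : ℝ → ℂ) (f : Sph d → ℂ) :
    ∀ᵐ p ∂(sphereMeasure d).prod (radialMeasure d),
      polarProd g f (polarMap d p) = g p.2 * f p.1 := by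
  have h := Measure.quasiMeasurePreserving_snd (μ := sphereMeasure d)
    (ν := radialMeasure d) |>.ae (ae_radialMeasure d)
  filter_upwards [h] with p hp
  exact polarProd_smul g f p.1 hp.1

lemma integral_polar {d : ℕ} (hd : 0 < d) {h : Sp d → ℂ}
    (hm : AEStronglyMeasurable h (ballMeasure d)) :
    ∫ x in ball 0 1, h x = ∫ p, h (polarMap d p) ∂(sphereMeasure d).prod (radialMeasure d) := by
  have hp := measurePreserving_polarMap d hd
  rw [← hp.map_eq] at hm
  rw [← integral_map hp.measurable.aemeasurable hm, hp.map_eq]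

lemma continuousOn_polarProd {d : ℕ} {g : ℝ → ℂ} {f : Sph d → ℂ} (hg : Continuous g)
    (hf : Continuous f) : ContinuousOn (polarProd g f) {0}ᶜ := by
  rw [continuousOn_iff_continuous_domRestrict]
  have h : ({0}ᶜ : Set (Sp d)).domRestrict (polarProd g f) = fun x : ({0}ᶜ : Set (Sp d)) =>
      g ‖(x : Sp d)‖ * f ((homeomorphUnitSphereProd (Sp d)) x).1 := by
    ext x
    have hx : (x : Sp d) ≠ 0 := x.2
    rw [domRestrict_apply, polarProd, dif_neg hx]
    refine congrArg (g ‖(x : Sp d)‖ * f ·) (Subtype.ext ?_)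
    simp
  rw [h]
  fun_prop

lemma aestronglyMeasurable_polarProd {d : ℕ} (hd : 0 < d) {g : ℝ → ℂ} {f : Sph d → ℂ}
    (hg : Continuous g) (hf : Continuous f) :
    AEStronglyMeasurable (polarProd g f) (ballMeasure d) := by
  have : Nonempty (Fin d) := ⟨⟨0, hd⟩⟩
  have h := (continuousOn_polarProd hg hf).aestronglyMeasurable
    (μ := (volume : Measure (Sp d))) (measurableSet_singleton 0).compl
  rw [restrict_compl_singleton] at h
  exact h.mono_measure Measure.restrict_le_self

lemma norm_polarProd_le {d : ℕ} {g : ℝ → ℂ} {f : Sph d → ℂ} {A M : ℝ}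
    (hA : ∀ r ∈ Icc (0 : ℝ) 1, ‖g r‖ ≤ A) (hM0 : 0 ≤ M) (hM : ∀ θ, ‖f θ‖ ≤ M) {x : Sp d}
    (hx : ‖x‖ ≤ 1) : ‖polarProd g f x‖ ≤ A * M := by
  have hA0 : 0 ≤ A := (norm_nonneg _).trans (hA 0 (by simp))
  rw [polarProd]
  split_ifs with h
  · simpa using mul_nonneg hA0 hM0
  · rw [norm_mul]
    exact mul_le_mul (hA _ ⟨norm_nonneg _, hx⟩) (hM _) (norm_nonneg _) hA0

instance (d : ℕ) : IsFiniteMeasure (ballMeasure d) :=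
  isFiniteMeasure_restrict.2 measure_ball_lt_top.ne

lemma memLp_polarProd {d : ℕ} (hd : 0 < d) {g : ℝ → ℂ} {f : Sph d → ℂ}
    (hg : Continuous g) (hf : Continuous f) (p : ℝ≥0∞) :
    MemLp (polarProd g f) p (ballMeasure d) := by
  obtain ⟨A, hA⟩ := isCompact_Icc.exists_bound_of_continuousOn hg.continuousOn
    (s := Icc (0 : ℝ) 1)
  obtain ⟨M, hM⟩ := isCompact_univ.exists_bound_of_continuousOn hf.continuousOn
  refine MemLp.of_bound (aestronglyMeasurable_polarProd hd hg hf) (A * max M 0) ?_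
  filter_upwards [ae_restrict_mem measurableSet_ball] with x hx
  exact norm_polarProd_le hA (le_max_right _ _)
    (fun θ => (hM θ (mem_univ _)).trans (le_max_left _ _)) (mem_ball_zero_iff.1 hx).le

lemma integral_polarProd_mul_conj {d : ℕ} (hd : 0 < d) {g g' : ℝ → ℂ} {f f' : Sph d → ℂ}
    (hg : Continuous g) (hf : Continuous f) (hg' : Continuous g') (hf' : Continuous f') :
    ∫ x in ball 0 1, polarProd g f x * starRingEnd ℂ (polarProd g' f' x) =
      (∫ θ, f θ * starRingEnd ℂ (f' θ) ∂sphereMeasure d) *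
        ∫ r, g r * starRingEnd ℂ (g' r) ∂radialMeasure d := by
  have hm : AEStronglyMeasurable (fun x => polarProd g f x * starRingEnd ℂ (polarProd g' f' x))
      (ballMeasure d) := (aestronglyMeasurable_polarProd hd hg hf).mul
    (Complex.continuous_conj.comp_aestronglyMeasurable (aestronglyMeasurable_polarProd hd hg' hf'))
  rw [integral_polar hd hm, ← integral_prod_mul]
  refine integral_congr_ae ?_
  filter_upwards [ae_polarProd_polarMap g f, ae_polarProd_polarMap g' f'] with p h1 h2
  rw [h1, h2, map_mul]
  ring

/-! ### Harmonic polynomials -/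

/-- The Laplacian of a polynomial. -/
def lap (d : ℕ) : MvPolynomial (Fin d) ℂ →ₗ[ℂ] MvPolynomial (Fin d) ℂ :=
  ∑ i : Fin d,
    (MvPolynomial.pderiv (R := ℂ) i).toLinearMap ∘ₗ (MvPolynomial.pderiv (R := ℂ) i).toLinearMap

lemma lap_apply {d : ℕ} (p : MvPolynomial (Fin d) ℂ) :
    lap d p = ∑ i, MvPolynomial.pderiv i (MvPolynomial.pderiv i p) := by
  simp [lap]

/-- The polynomial `|x|²`. -/
def rsq (d : ℕ) : MvPolynomial (Fin d) ℂ := ∑ i, MvPolynomial.X i ^ 2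

open MvPolynomial in
lemma isHomogeneous_rsq (d : ℕ) : (rsq d).IsHomogeneous 2 :=
  IsHomogeneous.sum _ _ _ fun i _ => isHomogeneous_X_pow i 2

open MvPolynomial in
lemma pderiv_rsq {d : ℕ} (i : Fin d) : pderiv i (rsq d) = 2 * X i := by
  rw [rsq, map_sum, Finset.sum_eq_single i]
  · rw [pderiv_pow, pderiv_X_self]; push_cast; ring
  · intro j _ hj
    rw [pderiv_pow, pderiv_X_of_ne hj]; ring
  · simp

open MvPolynomial in
-- The cross terms are `4 ∑ x_i ∂_i q = 4 m q` by Euler's identity, and `Δ|x|² = 2d`.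
lemma lap_rsq_mul {d m : ℕ} {q : MvPolynomial (Fin d) ℂ} (hq : q.IsHomogeneous m) :
    lap d (rsq d * q) = rsq d * lap d q + ((4 * m + 2 * d : ℕ) : ℂ) • q := by
  have h1 : ∀ i, pderiv i (pderiv i (rsq d * q)) =
      rsq d * pderiv i (pderiv i q) + 4 * (X i * pderiv i q) + 2 * q := by
    intro i
    have h2 : pderiv i (2 : MvPolynomial (Fin d) ℂ) = 0 := by
      rw [← map_ofNat (C : ℂ →+* MvPolynomial (Fin d) ℂ) 2, pderiv_C]
    rw [pderiv_mul, pderiv_rsq, map_add, pderiv_mul, pderiv_mul, pderiv_mul, pderiv_rsq,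
      pderiv_X_self, h2]
    ring
  rw [lap_apply, lap_apply]
  simp only [h1]
  rw [Finset.sum_add_distrib, Finset.sum_add_distrib, ← Finset.mul_sum, ← Finset.mul_sum,
    hq.sum_X_mul_pderiv, Finset.sum_const, Finset.card_univ, Fintype.card_fin, Nat.cast_smul_eq_nsmul]
  simp only [nsmul_eq_mul]
  push_cast
  ring

open MvPolynomial in
lemma isHomogeneous_lap {d m : ℕ} {q : MvPolynomial (Fin d) ℂ} (hq : q.IsHomogeneous m) :
    (lap d q).IsHomogeneous (m - 2) := by
  rw [lap_apply]
  exact IsHomogeneous.sum _ _ _ fun i _ => by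
    simpa [Nat.sub_sub] using (hq.pderiv (i := i)).pderiv (i := i)

/-- The operator `|x|² Δ` has no negative eigenvalue on homogeneous polynomials. -/
lemma eq_zero_of_rsq_mul_lap {d : ℕ} (hd : 0 < d) (m : ℕ) :
    ∀ (μ : ℕ), 0 < μ → ∀ q : MvPolynomial (Fin d) ℂ, q.IsHomogeneous m →
      rsq d * lap d q = -(μ : ℂ) • q → q = 0 := by
  induction m using Nat.strong_induction_on with
  | _ m ih =>
    intro μ hμ q hq h
    by_contra hq0
    have hμ' : (μ : ℂ) ≠ 0 := by exact_mod_cast hμ.ne'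
    -- The eigenvalue equation makes `q` divisible by `|x|²`, with quotient `q'`.
    set q' := (-(μ : ℂ)⁻¹) • lap d q with hq'
    have hqq' : q = rsq d * q' := by
      rw [hq', mul_smul_comm, h, smul_smul]
      simp [hμ']
    have hq'h : q'.IsHomogeneous (m - 2) :=
      (MvPolynomial.homogeneousSubmodule (Fin d) ℂ (m - 2)).smul_mem _ (isHomogeneous_lap hq)
    -- A nonzero multiple of `|x|²` has degree at least 2, so the truncated subtraction is harmless.
    have hm : m = 2 + (m - 2) := by
      refine hq.inj_right ?_ hq0
      rw [hqq']; exact (isHomogeneous_rsq d).mul hq'h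
    have h2 := lap_rsq_mul hq'h
    rw [← hqq'] at h2
    have h3 : lap d q = -(μ : ℂ) • q' := by
      rw [hq', smul_smul]; simp [hμ']
    have h4 : q' = 0 := by
      -- By `lap_rsq_mul` the quotient is again an eigenvector, of degree lower by 2 and with an
      -- eigenvalue that is still negative.
      refine ih (m - 2) (by omega) (μ + (4 * (m - 2) + 2 * d)) (by omega) q' hq'h ?_
      rw [h3] at h2
      rw [Nat.cast_add, neg_add, add_smul, neg_smul _ q', neg_smul _ q', ← sub_eq_add_neg,
        eq_sub_iff_add_eq, ← h2, neg_smul]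
    exact hq0 (by rw [hqq', h4, mul_zero])

open MvPolynomial in
lemma lap_eq_zero_of_lt {d m : ℕ} (hm : m < 2) {q : MvPolynomial (Fin d) ℂ}
    (hq : q.IsHomogeneous m) : lap d q = 0 := by
  have h0 : ∀ (p : MvPolynomial (Fin d) ℂ) (i : Fin d), p.IsHomogeneous 0 → pderiv i p = 0 := by
    intro p i hp
    rw [totalDegree_eq_zero_iff_eq_C.1 (Nat.le_zero.1 hp.totalDegree_le), pderiv_C]
  rw [lap_apply]
  refine Finset.sum_eq_zero fun i _ => h0 _ i ?_
  have := hq.pderiv (i := i)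
  rwa [show m - 1 = 0 by omega] at this

open MvPolynomial in
-- The map `q ↦ Δ(|x|² q)` preserves a finite-dimensional space of homogeneous polynomials. A kernel
-- element would be an eigenvector of `|x|² Δ` with eigenvalue `-(4m + 2d) < 0`, so the map is
-- injective and therefore onto.
lemma exists_lap_rsq_mul_eq {d : ℕ} (hd : 0 < d) (m : ℕ) {p : MvPolynomial (Fin d) ℂ}
    (hp : p.IsHomogeneous m) : ∃ q : MvPolynomial (Fin d) ℂ, q.IsHomogeneous m ∧
      lap d (rsq d * q) = p := by
  let V := homogeneousSubmodule (Fin d) ℂ m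
  have : FiniteDimensional ℂ V := Module.Finite.iff_fg.2 (homogeneousSubmodule_fg (Fin d) ℂ m)
  let T : V →ₗ[ℂ] V := LinearMap.restrict (lap d ∘ₗ LinearMap.mulLeft ℂ (rsq d)) (by
    intro q hq
    have := isHomogeneous_lap ((isHomogeneous_rsq d).mul (n := m) hq)
    rwa [Nat.add_sub_cancel_left] at this)
  have hT : Function.Injective T := by
    rw [injective_iff_map_eq_zero]
    intro q hq
    have h1 : lap d (rsq d * q) = 0 := congrArg Subtype.val hq
    rw [lap_rsq_mul (m := m) q.2] at h1
    refine Subtype.ext (eq_zero_of_rsq_mul_lap hd m (4 * m + 2 * d) (by omega) _ q.2 ?_)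
    rw [neg_smul]
    exact eq_neg_of_add_eq_zero_left h1
  obtain ⟨q, hq⟩ := LinearMap.injective_iff_surjective.1 hT ⟨p, hp⟩
  exact ⟨q, q.2, congrArg Subtype.val hq⟩

open MvPolynomial in
-- Solving `Δ(|x|² q) = Δp` makes `p - |x|² q` harmonic, and `q` has smaller degree.
lemma mem_span_rsq_pow_mul_harmonic {d : ℕ} (hd : 0 < d) (m : ℕ) :
    ∀ p : MvPolynomial (Fin d) ℂ, p.IsHomogeneous m →
      p ∈ Submodule.span ℂ {p : MvPolynomial (Fin d) ℂ |
        ∃ ℓ q h, h ∈ harmonicPoly d ℓ ∧ p = rsq d ^ q * h} := by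
  induction m using Nat.strong_induction_on with
  | _ m ih =>
    intro p hp
    rcases lt_or_ge m 2 with hm | hm
    · exact Submodule.subset_span ⟨m, 0, p, ⟨hp, lap_eq_zero_of_lt hm hp⟩, by simp⟩
    obtain ⟨q, hq, hq2⟩ := exists_lap_rsq_mul_eq hd (m - 2) (isHomogeneous_lap hp)
    have h1 := ih (m - 2) (by omega) q hq
    have h2 : rsq d * q ∈ Submodule.span ℂ {p : MvPolynomial (Fin d) ℂ |
        ∃ ℓ q h, h ∈ harmonicPoly d ℓ ∧ p = rsq d ^ q * h} := by
      refine Submodule.span_induction (p := fun q _ => rsq d * q ∈ Submodule.span ℂ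
        {p : MvPolynomial (Fin d) ℂ | ∃ ℓ q h, h ∈ harmonicPoly d ℓ ∧ p = rsq d ^ q * h})
        ?_ ?_ ?_ ?_ h1
      · rintro _ ⟨ℓ, j, h, hh, rfl⟩
        exact Submodule.subset_span ⟨ℓ, j + 1, h, hh, by ring⟩
      · simp
      · intro x y _ _ hx hy
        rw [mul_add]; exact add_mem hx hy
      · intro c x _ hx
        rw [mul_smul_comm]; exact Submodule.smul_mem _ c hx
    have h3 : p - rsq d * q ∈ harmonicPoly d m := by
      refine ⟨hp.sub ?_, ?_⟩
      · have := (isHomogeneous_rsq d).mul hq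
        rwa [show 2 + (m - 2) = m by omega] at this
      · show lap d (p - rsq d * q) = 0
        rw [map_sub, hq2, sub_self]
    have h4 := Submodule.subset_span (R := ℂ) (s := {p : MvPolynomial (Fin d) ℂ |
        ∃ ℓ q h, h ∈ harmonicPoly d ℓ ∧ p = rsq d ^ q * h}) ⟨m, 0, _, h3, by simp; rfl⟩
    have := add_mem h4 h2
    rwa [sub_add_cancel] at this

open MvPolynomial in
/-- Every polynomial is a sum of products of powers of `|x|²` and harmonic homogeneous
polynomials. -/
lemma span_rsq_pow_mul_harmonic {d : ℕ} (hd : 0 < d) :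
    Submodule.span ℂ {p : MvPolynomial (Fin d) ℂ |
        ∃ ℓ q h, h ∈ harmonicPoly d ℓ ∧ p = rsq d ^ q * h} = ⊤ := by
  refine eq_top_iff.2 fun p _ => ?_
  rw [← sum_homogeneousComponent p]
  exact Submodule.sum_mem _ fun i _ =>
    mem_span_rsq_pow_mul_harmonic hd i _ (homogeneousComponent_isHomogeneous i p)

/-! ### Polynomial functions -/

/-- The function on `ℝ^d` defined by a polynomial. -/
def evalP {d : ℕ} (p : MvPolynomial (Fin d) ℂ) (x : Sp d) : ℂ :=
  MvPolynomial.aeval (fun i => (x i : ℂ)) p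

lemma restrictSphere_apply {d : ℕ} (p : MvPolynomial (Fin d) ℂ) (θ : Sph d) :
    restrictSphere d p θ = evalP p θ := rfl

lemma evalP_add {d : ℕ} (p q : MvPolynomial (Fin d) ℂ) (x : Sp d) :
    evalP (p + q) x = evalP p x + evalP q x := map_add _ p q

lemma evalP_mul {d : ℕ} (p q : MvPolynomial (Fin d) ℂ) (x : Sp d) :
    evalP (p * q) x = evalP p x * evalP q x := map_mul _ p q

lemma evalP_C {d : ℕ} (c : ℂ) (x : Sp d) : evalP (MvPolynomial.C c) x = c :=
  MvPolynomial.aeval_C _ c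

lemma evalP_X {d : ℕ} (i : Fin d) (x : Sp d) : evalP (MvPolynomial.X i) x = (x i : ℂ) :=
  MvPolynomial.aeval_X _ i

lemma evalP_sum {d : ℕ} {ι : Type*} (s : Finset ι) (p : ι → MvPolynomial (Fin d) ℂ) (x : Sp d) :
    evalP (∑ i ∈ s, p i) x = ∑ i ∈ s, evalP (p i) x := map_sum _ p s

lemma evalP_pow {d : ℕ} (p : MvPolynomial (Fin d) ℂ) (n : ℕ) (x : Sp d) :
    evalP (p ^ n) x = evalP p x ^ n := map_pow _ p n

lemma evalP_rsq {d : ℕ} (x : Sp d) : evalP (rsq d) x = (‖x‖ : ℂ) ^ 2 := by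
  rw [rsq, evalP_sum, ← Complex.ofReal_pow, EuclideanSpace.norm_sq_eq]
  push_cast
  exact Finset.sum_congr rfl fun i _ => by
    rw [evalP_pow, evalP_X, ← Complex.ofReal_pow, ← Complex.ofReal_pow, Real.norm_eq_abs, sq_abs]

lemma contDiff_evalP {d : ℕ} (p : MvPolynomial (Fin d) ℂ) : ContDiff ℝ ∞ (evalP p) := by
  induction p using MvPolynomial.induction_on with
  | C a => simp only [show evalP (MvPolynomial.C a) = fun _ : Sp d => a from funext (evalP_C a)]
           exact contDiff_const
  | add p q hp hq =>
    rw [show evalP (p + q) = fun x => evalP p x + evalP q x from funext (evalP_add p q)]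
    exact hp.add hq
  | mul_X p i hp =>
    rw [show evalP (p * MvPolynomial.X i) = fun x => evalP p x * (x i : ℂ) from
      funext fun x => by rw [evalP_mul, evalP_X]]
    exact hp.mul (Complex.ofRealCLM.contDiff.comp (EuclideanSpace.proj (𝕜 := ℝ) i).contDiff)

lemma continuous_evalP {d : ℕ} (p : MvPolynomial (Fin d) ℂ) : Continuous (evalP p) :=
  (contDiff_evalP p).continuous

lemma differentiable_evalP {d : ℕ} (p : MvPolynomial (Fin d) ℂ) : Differentiable ℝ (evalP p) :=
  (contDiff_evalP p).differentiable (by simp)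

lemma pd_evalP {d : ℕ} (p : MvPolynomial (Fin d) ℂ) (i : Fin d) (x : Sp d) :
    pd i (evalP p) x = evalP (MvPolynomial.pderiv i p) x := by
  induction p using MvPolynomial.induction_on with
  | C a =>
    rw [show evalP (MvPolynomial.C a) = fun _ : Sp d => a from funext (evalP_C a)]
    simp [pd, evalP]
  | add p q hp hq =>
    rw [show evalP (p + q) = evalP p + evalP q from funext (evalP_add p q), map_add, evalP_add,
      ← hp, ← hq, pd, fderiv_add (differentiable_evalP p x) (differentiable_evalP q x)]
    rfl
  | mul_X p j hp =>
    have hX : HasFDerivAt (evalP (MvPolynomial.X j : MvPolynomial (Fin d) ℂ))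
        (Complex.ofRealCLM.comp (EuclideanSpace.proj (𝕜 := ℝ) j)) x := by
      refine (Complex.ofRealCLM.comp (EuclideanSpace.proj (𝕜 := ℝ) j)).hasFDerivAt.congr_of_eventuallyEq
        (.of_forall fun y => evalP_X j y)
    have h := (differentiable_evalP p x).hasFDerivAt.mul hX
    rw [show evalP (p * MvPolynomial.X j) = evalP p * evalP (MvPolynomial.X j) from
      funext (evalP_mul p _), pd, h.fderiv, MvPolynomial.pderiv_mul, evalP_add, evalP_mul, evalP_mul,
      ← hp]
    simp only [add_apply, smul_apply, pd,
      smul_eq_mul, ContinuousLinearMap.comp_apply, MvPolynomial.pderiv_X]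
    by_cases hij : j = i
    · subst hij; simp [evalP]; ring
    · simp [evalP, hij]; ring

lemma evalP_smul {d ℓ : ℕ} {p : MvPolynomial (Fin d) ℂ} (hp : p.IsHomogeneous ℓ) (r : ℝ)
    (x : Sp d) : evalP p (r • x) = (r : ℂ) ^ ℓ * evalP p x := by
  rw [evalP, evalP, MvPolynomial.aeval_def, MvPolynomial.aeval_def, MvPolynomial.eval₂_eq',
    MvPolynomial.eval₂_eq', Finset.mul_sum]
  refine Finset.sum_congr rfl fun m hm => ?_
  have h : ∑ i, m i = ℓ := by
    rw [← Finsupp.degree_eq_sum]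
    by_contra h
    exact MvPolynomial.mem_support_iff.1 hm (hp.coeff_eq_zero h)
  simp only [PiLp.smul_apply, smul_eq_mul, Complex.ofReal_mul, mul_pow, Finset.prod_mul_distrib]
  rw [Finset.prod_pow_eq_pow_sum, h]
  ring

/-- Complex conjugation of the coefficients. -/
def conjP {d : ℕ} (p : MvPolynomial (Fin d) ℂ) : MvPolynomial (Fin d) ℂ :=
  MvPolynomial.map (starRingEnd ℂ) p

lemma evalP_conjP {d : ℕ} (p : MvPolynomial (Fin d) ℂ) (x : Sp d) :
    evalP (conjP p) x = starRingEnd ℂ (evalP p x) := by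
  induction p using MvPolynomial.induction_on with
  | C a => rw [conjP, MvPolynomial.map_C, evalP_C, evalP_C]
  | add p q hp hq => rw [conjP, map_add, evalP_add, evalP_add, map_add, ← hp, ← hq]; rfl
  | mul_X p i hp =>
    rw [conjP, map_mul, MvPolynomial.map_X, evalP_mul, evalP_mul, evalP_X, map_mul, ← hp,
      Complex.conj_ofReal]; rfl

lemma conjP_mem_harmonicPoly {d ℓ : ℕ} {p : MvPolynomial (Fin d) ℂ} (hp : p ∈ harmonicPoly d ℓ) :
    conjP p ∈ harmonicPoly d ℓ := by
  refine ⟨hp.1.map _, ?_⟩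
  show lap d _ = 0
  rw [lap_apply]
  simp only [conjP, MvPolynomial.pderiv_map]
  have h := hp.2
  rw [← map_sum, ← lap_apply, show lap d p = 0 from h, map_zero]

/-! ### Orthogonality of spherical harmonics of different degrees -/

/-- Squaring the positive part removes its kink; this is why `ballWeight` is a square and can be
differentiated across the unit sphere. -/
lemma hasDerivAt_sq_max_zero (t : ℝ) :
    HasDerivAt (fun s : ℝ => (max s 0) ^ 2) (2 * max t 0) t := by
  rcases lt_trichotomy t 0 with ht | rfl | ht
  · rw [max_eq_right ht.le, mul_zero]
    refine (hasDerivAt_const t (0 : ℝ)).congr_of_eventuallyEq ?_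
    filter_upwards [Iio_mem_nhds ht] with s hs
    rw [max_eq_right (le_of_lt hs)]; simp
  · rw [max_self, mul_zero, hasDerivAt_iff_isLittleO_nhds_zero]
    simp only [zero_add, max_self, ne_eq, OfNat.ofNat_ne_zero, not_false_eq_true, zero_pow,
      sub_zero, smul_zero]
    refine (Asymptotics.IsBigO.of_bound 1 (.of_forall fun s => ?_)).trans_isLittleO
      (Asymptotics.isLittleO_pow_id one_lt_two)
    rw [one_mul, norm_pow, norm_pow, Real.norm_eq_abs, Real.norm_eq_abs]
    refine pow_le_pow_left₀ (abs_nonneg _) ?_ 2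
    rw [abs_of_nonneg (le_max_right _ _)]
    exact max_le (le_abs_self s) (abs_nonneg s)
  · rw [max_eq_left ht.le]
    have := (hasDerivAt_pow 2 t)
    simp only [Nat.cast_ofNat, Nat.add_one_sub_one, pow_one] at this
    refine this.congr_of_eventuallyEq ?_
    filter_upwards [Ioi_mem_nhds ht] with s hs
    rw [max_eq_left (le_of_lt hs)]

/-- The weight `((1 - |x|²)₊)²`. -/
def ballWeight {d : ℕ} (x : Sp d) : ℂ := (((max (1 - ‖x‖ ^ 2) 0) ^ 2 : ℝ) : ℂ)

/-- The factor `-4 (1 - |x|²)₊` in the gradient of `ballWeight`. -/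
def ballWeight' {d : ℕ} (x : Sp d) : ℂ := ((-4 * max (1 - ‖x‖ ^ 2) 0 : ℝ) : ℂ)

lemma hasFDerivAt_ballWeight {d : ℕ} (x : Sp d) : HasFDerivAt (ballWeight (d := d))
    (Complex.ofRealCLM.comp ((2 * max (1 - ‖x‖ ^ 2) 0) • -(2 • innerSL ℝ x))) x := by
  have h1 : HasFDerivAt (fun y : Sp d => 1 - ‖y‖ ^ 2) (-(2 • innerSL ℝ x)) x := by
    have := ((hasFDerivAt_id x).norm_sq).const_sub (1 : ℝ)
    simpa using this
  have h2 : HasFDerivAt (fun y : Sp d => (max (1 - ‖y‖ ^ 2) 0) ^ 2)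
      ((2 * max (1 - ‖x‖ ^ 2) 0) • (-(2 • innerSL ℝ x) : Sp d →L[ℝ] ℝ)) x :=
    HasDerivAt.comp_hasFDerivAt (h₂ := fun s : ℝ => (max s 0) ^ 2) x
      (hasDerivAt_sq_max_zero (1 - ‖x‖ ^ 2)) h1
  exact Complex.ofRealCLM.hasFDerivAt.comp x h2

lemma pd_ballWeight {d : ℕ} (i : Fin d) (x : Sp d) :
    pd i (ballWeight (d := d)) x = ballWeight' x * (x i : ℂ) := by
  rw [pd, (hasFDerivAt_ballWeight x).fderiv]
  simp only [ContinuousLinearMap.comp_apply, smul_apply, neg_apply, innerSL_apply_apply,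
    EuclideanSpace.inner_single_right, ballWeight', Complex.ofRealCLM_apply]
  simp
  ring

lemma continuous_ballWeight (d : ℕ) : Continuous (ballWeight (d := d)) := by
  unfold ballWeight; fun_prop

lemma continuous_ballWeight' (d : ℕ) : Continuous (ballWeight' (d := d)) := by
  unfold ballWeight'; fun_prop

lemma ballWeight_eq_zero {d : ℕ} {x : Sp d} (hx : x ∉ ball (0 : Sp d) 1) : ballWeight x = 0 := by
  have : 1 ≤ ‖x‖ := by simpa using hx
  have h2 : 1 - ‖x‖ ^ 2 ≤ 0 := by nlinarith
  simp [ballWeight, max_eq_right h2]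

lemma ballWeight'_eq_zero {d : ℕ} {x : Sp d} (hx : x ∉ ball (0 : Sp d) 1) :
    ballWeight' x = 0 := by
  have : 1 ≤ ‖x‖ := by simpa using hx
  have h2 : 1 - ‖x‖ ^ 2 ≤ 0 := by nlinarith
  simp [ballWeight', max_eq_right h2]

lemma hasCompactSupport_ballWeight (d : ℕ) : HasCompactSupport (ballWeight (d := d)) :=
  HasCompactSupport.intro (isCompact_closedBall (0 : Sp d) 1) fun _ hx =>
    ballWeight_eq_zero fun h => hx (ball_subset_closedBall h)

lemma hasCompactSupport_ballWeight' (d : ℕ) : HasCompactSupport (ballWeight' (d := d)) :=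
  HasCompactSupport.intro (isCompact_closedBall (0 : Sp d) 1) fun _ hx =>
    ballWeight'_eq_zero fun h => hx (ball_subset_closedBall h)

/-- Integration by parts over the whole space; the compactly supported weight leaves no boundary
term. -/
lemma integral_ballWeight_pd_mul_pd {d : ℕ} (p q : MvPolynomial (Fin d) ℂ) (i : Fin d) :
    ∫ x : Sp d, evalP p x * (ballWeight' x * (x i : ℂ) * evalP (MvPolynomial.pderiv i q) x +
      ballWeight x * evalP (MvPolynomial.pderiv i (MvPolynomial.pderiv i q)) x) =
    - ∫ x : Sp d, evalP (MvPolynomial.pderiv i p) x *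
      (ballWeight x * evalP (MvPolynomial.pderiv i q) x) := by
  have hW := continuous_ballWeight d
  have hW' := continuous_ballWeight' d
  have hci : Continuous fun x : Sp d => (x i : ℂ) :=
    Complex.continuous_ofReal.comp (EuclideanSpace.proj (𝕜 := ℝ) i).continuous
  have hg : ∀ x, HasFDerivAt (fun x => ballWeight x * evalP (MvPolynomial.pderiv i q) x)
      _ x := fun x => (hasFDerivAt_ballWeight x).mul
        (differentiable_evalP (MvPolynomial.pderiv i q) x).hasFDerivAt
  have hpd : ∀ x : Sp d, fderiv ℝ (fun x => ballWeight x * evalP (MvPolynomial.pderiv i q) x) x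
      (EuclideanSpace.single i 1) =
      ballWeight' x * (x i : ℂ) * evalP (MvPolynomial.pderiv i q) x +
      ballWeight x * evalP (MvPolynomial.pderiv i (MvPolynomial.pderiv i q)) x := by
    intro x
    rw [(hg x).fderiv, ← pd_ballWeight, ← pd_evalP (MvPolynomial.pderiv i q), pd, pd,
      (hasFDerivAt_ballWeight x).fderiv]
    simp only [add_apply, smul_apply, smul_eq_mul]
    ring
  have hpd2 : ∀ x : Sp d, fderiv ℝ (evalP p) x (EuclideanSpace.single i 1) =
    evalP (MvPolynomial.pderiv i p) x := pd_evalP p i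
  have key := integral_mul_fderiv_eq_neg_fderiv_mul_of_integrable (μ := (volume : Measure (Sp d)))
    (f := evalP p) (g := fun x => ballWeight x * evalP (MvPolynomial.pderiv i q) x)
    (v := EuclideanSpace.single i 1) ?_ ?_ ?_ (fun x _ => differentiable_evalP p x)
    (fun x _ => (hg x).differentiableAt)
  · simpa only [hpd, hpd2] using key
  · simp only [hpd2]
    refine Continuous.integrable_of_hasCompactSupport ?_ ?_
    · exact (continuous_evalP _).mul (hW.mul (continuous_evalP _))
    · exact (hasCompactSupport_ballWeight d).mul_right.mul_left
  · simp only [hpd]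
    refine Continuous.integrable_of_hasCompactSupport ?_ ?_
    · exact (continuous_evalP _).mul (((hW'.mul hci).mul (continuous_evalP _)).add
        (hW.mul (continuous_evalP _)))
    · exact (((hasCompactSupport_ballWeight' d).mul_right.mul_right).add
        (hasCompactSupport_ballWeight d).mul_right).mul_left
  · refine Continuous.integrable_of_hasCompactSupport ?_ ?_
    · exact (continuous_evalP _).mul (hW.mul (continuous_evalP _))
    · exact (hasCompactSupport_ballWeight d).mul_right.mul_left

/-- A weighted Green formula. After summation over `i`, the derivative of the weight produces the
Euler field, which acts on `q` as `ℓ`, and the other term contains `Δq = 0`. The right side is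
symmetric in `p` and `q`. -/
lemma degree_mul_integral_ballWeight' {d ℓ : ℕ} (p : MvPolynomial (Fin d) ℂ)
    {q : MvPolynomial (Fin d) ℂ} (hq : q ∈ harmonicPoly d ℓ) :
    ℓ * ∫ x : Sp d, ballWeight' x * (evalP p x * evalP q x) =
      - ∑ i, ∫ x : Sp d, evalP (MvPolynomial.pderiv i p) x *
      (ballWeight x * evalP (MvPolynomial.pderiv i q) x) := by
  have hW := continuous_ballWeight d
  have hW' := continuous_ballWeight' d
  simp only [← Finset.sum_neg_distrib, ← integral_ballWeight_pd_mul_pd]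
  rw [← integral_finsetSum, ← integral_const_mul]
  · refine integral_congr_ae (.of_forall fun x => ?_)
    have h1 := congrArg (evalP · x) hq.1.sum_X_mul_pderiv
    have h2 := congrArg (evalP · x) (show lap d q = 0 from hq.2)
    simp only [lap_apply, evalP_sum, evalP_mul, evalP_X, nsmul_eq_mul] at h1 h2
    have h3 : evalP ((ℓ : MvPolynomial (Fin d) ℂ)) x = ℓ := by simp [evalP]
    have h4 : evalP (0 : MvPolynomial (Fin d) ℂ) x = 0 := by simp [evalP]
    rw [h3] at h1
    rw [h4] at h2
    have e : ∀ i, evalP p x * (ballWeight' x * (x i : ℂ) * evalP (MvPolynomial.pderiv i q) x +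
        ballWeight x * evalP (MvPolynomial.pderiv i (MvPolynomial.pderiv i q)) x) =
        evalP p x * ballWeight' x * ((x i : ℂ) * evalP (MvPolynomial.pderiv i q) x) +
        evalP p x * ballWeight x *
          evalP (MvPolynomial.pderiv i (MvPolynomial.pderiv i q)) x := fun i => by ring
    simp only [e]
    rw [Finset.sum_add_distrib, ← Finset.mul_sum, ← Finset.mul_sum, h1, h2]
    ring
  · intro i _
    have hci : Continuous fun x : Sp d => (x i : ℂ) :=
      Complex.continuous_ofReal.comp (EuclideanSpace.proj (𝕜 := ℝ) i).continuous
    refine Continuous.integrable_of_hasCompactSupport ?_ ?_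
    · exact (continuous_evalP _).mul (((hW'.mul hci).mul (continuous_evalP _)).add
        (hW.mul (continuous_evalP _)))
    · exact (((hasCompactSupport_ballWeight' d).mul_right.mul_right).add
        (hasCompactSupport_ballWeight d).mul_right).mul_left

lemma integral_ballWeight'_polar {d ℓ ℓ' : ℕ} (hd : 0 < d) {p q : MvPolynomial (Fin d) ℂ}
    (hp : p.IsHomogeneous ℓ) (hq : q.IsHomogeneous ℓ') :
    ∫ x : Sp d, ballWeight' x * (evalP p x * evalP q x) =
      (∫ θ, evalP p (θ : Sph d) * evalP q (θ : Sph d) ∂sphereMeasure d) *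
        ∫ r, ((-4 * (1 - r ^ 2) * r ^ (ℓ + ℓ') : ℝ) : ℂ) ∂radialMeasure d := by
  have hc : Continuous fun x : Sp d => ballWeight' x * (evalP p x * evalP q x) :=
    (continuous_ballWeight' d).mul ((continuous_evalP p).mul (continuous_evalP q))
  rw [← setIntegral_eq_integral_of_forall_compl_eq_zero (s := ball (0 : Sp d) 1)
    (fun x hx => by rw [ballWeight'_eq_zero hx, zero_mul]),
    integral_polar hd hc.aestronglyMeasurable, ← integral_prod_mul]
  refine integral_congr_ae ?_
  have h := Measure.quasiMeasurePreserving_snd (μ := sphereMeasure d)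
    (ν := radialMeasure d) |>.ae (ae_radialMeasure d)
  filter_upwards [h] with y hy
  have hn : ‖polarMap d y‖ = y.2 := by rw [polarMap, norm_smul]; simp [abs_of_pos hy.1]
  have h0 : (0 : ℝ) ≤ 1 - y.2 ^ 2 := by nlinarith [hy.1, hy.2]
  rw [ballWeight', hn, max_eq_left h0, polarMap, evalP_smul hp, evalP_smul hq]
  push_cast
  ring

/-- The integrand is negative on `(0,1)`. -/
lemma integral_radial_weight_ne_zero {d : ℕ} (n : ℕ) :
    ∫ r, ((-4 * (1 - r ^ 2) * r ^ n : ℝ) : ℂ) ∂radialMeasure d ≠ 0 := by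
  rw [integral_radialMeasure]
  have e : ∀ r : ℝ, r ^ (d - 1) • ((-4 * (1 - r ^ 2) * r ^ n : ℝ) : ℂ) =
    ((-4 * ((1 - r ^ 2) * r ^ (d - 1 + n)) : ℝ) : ℂ) := by
    intro r; rw [Complex.real_smul, pow_add]; push_cast; ring
  simp only [e]
  rw [intervalIntegral.integral_ofReal, intervalIntegral.integral_const_mul]
  have hpos : 0 < ∫ r in (0 : ℝ)..1, (1 - r ^ 2) * r ^ (d - 1 + n) := by
    refine intervalIntegral.intervalIntegral_pos_of_pos_on ?_ (fun r hr => ?_) zero_lt_one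
    · apply Continuous.intervalIntegrable; fun_prop
    · have h1 : 0 < 1 - r ^ 2 := by nlinarith [hr.1, hr.2]
      have := hr.1
      positivity
  rw [Ne, Complex.ofReal_eq_zero]
  linarith

/-- Exchanging `p` and `q` in the weighted Green formula shows that `ℓ' - ℓ` times a nonzero radial
integral times the sphere integral vanishes. -/
lemma integral_sphere_mul_eq_zero {d ℓ ℓ' : ℕ} (hd : 0 < d) (hne : ℓ ≠ ℓ')
    {p q : MvPolynomial (Fin d) ℂ} (hp : p ∈ harmonicPoly d ℓ) (hq : q ∈ harmonicPoly d ℓ') :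
    ∫ θ, evalP p (θ : Sph d) * evalP q (θ : Sph d) ∂sphereMeasure d = 0 := by
  have h1 := degree_mul_integral_ballWeight' p hq
  have h2 := degree_mul_integral_ballWeight' q hp
  have e1 : ∀ x : Sp d, evalP q x * evalP p x = evalP p x * evalP q x := fun x => mul_comm _ _
  have e2 : ∀ (i : Fin d) (x : Sp d), evalP (MvPolynomial.pderiv i q) x *
      (ballWeight x * evalP (MvPolynomial.pderiv i p) x) = evalP (MvPolynomial.pderiv i p) x *
      (ballWeight x * evalP (MvPolynomial.pderiv i q) x) := fun i x => by ring
  simp only [e1, e2] at h2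
  rw [← h2, integral_ballWeight'_polar hd hp.1 hq.1] at h1
  have h3 : ((ℓ' : ℂ) - ℓ) ≠ 0 := sub_ne_zero.2 (by exact_mod_cast hne.symm)
  have h4 := integral_radial_weight_ne_zero (d := d) (ℓ + ℓ')
  rw [← sub_eq_zero, ← sub_mul] at h1
  exact (mul_eq_zero.1 ((mul_eq_zero.1 h1).resolve_left h3)).resolve_right h4

lemma integral_sphericalHarmonics_mul_conj {d ℓ ℓ' : ℕ} (hd : 0 < d) (hne : ℓ ≠ ℓ')
    {f g : Sph d → ℂ} (hf : f ∈ sphericalHarmonics d ℓ) (hg : g ∈ sphericalHarmonics d ℓ') :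
    ∫ θ, f θ * starRingEnd ℂ (g θ) ∂sphereMeasure d = 0 := by
  obtain ⟨p, hp, rfl⟩ := hf
  obtain ⟨q, hq, rfl⟩ := hg
  simp only [restrictSphere_apply, ← evalP_conjP]
  exact integral_sphere_mul_eq_zero hd hne hp (conjP_mem_harmonicPoly hq)

lemma continuous_of_mem_sphericalHarmonics {d ℓ : ℕ} {f : Sph d → ℂ}
    (hf : f ∈ sphericalHarmonics d ℓ) : Continuous f := by
  obtain ⟨p, hp, rfl⟩ := hf
  exact (continuous_evalP p).comp continuous_subtype_val

/-! ### Rotation invariance and the pointwise bound for spherical harmonics -/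

/-- The linear substitution `p ↦ p ∘ T` on polynomials. -/
def rotP {d : ℕ} (T : Sp d ≃ₗᵢ[ℝ] Sp d) :
    MvPolynomial (Fin d) ℂ →ₐ[ℂ] MvPolynomial (Fin d) ℂ :=
  MvPolynomial.aeval fun i => ∑ j, MvPolynomial.C (T (EuclideanSpace.single j 1) i : ℂ) *
    MvPolynomial.X j

lemma apply_eq_sum {d : ℕ} (T : Sp d ≃ₗᵢ[ℝ] Sp d) (x : Sp d) (i : Fin d) :
    T x i = ∑ j, T (EuclideanSpace.single j 1) i * x j := by
  have hx : x = ∑ j, x j • EuclideanSpace.single j (1 : ℝ) := by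
    ext k
    simp [Pi.single_apply]
  conv_lhs => rw [hx]
  simp [mul_comm]

lemma evalP_rotP {d : ℕ} (T : Sp d ≃ₗᵢ[ℝ] Sp d) (p : MvPolynomial (Fin d) ℂ) (x : Sp d) :
    evalP (rotP T p) x = evalP p (T x) := by
  induction p using MvPolynomial.induction_on with
  | C a => rw [rotP, MvPolynomial.aeval_C, evalP_C]; exact evalP_C a x
  | add p q hp hq => rw [map_add, evalP_add, evalP_add, hp, hq]
  | mul_X p i hp =>
    rw [map_mul, evalP_mul, evalP_mul, hp, evalP_X, apply_eq_sum, rotP, MvPolynomial.aeval_X,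
      evalP_sum]
    simp only [evalP_mul, evalP_C, evalP_X]
    push_cast
    rfl

lemma pderiv_rotP {d : ℕ} (T : Sp d ≃ₗᵢ[ℝ] Sp d) (p : MvPolynomial (Fin d) ℂ) (j : Fin d) :
    MvPolynomial.pderiv j (rotP T p) = ∑ i, MvPolynomial.C (T (EuclideanSpace.single j 1) i : ℂ) *
      rotP T (MvPolynomial.pderiv i p) := by
  induction p using MvPolynomial.induction_on with
  | C a =>
    rw [rotP, MvPolynomial.aeval_C]
    simp [MvPolynomial.algebraMap_eq]
  | add p q hp hq => simp only [map_add, hp, hq, mul_add, Finset.sum_add_distrib]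
  | mul_X p k hp =>
    have h1 : MvPolynomial.pderiv j (rotP T (MvPolynomial.X k)) =
        MvPolynomial.C (T (EuclideanSpace.single j 1) k : ℂ) := by
      rw [rotP, MvPolynomial.aeval_X, map_sum, Finset.sum_eq_single j]
      · simp
      · intro i _ hi
        rw [MvPolynomial.pderiv_C_mul, MvPolynomial.pderiv_X_of_ne hi, mul_zero]
      · simp
    have h2 : ∀ i, rotP T (MvPolynomial.pderiv i (p * MvPolynomial.X k)) =
        rotP T (MvPolynomial.pderiv i p) * rotP T (MvPolynomial.X k) +
          (if i = k then rotP T p else 0) := by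
      intro i
      rw [MvPolynomial.pderiv_mul, map_add, map_mul, map_mul]
      congr 1
      split_ifs with h
      · subst h; simp
      · rw [MvPolynomial.pderiv_X_of_ne (Ne.symm h)]; simp
    rw [map_mul, MvPolynomial.pderiv_mul, h1, hp, Finset.sum_mul]
    simp only [h2, mul_add, Finset.sum_add_distrib, mul_ite, mul_zero, Finset.sum_ite_eq',
      Finset.mem_univ, if_true]
    rw [mul_comm (rotP T p)]
    simp only [mul_assoc]

/-- The matrix of `T` has orthonormal rows: they are the columns of the inverse isometry. This is
what makes the Laplacian rotation invariant. -/
lemma sum_apply_single_mul {d : ℕ} (T : Sp d ≃ₗᵢ[ℝ] Sp d) (i k : Fin d) :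
    ∑ j, T (EuclideanSpace.single j 1) i * T (EuclideanSpace.single j 1) k =
      if i = k then 1 else 0 := by
  have h : ∀ j i, T (EuclideanSpace.single j 1) i = T.symm (EuclideanSpace.single i 1) j := by
    intro j i
    have h1 : ⟪EuclideanSpace.single i (1 : ℝ), T (EuclideanSpace.single j 1)⟫_ℝ =
        ⟪T.symm (EuclideanSpace.single i 1), EuclideanSpace.single j (1 : ℝ)⟫_ℝ := by
      rw [← T.symm.inner_map_map, T.symm_apply_apply]
    simpa [EuclideanSpace.inner_single_left, EuclideanSpace.inner_single_right] using h1
  simp only [h]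
  have h2 := T.symm.inner_map_map (EuclideanSpace.single i (1 : ℝ)) (EuclideanSpace.single k 1)
  rw [PiLp.inner_apply] at h2
  simp only [RCLike.inner_apply, conj_trivial, EuclideanSpace.inner_single_left,
    PiLp.single_apply, one_mul] at h2
  rw [← h2]
  exact Finset.sum_congr rfl fun j _ => mul_comm _ _

lemma lap_rotP {d : ℕ} (T : Sp d ≃ₗᵢ[ℝ] Sp d) (p : MvPolynomial (Fin d) ℂ) :
    lap d (rotP T p) = rotP T (lap d p) := by
  rw [lap_apply, lap_apply]
  simp only [pderiv_rotP, map_sum, MvPolynomial.pderiv_C_mul, Finset.mul_sum]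
  rw [Finset.sum_comm]
  refine Finset.sum_congr rfl fun i _ => ?_
  rw [Finset.sum_comm, Finset.sum_eq_single i]
  · simp only [← mul_assoc, ← MvPolynomial.C_mul, ← Finset.sum_mul, ← map_sum,
      ← Complex.ofReal_mul, ← Complex.ofReal_sum, sum_apply_single_mul]
    simp
  · intro k _ hk
    simp only [← mul_assoc, ← MvPolynomial.C_mul, ← Finset.sum_mul, ← map_sum,
      ← Complex.ofReal_mul, ← Complex.ofReal_sum, sum_apply_single_mul, if_neg hk.symm]
    simp
  · simp

lemma rotP_mem_harmonicPoly {d ℓ : ℕ} (T : Sp d ≃ₗᵢ[ℝ] Sp d) {p : MvPolynomial (Fin d) ℂ}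
    (hp : p ∈ harmonicPoly d ℓ) : rotP T p ∈ harmonicPoly d ℓ := by
  refine ⟨?_, ?_⟩
  · have := MvPolynomial.IsHomogeneous.aeval (n := 1) hp.1 (fun i => ∑ j,
      MvPolynomial.C (T (EuclideanSpace.single j 1) i : ℂ) * MvPolynomial.X j)
      (fun i => MvPolynomial.IsHomogeneous.sum _ _ _ fun j _ =>
        MvPolynomial.isHomogeneous_C_mul_X _ _)
    rwa [one_mul] at this
  · show lap d _ = 0
    rw [lap_rotP, show lap d p = 0 from hp.2, map_zero]

/-- The action of a linear isometry on the unit sphere. -/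
def rotS {d : ℕ} (T : Sp d ≃ₗᵢ[ℝ] Sp d) (θ : Sph d) : Sph d := ⟨T θ, by simp⟩

lemma continuous_rotS {d : ℕ} (T : Sp d ≃ₗᵢ[ℝ] Sp d) : Continuous (rotS T) :=
  (T.continuous.comp continuous_subtype_val).subtype_mk _

lemma comp_rotS_mem_sphericalHarmonics {d ℓ : ℕ} (T : Sp d ≃ₗᵢ[ℝ] Sp d) {f : Sph d → ℂ}
    (hf : f ∈ sphericalHarmonics d ℓ) : f ∘ rotS T ∈ sphericalHarmonics d ℓ := by
  obtain ⟨p, hp, rfl⟩ := hf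
  refine ⟨rotP T p, rotP_mem_harmonicPoly T hp, ?_⟩
  ext θ
  rw [restrictSphere_apply, evalP_rotP]
  rfl

open Pointwise in
-- The surface measure of `s` is a multiple of the volume of the cone over `s`, and `T` carries
-- cones to cones and preserves volume.
lemma measurePreserving_rotS {d : ℕ} (T : Sp d ≃ₗᵢ[ℝ] Sp d) :
    MeasurePreserving (rotS T) (sphereMeasure d) (sphereMeasure d) := by
  have hm := (continuous_rotS T).measurable
  refine ⟨hm, Measure.ext fun s hs => ?_⟩
  rw [Measure.map_apply hm hs, Measure.toSphere_apply' _ (hm hs), Measure.toSphere_apply' _ hs]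
  congr 1
  have e : T ⁻¹' (Ioo (0 : ℝ) 1 • ((Subtype.val : Sph d → Sp d) '' s)) =
      Ioo (0 : ℝ) 1 • ((Subtype.val : Sph d → Sp d) '' (rotS T ⁻¹' s)) := by
    ext x
    simp only [mem_preimage, mem_smul, mem_image]
    constructor
    · rintro ⟨r, hr, _, ⟨θ, hθ, rfl⟩, h⟩
      refine ⟨r, hr, T.symm θ, ⟨⟨T.symm θ, by simp⟩, ?_, rfl⟩, ?_⟩
      · have : rotS T ⟨T.symm θ, by simp⟩ = θ := Subtype.ext (by simp [rotS])
        rwa [this]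
      · apply T.injective; rw [← h]; simp
    · rintro ⟨r, hr, _, ⟨θ, hθ, rfl⟩, rfl⟩
      exact ⟨r, hr, _, ⟨_, hθ, rfl⟩, by simp [rotS]⟩
  rw [← e]
  exact T.measurePreserving.measure_preimage_equiv (f := T.toMeasurableEquiv) _

instance (d ℓ : ℕ) : FiniteDimensional ℂ (sphericalHarmonics d ℓ) := by
  have h1 : FiniteDimensional ℂ (MvPolynomial.homogeneousSubmodule (Fin d) ℂ ℓ) :=
    Module.Finite.iff_fg.2 (MvPolynomial.homogeneousSubmodule_fg (Fin d) ℂ ℓ)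
  have h2 : FiniteDimensional ℂ (harmonicPoly d ℓ) :=
    Submodule.finiteDimensional_of_le (inf_le_left (b := LinearMap.ker _))
  unfold sphericalHarmonics
  infer_instance

/-! ### Orthonormal bases of `ℋ_ℓ` and the sum of their squared moduli -/

section
variable {d ℓ : ℕ} {I : Type*} {f : I → Sph d → ℂ}

lemma IsHarmonicONB.mem (hf : IsHarmonicONB d ℓ f) (m : I) : f m ∈ sphericalHarmonics d ℓ := by
  rw [← hf.span_eq]; exact Submodule.subset_span ⟨m, rfl⟩

lemma IsHarmonicONB.continuous (hf : IsHarmonicONB d ℓ f) (m : I) : Continuous (f m) :=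
  continuous_of_mem_sphericalHarmonics (hf.mem m)

lemma integrable_sphere {F : Type*} [NormedAddCommGroup F] {g : Sph d → F} (hg : Continuous g) :
    Integrable g (sphereMeasure d) :=
  hg.integrable_of_hasCompactSupport (HasCompactSupport.of_compactSpace g)

lemma IsHarmonicONB.integral_sum_mul_conj (hf : IsHarmonicONB d ℓ f) (s : Finset I) (c : I → ℂ)
    (k : I) : ∫ θ, (∑ m ∈ s, c m * f m θ) * starRingEnd ℂ (f k θ) ∂sphereMeasure d =
      ∑ m ∈ s, c m * ∫ θ, f m θ * starRingEnd ℂ (f k θ) ∂sphereMeasure d := by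
  simp only [Finset.sum_mul, mul_assoc]
  rw [integral_finsetSum]
  · simp only [integral_const_mul]
  · intro m _
    exact integrable_sphere (continuous_const.mul ((hf.continuous m).mul
      (Complex.continuous_conj.comp (hf.continuous k))))

lemma IsHarmonicONB.integral_mul_conj [DecidableEq I] (hf : IsHarmonicONB d ℓ f) (m k : I) :
    ∫ θ, f m θ * starRingEnd ℂ (f k θ) ∂sphereMeasure d = if m = k then 1 else 0 := by
  split_ifs with h
  · subst h; exact hf.orthonormal.norm_one m
  · exact hf.orthonormal.ortho m k h

lemma IsHarmonicONB.linearIndependent (hf : IsHarmonicONB d ℓ f) : LinearIndependent ℂ f := by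
  classical
  rw [linearIndependent_iff']
  intro s c hc k hk
  have h := hf.integral_sum_mul_conj s c k
  have h0 : ∀ θ, ∑ m ∈ s, c m * f m θ = 0 := fun θ => by
    have := congrFun hc θ
    simpa [Finset.sum_apply] using this
  simp only [h0, zero_mul, integral_zero, hf.integral_mul_conj] at h
  simpa [hk] using h.symm

lemma IsHarmonicONB.finite (hf : IsHarmonicONB d ℓ f) : Finite I := by
  have h := linearIndependent_span hf.linearIndependent
  have : FiniteDimensional ℂ (Submodule.span ℂ (range f)) := by
    rw [hf.span_eq]; infer_instance
  exact h.finite_of_isNoetherian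

lemma IsHarmonicONB.card_eq [Fintype I] (hf : IsHarmonicONB d ℓ f) :
    Fintype.card I = Module.finrank ℂ (sphericalHarmonics d ℓ) := by
  rw [← hf.span_eq, finrank_span_eq_card hf.linearIndependent]

lemma IsHarmonicONB.integral_norm_sq_sum [Fintype I] (hf : IsHarmonicONB d ℓ f) (c : I → ℂ) :
    ∫ θ, ‖∑ m, c m * f m θ‖ ^ 2 ∂sphereMeasure d = ∑ m, ‖c m‖ ^ 2 := by
  classical
  have h1 : ∀ θ, ((‖∑ m, c m * f m θ‖ ^ 2 : ℝ) : ℂ) =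
      ∑ k, starRingEnd ℂ (c k) * ((∑ m, c m * f m θ) * starRingEnd ℂ (f k θ)) := by
    intro θ
    rw [Complex.ofReal_pow, ← Complex.mul_conj', map_sum, Finset.mul_sum]
    refine Finset.sum_congr rfl fun k _ => ?_
    rw [map_mul]; ring
  refine Complex.ofReal_injective ?_
  rw [← integral_complex_ofReal]
  simp only [h1]
  rw [integral_finsetSum]
  · simp only [integral_const_mul, hf.integral_sum_mul_conj, hf.integral_mul_conj]
    push_cast
    refine Finset.sum_congr rfl fun k _ => ?_
    simp [← Complex.mul_conj', mul_comm]
  · intro k _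
    refine integrable_sphere (continuous_const.mul ((continuous_finsetSum _ fun m _ =>
      continuous_const.mul (hf.continuous m)).mul (Complex.continuous_conj.comp (hf.continuous k))))

/-- With `K = ∑ |f_m(θ)|²`, the reproducing kernel `g` at `θ` has `g(θ) = K` and squared `L²` norm
`K`. A rotated copy takes the value `K` at `θ'` with the same norm, so Cauchy–Schwarz at `θ'` gives
`K² ≤ K ∑ |f_m(θ')|²`. As the points are arbitrary, the sum is constant. -/
lemma IsHarmonicONB.sum_sq_le [Fintype I] (hf : IsHarmonicONB d ℓ f) (θ θ' : Sph d) :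
    ∑ m, ‖f m θ‖ ^ 2 ≤ ∑ m, ‖f m θ'‖ ^ 2 := by
  -- Reflection in the hyperplane orthogonal to `θ' - θ`, which exchanges these two unit vectors.
  set T : Sp d ≃ₗᵢ[ℝ] Sp d := (ℝ ∙ ((θ' : Sp d) - θ))ᗮ.reflection with hT
  have hTθ : rotS T θ' = θ := Subtype.ext (Submodule.reflection_sub (by simp))
  set K := ∑ m, ‖f m θ‖ ^ 2 with hK
  have hK0 : 0 ≤ K := Finset.sum_nonneg fun _ _ => by positivity
  let g : Sph d → ℂ := fun φ => ∑ m, starRingEnd ℂ (f m θ) * f m φ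
  have hg : g ∈ sphericalHarmonics d ℓ := by
    have : g = ∑ m, starRingEnd ℂ (f m θ) • f m := by
      ext φ; simp [g, Finset.sum_apply]
    rw [this]
    exact Submodule.sum_mem _ fun m _ => Submodule.smul_mem _ _ (hf.mem m)
  have hgT := comp_rotS_mem_sphericalHarmonics T hg
  rw [← hf.span_eq, Submodule.mem_span_range_iff_exists_fun] at hgT
  obtain ⟨c, hc⟩ := hgT
  have hc' : ∀ φ, ∑ m, c m * f m φ = g (rotS T φ) := fun φ => by
    have := congrFun hc φ
    simpa [Finset.sum_apply] using this
  have h1 : ∑ m, ‖c m‖ ^ 2 = K := by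
    rw [← hf.integral_norm_sq_sum c]
    simp only [hc']
    have h2 := (measurePreserving_rotS T).integral_comp'
      (f := ⟨⟨rotS T, rotS T.symm, fun φ => Subtype.ext (by simp [rotS]),
        fun φ => Subtype.ext (by simp [rotS])⟩, (continuous_rotS T).measurable,
        (continuous_rotS T.symm).measurable⟩) (fun φ => ‖g φ‖ ^ 2)
    refine h2.trans ?_
    simp only [g]
    rw [hf.integral_norm_sq_sum]
    simp [hK]
  have h3 : ∑ m, c m * f m θ' = K := by
    rw [hc', hTθ]
    simp only [g, hK, Complex.conj_mul']
    push_cast; rfl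
  have h4 : K ^ 2 ≤ K * ∑ m, ‖f m θ'‖ ^ 2 := by
    calc K ^ 2 = ‖∑ m, c m * f m θ'‖ ^ 2 := by rw [h3]; simp
      _ ≤ (∑ m, ‖c m‖ * ‖f m θ'‖) ^ 2 := by
        gcongr
        exact (norm_sum_le _ _).trans (le_of_eq (Finset.sum_congr rfl fun m _ => norm_mul _ _))
      _ ≤ (∑ m, ‖c m‖ ^ 2) * ∑ m, ‖f m θ'‖ ^ 2 := Finset.sum_mul_sq_le_sq_mul_sq _ _ _
      _ = _ := by rw [h1]
  rcases hK0.eq_or_lt with h | h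
  · rw [← h]; exact Finset.sum_nonneg fun _ _ => by positivity
  · rw [sq] at h4
    exact le_of_mul_le_mul_left h4 h

lemma sphereMeasure_real_univ_pos (hd : 0 < d) : 0 < (sphereMeasure d).real univ := by
  have : Nonempty (Fin d) := ⟨⟨0, hd⟩⟩
  have : NeZero (sphereMeasure d) := ⟨Measure.toSphere_ne_zero _⟩
  exact measureReal_univ_pos

/-- The pointwise bound for normalized spherical harmonics that follows from the addition theorem. -/
lemma IsHarmonicONB.norm_le (hd : 0 < d) (hf : IsHarmonicONB d ℓ f) (m : I) (θ : Sph d) :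
    ‖f m θ‖ ≤ √((Module.finrank ℂ (sphericalHarmonics d ℓ) : ℝ) / (sphereMeasure d).real univ) := by
  classical
  have := hf.finite
  have := Fintype.ofFinite I
  have hpos := sphereMeasure_real_univ_pos hd
  refine Real.le_sqrt_of_sq_le ?_
  have h1 : ‖f m θ‖ ^ 2 ≤ ∑ k, ‖f k θ‖ ^ 2 :=
    Finset.single_le_sum (f := fun k => ‖f k θ‖ ^ 2) (fun _ _ => by positivity) (Finset.mem_univ m)
  refine h1.trans ?_
  rw [le_div_iff₀ hpos, ← hf.card_eq]
  have hi : ∀ k, Integrable (fun φ => ‖f k φ‖ ^ 2) (sphereMeasure d) := fun k =>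
    integrable_sphere ((hf.continuous k).norm.pow 2)
  have h2 : ∫ φ, ∑ k, ‖f k φ‖ ^ 2 ∂sphereMeasure d = Fintype.card I := by
    rw [integral_finsetSum _ fun k _ => hi k]
    have h3 : ∀ k, ∫ φ, ‖f k φ‖ ^ 2 ∂sphereMeasure d = 1 := by
      intro k
      have := hf.integral_norm_sq_sum (Pi.single k 1)
      simpa [Pi.single_apply, apply_ite, Finset.sum_ite_eq] using this
    simp [h3]
  rw [← h2]
  -- Integration of the pointwise comparison over the second point: `|∂B| ∑ |f_k(θ)|²` is at most
  -- the number of basis functions.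
  have h4 := integral_mono (μ := sphereMeasure d) (integrable_const (∑ k, ‖f k θ‖ ^ 2))
    (integrable_finsetSum _ fun k _ => hi k) (hf.sum_sq_le θ)
  rw [integral_const, smul_eq_mul, mul_comm] at h4
  exact h4

end

/-! ### Completeness -/

/-- The functions that are almost everywhere equal to an element of `V`. -/
def aeSub {α : Type*} [MeasurableSpace α] {μ : Measure α} (V : Submodule ℂ (Lp ℂ 2 μ)) :
    Submodule ℂ (α → ℂ) where
  carrier := {φ | ∃ F ∈ V, F =ᵐ[μ] φ}
  zero_mem' := ⟨0, V.zero_mem, Lp.coeFn_zero _ _ _⟩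
  add_mem' := by
    rintro φ ψ ⟨F, hF, hF'⟩ ⟨G, hG, hG'⟩
    exact ⟨F + G, V.add_mem hF hG, (Lp.coeFn_add F G).trans (hF'.add hG')⟩
  smul_mem' := by
    rintro c φ ⟨F, hF, hF'⟩
    exact ⟨c • F, V.smul_mem c hF, (Lp.coeFn_smul c F).trans (hF'.const_smul c)⟩

lemma mem_aeSub_congr {α : Type*} [MeasurableSpace α] {μ : Measure α}
    {V : Submodule ℂ (Lp ℂ 2 μ)} {φ ψ : α → ℂ} (h : φ ∈ aeSub V) (hφ : φ =ᵐ[μ] ψ) :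
    ψ ∈ aeSub V := by
  obtain ⟨F, hF, hF'⟩ := h
  exact ⟨F, hF, hF'.trans hφ⟩

lemma mem_aeSub_closedSpan {α ι : Type*} [MeasurableSpace α] {μ : Measure α} {f : ι → α → ℂ}
    (i : ι) (h : MemLp (f i) 2 μ) : f i ∈ aeSub (closedSpan μ f) :=
  ⟨h.toLp _, Submodule.le_topologicalClosure _ (Submodule.subset_span ⟨i, h.coeFn_toLp⟩),
    h.coeFn_toLp⟩

lemma isClosed_closedSpan {α ι : Type*} [MeasurableSpace α] {μ : Measure α} (f : ι → α → ℂ) :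
    IsClosed (closedSpan μ f : Set (Lp ℂ 2 μ)) := Submodule.isClosed_topologicalClosure _

open scoped BoundedContinuousFunction in
-- Bounded continuous functions are dense in `L²`, and for a finite measure uniform approximation
-- implies `L²` approximation.
lemma eq_top_of_forall_approx {α : Type*} [MeasurableSpace α] [TopologicalSpace α] [NormalSpace α]
    [BorelSpace α] {μ : Measure α} [IsFiniteMeasure μ] [μ.WeaklyRegular]
    {V : Submodule ℂ (Lp ℂ 2 μ)} (hV : IsClosed (V : Set (Lp ℂ 2 μ)))
    (h : ∀ (g : α →ᵇ ℂ) (ε : ℝ), 0 < ε → ∃ φ ∈ aeSub V, ∀ᵐ x ∂μ, ‖g x - φ x‖ ≤ ε) :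
    V = ⊤ := by
  have hd := BoundedContinuousFunction.toLp_denseRange (p := 2) (E := ℂ) (μ := μ) ℂ (by simp)
  refine Submodule.eq_top_iff'.2 fun F => ?_
  have hsub : range (BoundedContinuousFunction.toLp (E := ℂ) 2 μ ℂ) ⊆ (V : Set (Lp ℂ 2 μ)) := by
    rintro _ ⟨g, rfl⟩
    rw [← hV.closure_eq, Metric.mem_closure_iff]
    intro δ hδ
    -- The factor that passes from a sup bound to the `L²` norm; the tolerance `δ / (M + 1)` keeps
    -- the product strictly below `δ`.
    set M : ℝ := (measureUnivNNReal μ : ℝ) ^ ((2 : ℝ≥0∞).toReal)⁻¹ with hM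
    have hM0 : 0 ≤ M := by positivity
    obtain ⟨φ, ⟨G, hG, hG'⟩, hφ⟩ := h g (δ / (M + 1)) (by positivity)
    refine ⟨G, hG, ?_⟩
    rw [dist_eq_norm]
    have := Lp.norm_le_of_ae_bound (p := 2)
      (f := BoundedContinuousFunction.toLp (E := ℂ) 2 μ ℂ g - G) (C := δ / (M + 1))
      (by positivity) (by
        filter_upwards [Lp.coeFn_sub (BoundedContinuousFunction.toLp (E := ℂ) 2 μ ℂ g) G,
          BoundedContinuousFunction.coeFn_toLp (p := 2) (𝕜 := ℂ) μ g, hG', hφ] with x h1 h2 h3 h4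
        rw [h1, Pi.sub_apply, h2, h3]
        exact h4)
    refine this.trans_lt ?_
    rw [← mul_div_assoc, div_lt_iff₀ (by positivity)]
    nlinarith
  exact closure_minimal hsub hV (hd F)

/-- The star subalgebra of polynomial functions on a compact set. -/
def polyStarSubalgebra {d : ℕ} (K : Set (Sp d)) : StarSubalgebra ℂ C(K, ℂ) where
  carrier := {g | ∃ p, ∀ x : K, g x = evalP p (x : Sp d)}
  mul_mem' := by
    rintro a b ⟨p, hp⟩ ⟨q, hq⟩
    exact ⟨p * q, fun x => by rw [evalP_mul, ← hp, ← hq]; rfl⟩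
  add_mem' := by
    rintro a b ⟨p, hp⟩ ⟨q, hq⟩
    exact ⟨p + q, fun x => by rw [evalP_add, ← hp, ← hq]; rfl⟩
  algebraMap_mem' := fun c => ⟨MvPolynomial.C c, fun x => by rw [evalP_C]; rfl⟩
  star_mem' := by
    rintro a ⟨p, hp⟩
    exact ⟨conjP p, fun x => by
      show star (a x) = _
      rw [evalP_conjP, ← hp]; rfl⟩

lemma exists_evalP_approx {d : ℕ} (K : Set (Sp d)) [CompactSpace K] (g : C(K, ℂ)) {ε : ℝ}
    (hε : 0 < ε) : ∃ p, ∀ x : K, ‖g x - evalP p (x : Sp d)‖ < ε := by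
  have hsep : (polyStarSubalgebra K).SeparatesPoints := by
    intro x y hxy
    have : ∃ i, (x : Sp d) i ≠ (y : Sp d) i := by
      by_contra! h
      exact hxy (Subtype.ext (PiLp.ext h))
    obtain ⟨i, hi⟩ := this
    refine ⟨fun z : K => evalP (MvPolynomial.X i) (z : Sp d),
      ⟨⟨_, (continuous_evalP _).comp continuous_subtype_val⟩,
      ⟨MvPolynomial.X i, fun _ => rfl⟩, rfl⟩, ?_⟩
    simp only [evalP_X]
    exact_mod_cast hi
  have htop := ContinuousMap.starSubalgebra_topologicalClosure_eq_top_of_separatesPoints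
    (polyStarSubalgebra K) hsep
  have hg : g ∈ (polyStarSubalgebra K).topologicalClosure := by rw [htop]; trivial
  obtain ⟨a, ⟨p, hp⟩, ha⟩ := Metric.mem_closure_iff.1 hg ε hε
  refine ⟨p, fun x => ?_⟩
  rw [← hp, ← dist_eq_norm]
  exact (ContinuousMap.dist_apply_le_dist x).trans_lt ha

section
variable {d : ℕ} {I : ℕ → Type*} {f : (ℓ : ℕ) → I ℓ → Sph d → ℂ}

/-- On the sphere `|x|² = 1`, so every polynomial restricts to a sum of spherical harmonics;
polynomials are uniformly dense by Stone–Weierstrass. -/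
lemma closedSpan_angular_eq_top (hd : 0 < d) (hf : ∀ ℓ, IsHarmonicONB d ℓ (f ℓ)) :
    closedSpan (sphereMeasure d) (angular f) = ⊤ := by
  refine eq_top_of_forall_approx (isClosed_closedSpan _) fun g ε hε => ?_
  obtain ⟨p, hp⟩ := exists_evalP_approx (sphere (0 : Sp d) 1) g.toContinuousMap hε
  refine ⟨restrictSphere d p, ?_, .of_forall fun x => (hp x).le⟩
  have hp' : p ∈ (aeSub (closedSpan (sphereMeasure d) (angular f))).comap (restrictSphere d) := by
    have h : Submodule.span ℂ {p : MvPolynomial (Fin d) ℂ |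
        ∃ ℓ q h, h ∈ harmonicPoly d ℓ ∧ p = rsq d ^ q * h} ≤
        (aeSub (closedSpan (sphereMeasure d) (angular f))).comap (restrictSphere d) := by
      refine Submodule.span_le.2 ?_
      rintro _ ⟨ℓ, q, h, hh, rfl⟩
      have e : restrictSphere d (rsq d ^ q * h) = restrictSphere d h := by
        ext θ
        rw [restrictSphere_apply, evalP_mul, evalP_pow, evalP_rsq, restrictSphere_apply]
        simp
      rw [SetLike.mem_coe, Submodule.mem_comap, e]
      have h1 : restrictSphere d h ∈ sphericalHarmonics d ℓ := ⟨h, hh, rfl⟩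
      rw [← (hf ℓ).span_eq] at h1
      refine (Submodule.span_le.2 ?_) h1
      rintro _ ⟨m, rfl⟩
      exact mem_aeSub_closedSpan (f := angular f) ⟨ℓ, m⟩ ((hf ℓ).orthonormal.memLp m)
    rw [span_rsq_pow_mul_harmonic hd] at h
    exact h trivial
  exact hp'

/-- `polarProd` as a linear map in the angular function. -/
def polarAngular (d : ℕ) (g : ℝ → ℂ) : (Sph d → ℂ) →ₗ[ℂ] (Sp d → ℂ) where
  toFun f := polarProd g f
  map_add' f f' := by ext x; simp only [polarProd, Pi.add_apply]; split_ifs <;> ring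
  map_smul' c f := by
    ext x; simp only [polarProd, Pi.smul_apply, smul_eq_mul, RingHom.id_apply]; split_ifs <;> ring

/-- `polarProd` as a linear map in the radial function. -/
def polarRadial {d : ℕ} (f : Sph d → ℂ) : (ℝ → ℂ) →ₗ[ℂ] (Sp d → ℂ) where
  toFun g := polarProd g f
  map_add' g g' := by ext x; simp only [polarProd, Pi.add_apply]; split_ifs <;> ring
  map_smul' c g := by
    ext x; simp only [polarProd, Pi.smul_apply, smul_eq_mul, RingHom.id_apply]; split_ifs <;> ring

lemma continuous_radial (d : ℕ) (I : ℕ → Type*) (n : Σ ℓ, I ℓ) (k : ℕ) :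
    Continuous (radial d I n k) :=
  Complex.continuous_ofReal.comp (continuous_zernikeR d n.1 k)

lemma polarProd_zernikeR_mem (hd : 0 < d) (hf : ∀ ℓ, IsHarmonicONB d ℓ (f ℓ)) (ℓ k : ℕ)
    {φ : Sph d → ℂ} (hφ : φ ∈ sphericalHarmonics d ℓ) :
    polarProd (fun r => (zernikeR d ℓ k r : ℂ)) φ ∈
      aeSub (spaceW d (angular f) (radial d I)) := by
  have h : sphericalHarmonics d ℓ ≤ (aeSub (spaceW d (angular f) (radial d I))).comap
      (polarAngular d fun r => (zernikeR d ℓ k r : ℂ)) := by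
    rw [← (hf ℓ).span_eq]
    refine Submodule.span_le.2 ?_
    rintro _ ⟨m, rfl⟩
    exact mem_aeSub_closedSpan (f := fun nk : (Σ ℓ, I ℓ) × ℕ =>
      polarProd (radial d I nk.1 nk.2) (angular f nk.1)) (⟨ℓ, m⟩, k)
      (memLp_polarProd hd (continuous_radial d I ⟨ℓ, m⟩ k) ((hf ℓ).continuous m) 2)
  exact h hφ

/-- The passage from powers to radial Zernike functions is triangular: `R_{ℓ,q}` has a nonzero
coefficient at `r^(ℓ+2q)`, and its other powers are covered by induction. -/
lemma polarProd_pow_mem (hd : 0 < d) (hf : ∀ ℓ, IsHarmonicONB d ℓ (f ℓ)) (ℓ q : ℕ)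
    {φ : Sph d → ℂ} (hφ : φ ∈ sphericalHarmonics d ℓ) :
    polarProd (fun r => (r : ℂ) ^ (ℓ + 2 * q)) φ ∈
      aeSub (spaceW d (angular f) (radial d I)) := by
  induction q using Nat.strong_induction_on with
  | _ q ih =>
    have hc : (0 : ℝ) < ℓ + d / 2 := by positivity
    set b : ℕ → ℂ := fun j => (zernikeC d ℓ q * radCoeff (ℓ + d / 2) q j : ℝ) with hb
    have hb0 : b q ≠ 0 := by
      simp only [hb, ne_eq, Complex.ofReal_eq_zero]
      exact mul_ne_zero (zernikeC_ne_zero hd ℓ q) (radCoeff_self_ne_zero hc q)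
    have e : (fun r : ℝ => (r : ℂ) ^ (ℓ + 2 * q)) = (b q)⁻¹ •
        ((fun r => (zernikeR d ℓ q r : ℂ)) -
          ∑ j ∈ Finset.range q, b j • fun r : ℝ => (r : ℂ) ^ (ℓ + 2 * j)) := by
      ext r
      have h1 : (zernikeR d ℓ q r : ℂ) =
          ∑ j ∈ Finset.range (q + 1), b j * (r : ℂ) ^ (ℓ + 2 * j) := by
        rw [zernikeR_eq, eval_radPoly, Finset.mul_sum _ _ (r ^ ℓ), Finset.mul_sum]
        push_cast
        refine Finset.sum_congr rfl fun j _ => ?_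
        simp only [hb]
        push_cast
        ring
      simp only [Pi.smul_apply, Pi.sub_apply, Finset.sum_apply, smul_eq_mul]
      rw [h1, Finset.sum_range_succ, add_sub_cancel_left, inv_mul_cancel_left₀ hb0]
    rw [e]
    show polarRadial φ _ ∈ _
    rw [map_smul, map_sub, map_sum]
    refine Submodule.smul_mem _ _ (Submodule.sub_mem _ (polarProd_zernikeR_mem hd hf ℓ q hφ)
      (Submodule.sum_mem _ fun j hj => ?_))
    rw [map_smul]
    exact Submodule.smul_mem _ _ (ih j (Finset.mem_range.1 hj))

/-- `evalP` as a linear map. -/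
def evalPₗ (d : ℕ) : MvPolynomial (Fin d) ℂ →ₗ[ℂ] (Sp d → ℂ) :=
  LinearMap.pi fun x => (MvPolynomial.aeval fun i => (x i : ℂ)).toLinearMap

/-- By homogeneity `|x|^(2q) h(x) = r^(ℓ+2q) h(θ)` away from the origin, which is a null set. -/
lemma evalP_mem (hd : 0 < d) (hf : ∀ ℓ, IsHarmonicONB d ℓ (f ℓ)) (p : MvPolynomial (Fin d) ℂ) :
    evalP p ∈ aeSub (spaceW d (angular f) (radial d I)) := by
  have : Nonempty (Fin d) := ⟨⟨0, hd⟩⟩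
  have h : Submodule.span ℂ {p : MvPolynomial (Fin d) ℂ |
      ∃ ℓ q h, h ∈ harmonicPoly d ℓ ∧ p = rsq d ^ q * h} ≤
      (aeSub (spaceW d (angular f) (radial d I))).comap (evalPₗ d) := by
    refine Submodule.span_le.2 ?_
    rintro _ ⟨ℓ, q, h, hh, rfl⟩
    have h1 : restrictSphere d h ∈ sphericalHarmonics d ℓ := ⟨h, hh, rfl⟩
    refine mem_aeSub_congr (polarProd_pow_mem hd hf ℓ q h1) ?_
    have h0 : ∀ᵐ x ∂ballMeasure d, x ≠ 0 := Measure.ae_ne _ 0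
    filter_upwards [h0] with x hx
    have hx' : ‖x‖ ≠ 0 := norm_ne_zero_iff.2 hx
    rw [polarProd, dif_neg hx, restrictSphere_apply]
    simp only [evalP_smul hh.1]
    show _ = evalP _ x
    rw [evalP_mul, evalP_pow, evalP_rsq]
    push_cast
    have hx'' : (‖x‖ : ℂ) ≠ 0 := by exact_mod_cast hx'
    rw [pow_add, inv_pow]
    field_simp
    ring
  rw [span_rsq_pow_mul_harmonic hd] at h
  exact h (trivial : p ∈ ⊤)

lemma spaceW_eq_top (hd : 0 < d) (hf : ∀ ℓ, IsHarmonicONB d ℓ (f ℓ)) :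
    spaceW d (angular f) (radial d I) = ⊤ := by
  refine eq_top_of_forall_approx (isClosed_closedSpan _) fun g ε hε => ?_
  have : CompactSpace (closedBall (0 : Sp d) 1) :=
    isCompact_iff_compactSpace.1 (isCompact_closedBall 0 1)
  obtain ⟨p, hp⟩ := exists_evalP_approx (closedBall (0 : Sp d) 1)
    (g.toContinuousMap.restrict (closedBall 0 1)) hε
  refine ⟨evalP p, evalP_mem hd hf p, ?_⟩
  filter_upwards [ae_restrict_mem measurableSet_ball] with x hx
  exact (hp ⟨x, ball_subset_closedBall hx⟩).le

/-! ### The Zernike system -/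

lemma isOrthonormalSet_angular (hd : 0 < d) (hf : ∀ ℓ, IsHarmonicONB d ℓ (f ℓ)) :
    IsOrthonormalSet (sphereMeasure d) (angular f) := by
  refine ⟨fun n => (hf n.1).orthonormal.memLp n.2, fun n => (hf n.1).orthonormal.norm_one n.2, ?_⟩
  rintro ⟨ℓ, m⟩ ⟨ℓ', m'⟩ hne
  by_cases h : ℓ = ℓ'
  · subst h
    exact (hf ℓ).orthonormal.ortho m m' fun h => hne (by rw [h])
  · exact integral_sphericalHarmonics_mul_conj hd h ((hf ℓ).mem m) ((hf ℓ').mem m')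

lemma isOrthonormalSet_zernike (hd : 0 < d) (hf : ∀ ℓ, IsHarmonicONB d ℓ (f ℓ)) :
    IsOrthonormalSet (ballMeasure d)
      (fun nk : (Σ ℓ, I ℓ) × ℕ => polarProd (radial d I nk.1 nk.2) (angular f nk.1)) := by
  have hA := isOrthonormalSet_angular hd hf
  have hR : ∀ n : Σ ℓ, I ℓ, IsOrthonormalSet (radialMeasure d) (radial d I n) :=
    fun n => isOrthonormalSet_zernikeR hd n.1
  have hcf : ∀ n : Σ ℓ, I ℓ, Continuous (angular f n) := fun n => (hf n.1).continuous n.2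
  have key : ∀ nk nk' : (Σ ℓ, I ℓ) × ℕ, ∫ x in ball 0 1,
      polarProd (radial d I nk.1 nk.2) (angular f nk.1) x *
      starRingEnd ℂ (polarProd (radial d I nk'.1 nk'.2) (angular f nk'.1) x) = _ := fun nk nk' =>
    integral_polarProd_mul_conj hd (continuous_radial d I nk.1 nk.2) (hcf nk.1)
      (continuous_radial d I nk'.1 nk'.2) (hcf nk'.1)
  refine ⟨fun nk => memLp_polarProd hd (continuous_radial d I nk.1 nk.2) (hcf nk.1) 2,
    fun nk => ?_, ?_⟩
  · rw [key, hA.norm_one, (hR nk.1).norm_one, mul_one]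
  · rintro ⟨n, k⟩ ⟨n', k'⟩ hne
    rw [key]
    by_cases h : n = n'
    · subst h
      rw [(hR n).ortho k k' fun h => hne (by rw [h]), mul_zero]
    · rw [hA.ortho n n' h, zero_mul]

lemma norm_zernike_le (hd : 2 ≤ d) (hf : ∀ ℓ, IsHarmonicONB d ℓ (f ℓ)) (n : Σ ℓ, I ℓ) (k : ℕ)
    {x : Sp d} (hx : ‖x‖ ≤ 1) :
    ‖polarProd (radial d I n k) (angular f n) x‖ ≤ zernikeBound d I n k := by
  refine norm_polarProd_le (fun r hr => ?_) (Real.sqrt_nonneg _)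
    ((hf n.1).norm_le (by omega) n.2) hx
  rw [radial, Complex.norm_real]
  exact abs_zernikeR_le hd n.1 k hr

lemma norm_radial_one (hd : 0 < d) (n : Σ ℓ, I ℓ) (k : ℕ) :
    ‖radial d I n k 1‖ = √(2 * n.1 + 4 * k + d) := by
  rw [radial, zernikeR_one hd, Complex.norm_real, Real.norm_of_nonneg (Real.sqrt_nonneg _)]

lemma basisAssumption_zernike (hd : 2 ≤ d) (hf : ∀ ℓ, IsHarmonicONB d ℓ (f ℓ)) :
    BasisAssumption d (angular f) (radial d I) (zernikeBound d I) where
  f_orthonormal := isOrthonormalSet_angular (by omega) hf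
  f_complete := closedSpan_angular_eq_top (by omega) hf
  g_orthonormal n := isOrthonormalSet_zernikeR (by omega) n.1
  g_continuous n k := (continuous_radial d I n k).continuousWithinAt
  g_lower := by
    refine ⟨√d, Real.sqrt_pos.2 (by exact_mod_cast (by omega : 0 < d)), fun n k => ?_⟩
    rw [norm_radial_one (by omega)]
    refine Real.sqrt_le_sqrt ?_
    have : (0 : ℝ) ≤ 2 * n.1 + 4 * k := by positivity
    linarith
  a_nonneg n k := by unfold zernikeBound; positivity
  a_bound := by
    -- Any width works, since the bound holds on the whole closed ball.
    refine ⟨1 / 2, by norm_num, by norm_num, fun n k => ?_⟩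
    have hm : MeasurableSet (shell d (1 / 2)) :=
      (measurableSet_le measurable_const measurable_norm).inter
        (measurableSet_le measurable_norm measurable_const)
    refine eLpNormEssSup_le_of_ae_bound ?_
    filter_upwards [ae_restrict_mem hm] with x hx
    exact norm_zernike_le hd hf n k hx.2

/-- The constant 1 is a nonzero harmonic of degree 0. This supplies the index at which the infima of
`|g_{n,k}(1)|` are attained. -/
lemma nonempty_of_isHarmonicONB_zero {J : Type*} {g : J → Sph d → ℂ} (hd : 0 < d)
    (hg : IsHarmonicONB d 0 g) : Nonempty J := by
  by_contra h
  rw [not_nonempty_iff] at h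
  have h1 := hg.span_eq
  rw [range_eq_empty, Submodule.span_empty] at h1
  have h2 : restrictSphere d 1 ∈ sphericalHarmonics d 0 :=
    ⟨1, ⟨MvPolynomial.isHomogeneous_one _ _,
      lap_eq_zero_of_lt two_pos (MvPolynomial.isHomogeneous_one _ _)⟩, rfl⟩
  rw [← h1, Submodule.mem_bot] at h2
  have : Nonempty (Fin d) := ⟨⟨0, hd⟩⟩
  obtain ⟨θ⟩ : Nonempty (Sph d) := (NormedSpace.sphere_nonempty.2 zero_le_one).to_subtype
  have := congrFun h2 θ
  simp [restrictSphere] at this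

lemma isGLB_radial_one (hd : 0 < d) (hf : ∀ ℓ, IsHarmonicONB d ℓ (f ℓ)) (k : ℕ) :
    IsGLB (range fun n : Σ ℓ, I ℓ => ‖radial d I n k 1‖) √(4 * (k : ℝ) + d) := by
  obtain ⟨m⟩ := nonempty_of_isHarmonicONB_zero hd (hf 0)
  refine IsLeast.isGLB ⟨⟨⟨0, m⟩, ?_⟩, ?_⟩
  · simp [norm_radial_one hd]
  · rintro _ ⟨n, rfl⟩
    simp only [norm_radial_one hd]
    refine Real.sqrt_le_sqrt ?_
    have : (0 : ℝ) ≤ 2 * n.1 := by positivity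
    linarith

lemma isGLB_radial_one' (hd : 0 < d) (hf : ∀ ℓ, IsHarmonicONB d ℓ (f ℓ)) :
    IsGLB (range fun nk : (Σ ℓ, I ℓ) × ℕ => ‖radial d I nk.1 nk.2 1‖) √(d : ℝ) := by
  obtain ⟨m⟩ := nonempty_of_isHarmonicONB_zero hd (hf 0)
  refine IsLeast.isGLB ⟨⟨(⟨0, m⟩, 0), ?_⟩, ?_⟩
  · simp [norm_radial_one hd]
  · rintro _ ⟨nk, rfl⟩
    simp only [norm_radial_one hd]
    refine Real.sqrt_le_sqrt ?_
    have : (0 : ℝ) ≤ 2 * nk.1.1 + 4 * nk.2 := by positivity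
    linarith

end

/-! ### Stability in the classes `𝒜_k` -/

/-- Inside its closed span an orthonormal family is a Hilbert basis, so `‖x‖²` equals the sum of the
squared coefficients and inherits any bound on the finite partial sums. -/
lemma norm_sq_le_of_mem_topologicalClosure_span {E ι : Type*} [NormedAddCommGroup E]
    [InnerProductSpace ℂ E] [CompleteSpace E] {v : ι → E} (hv : Orthonormal ℂ v) {x : E}
    (hx : x ∈ (Submodule.span ℂ (range v)).topologicalClosure) {A : ℝ}
    (hA : ∀ s : Finset ι, ∑ i ∈ s, ‖⟪v i, x⟫_ℂ‖ ^ 2 ≤ A) : ‖x‖ ^ 2 ≤ A := by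
  set U := (Submodule.span ℂ (range v)).topologicalClosure with hU
  have : CompleteSpace U := (Submodule.isClosed_topologicalClosure _).completeSpace_coe
  have hvU : ∀ i, v i ∈ U := fun i =>
    Submodule.le_topologicalClosure _ (Submodule.subset_span ⟨i, rfl⟩)
  let w : ι → U := fun i => ⟨v i, hvU i⟩
  have hw : Orthonormal ℂ w := by
    classical
    rw [orthonormal_iff_ite] at hv ⊢
    exact fun i j => hv i j
  have hbot : (Submodule.span ℂ (range w))ᗮ = ⊥ := by
    rw [Submodule.eq_bot_iff]
    intro u hu
    have h1 : ∀ i, ⟪v i, (u : E)⟫_ℂ = 0 := fun i =>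
      (Submodule.mem_orthogonal _ _).1 hu (w i) (Submodule.subset_span ⟨i, rfl⟩)
    have h2 : (u : E) ∈ Uᗮ := by
      suffices (u : E) ∈ (Submodule.span ℂ (range v))ᗮ from
        (Submodule.orthogonal_closure (Submodule.span ℂ (range v))).symm ▸ this
      rw [Submodule.mem_orthogonal]
      intro y hy
      refine Submodule.span_induction (p := fun y _ => ⟪y, (u : E)⟫_ℂ = 0) ?_ ?_ ?_ ?_ hy
      · rintro _ ⟨i, rfl⟩; exact h1 i
      · simp
      · intro y z _ _ hy hz; rw [inner_add_left, hy, hz, add_zero]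
      · intro c y _ hy; rw [inner_smul_left, hy, mul_zero]
    have h3 : (u : E) = 0 := by
      rw [← inner_self_eq_zero (𝕜 := ℂ)]
      exact (Submodule.mem_orthogonal _ _).1 h2 _ u.2
    exact Subtype.ext h3
  let b := HilbertBasis.mkOfOrthogonalEqBot hw hbot
  have hb : ∀ i, b i = w i := fun i => by simp [b]
  have hs := (b.hasSum_inner_mul_inner ⟨x, hx⟩ ⟨x, hx⟩).mapL Complex.reCLM
  have e1 : ∀ i, Complex.reCLM (⟪(⟨x, hx⟩ : U), b i⟫_ℂ * ⟪b i, ⟨x, hx⟩⟫_ℂ) =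
      ‖⟪v i, x⟫_ℂ‖ ^ 2 := by
    intro i
    rw [hb, ← inner_conj_symm, Complex.conj_mul', ← Complex.ofReal_pow]
    rfl
  have e2 : Complex.reCLM ⟪(⟨x, hx⟩ : U), (⟨x, hx⟩ : U)⟫_ℂ = ‖x‖ ^ 2 := by
    rw [inner_self_eq_norm_sq_to_K]
    norm_cast
  simp only [e1, e2] at hs
  exact hasSum_le_of_sum_le hs hA

/-! ### Orthonormal sets of functions as orthonormal families in `L²` -/

section
variable {α ι : Type*} [MeasurableSpace α] {μ : Measure α} {f : ι → α → ℂ}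

lemma inner_toLp_left {g : α → ℂ} (hg : MemLp g 2 μ) (F : Lp ℂ 2 μ) :
    ⟪hg.toLp g, F⟫_ℂ = ∫ x, F x * starRingEnd ℂ (g x) ∂μ := by
  rw [L2.inner_def]
  refine integral_congr_ae ?_
  filter_upwards [hg.coeFn_toLp] with x hx
  rw [hx]; rfl

lemma inner_toLp_toLp {g h : α → ℂ} (hg : MemLp g 2 μ) (hh : MemLp h 2 μ) :
    ⟪hg.toLp g, hh.toLp h⟫_ℂ = ∫ x, h x * starRingEnd ℂ (g x) ∂μ := by
  rw [inner_toLp_left]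
  refine integral_congr_ae ?_
  filter_upwards [hh.coeFn_toLp] with x hx
  rw [hx]

lemma IsOrthonormalSet.orthonormal (hf : IsOrthonormalSet μ f) :
    Orthonormal ℂ fun i => (hf.memLp i).toLp (f i) := by
  classical
  rw [orthonormal_iff_ite]
  intro i j
  rw [inner_toLp_toLp]
  split_ifs with h
  · subst h; exact hf.norm_one i
  · exact hf.ortho j i (Ne.symm h)

lemma IsOrthonormalSet.closedSpan_eq (hf : IsOrthonormalSet μ f) : closedSpan μ f =
    (Submodule.span ℂ (range fun i => (hf.memLp i).toLp (f i))).topologicalClosure := by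
  rw [closedSpan]
  congr 2
  ext F
  refine exists_congr fun i => ⟨fun h => ?_, fun h => ?_⟩
  · exact Lp.ext ((hf.memLp i).coeFn_toLp.trans h.symm)
  · rw [← h]; exact (hf.memLp i).coeFn_toLp

end

/-! ### From coefficients in the ball to coefficients on the boundary -/

section
variable {d : ℕ} {I : ℕ → Type*} {f : (ℓ : ℕ) → I ℓ → Sph d → ℂ}

lemma continuous_integral_sphere {g : Sp d → ℂ} (hg : Continuous g) {φ : Sph d → ℂ}
    (hφ : Continuous φ) :
    Continuous fun r : ℝ => ∫ θ, g (r • (θ : Sp d)) * φ θ ∂sphereMeasure d := by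
  have h := continuous_parametric_integral_of_continuous (μ := sphereMeasure d)
    (f := fun (r : ℝ) (θ : Sph d) => g (r • (θ : Sp d)) * φ θ) (by fun_prop) isCompact_univ
  simpa using h

lemma integral_polar_mul_conj (hd : 0 < d) {g : Sp d → ℂ} (hg : Continuous g) {D : ℝ → ℂ}
    (hD : Continuous D) {φ : Sph d → ℂ} (hφ : Continuous φ) :
    ∫ x in ball 0 1, g x * starRingEnd ℂ (polarProd D φ x) =
      ∫ r, (∫ θ, g (r • (θ : Sp d)) * starRingEnd ℂ (φ θ) ∂sphereMeasure d) *
        starRingEnd ℂ (D r) ∂radialMeasure d := by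
  have hm : AEStronglyMeasurable (fun x => g x * starRingEnd ℂ (polarProd D φ x)) (ballMeasure d) :=
    hg.aestronglyMeasurable.mul (Complex.continuous_conj.comp_aestronglyMeasurable
      (aestronglyMeasurable_polarProd hd hD hφ))
  have hG : Continuous fun p : Sph d × ℝ =>
      g (polarMap d p) * starRingEnd ℂ (φ p.1) * starRingEnd ℂ (D p.2) :=
    ((hg.comp (continuous_polarMap d)).mul (Complex.continuous_conj.comp
      (hφ.comp continuous_fst))).mul (Complex.continuous_conj.comp (hD.comp continuous_snd))
  have hint : Integrable (fun p : Sph d × ℝ =>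
      g (polarMap d p) * starRingEnd ℂ (φ p.1) * starRingEnd ℂ (D p.2))
      ((sphereMeasure d).prod (radialMeasure d)) := by
    obtain ⟨M, hM⟩ := (isCompact_univ.prod (isCompact_Icc (a := (0 : ℝ)) (b := 1))
      |>.exists_bound_of_continuousOn (hG.continuousOn))
    refine Integrable.of_bound hG.aestronglyMeasurable M ?_
    have h := Measure.quasiMeasurePreserving_snd (μ := sphereMeasure d)
      (ν := radialMeasure d) |>.ae (ae_radialMeasure d)
    filter_upwards [h] with p hp
    exact hM p ⟨mem_univ _, hp.1.le, hp.2⟩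
  rw [integral_polar hd hm]
  have e : ∫ p, g (polarMap d p) * starRingEnd ℂ (polarProd D φ (polarMap d p))
      ∂(sphereMeasure d).prod (radialMeasure d) =
      ∫ p, g (polarMap d p) * starRingEnd ℂ (φ p.1) * starRingEnd ℂ (D p.2)
      ∂(sphereMeasure d).prod (radialMeasure d) := by
    refine integral_congr_ae ?_
    filter_upwards [ae_polarProd_polarMap D φ] with p hp
    rw [hp, map_mul]; ring
  rw [e, integral_prod_symm _ hint]
  refine integral_congr_ae (.of_forall fun r => ?_)
  exact integral_mul_const (L := ℂ) (starRingEnd ℂ (D r))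
    fun θ : Sph d => g (r • (θ : Sp d)) * starRingEnd ℂ (φ θ)

/-- For a continuous element of the closed span of the `ψ n k` (`k` fixed) the angular coefficients
on the boundary are obtained from the coefficients in `L²(B)`. -/
lemma integral_sphere_mul_conj_eq (hd : 0 < d) (hf : ∀ ℓ, IsHarmonicONB d ℓ (f ℓ)) (k : ℕ)
    {g : Sp d → ℂ} (hg : Continuous g) {F : Lp ℂ 2 (ballMeasure d)}
    (hF : F ∈ spaceWk d (angular f) (radial d I) k) (hFg : F =ᵐ[ballMeasure d] g)
    (n : Σ ℓ, I ℓ) :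
    ∫ θ, g (θ : Sph d) * starRingEnd ℂ (angular f n θ) ∂sphereMeasure d =
      (∫ x in ball 0 1, g x * starRingEnd ℂ (polarProd (radial d I n k) (angular f n) x)) *
        radial d I n k 1 := by
  have hcf : ∀ n : Σ ℓ, I ℓ, Continuous (angular f n) := fun n => (hf n.1).continuous n.2
  have hcR := fun n => continuous_radial d I n k
  have hA := isOrthonormalSet_angular hd hf
  set c := ∫ x in ball 0 1, g x * starRingEnd ℂ (polarProd (radial d I n k) (angular f n) x)
    with hc
  set H : ℝ → ℂ := fun r =>
    ∫ θ, g (r • (θ : Sp d)) * starRingEnd ℂ (angular f n θ) ∂sphereMeasure d with hH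
  have hHc : Continuous H := continuous_integral_sphere hg (Complex.continuous_conj.comp (hcf n))
  -- The goal is `D 1 = 0`. Since `D` is continuous, it suffices that it vanish in the weighted
  -- `L²`, which is seen by pairing `F` with `D(r) f_n(θ)`.
  set D : ℝ → ℂ := fun r => H r - c * radial d I n k r with hD
  have hDc : Continuous D := hHc.sub (continuous_const.mul (hcR n))
  have hψ : ∀ m, MemLp (polarProd (radial d I m k) (angular f m)) 2 (ballMeasure d) :=
    fun m => memLp_polarProd hd (hcR m) (hcf m) 2
  have hGm : MemLp (polarProd D (angular f n)) 2 (ballMeasure d) :=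
    memLp_polarProd hd hDc (hcf n) 2
  set G := hGm.toLp _
  set ψ := (hψ n).toLp _
  set b := ⟪G, ψ⟫_ℂ with hb
  have hbI : b = ∫ r, radial d I n k r * starRingEnd ℂ (D r) ∂radialMeasure d := by
    rw [hb, inner_toLp_toLp, integral_polarProd_mul_conj hd (hcR n) (hcf n) hDc (hcf n),
      hA.norm_one, one_mul]
  -- Both sides are continuous in `F`, so it is enough to check the spanning functions `ψ_{m,k}`:
  -- for `m = n` this is the definition of `b`, and for `m ≠ n` both sides vanish by angular
  -- orthogonality.
  have hker : ⟪G, F⟫_ℂ = b * ⟪ψ, F⟫_ℂ := by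
    have hle : spaceWk d (angular f) (radial d I) k ≤
        LinearMap.ker (innerSL ℂ G - b • innerSL ℂ ψ).toLinearMap := by
      refine Submodule.topologicalClosure_minimal _ (Submodule.span_le.2 ?_)
        (ContinuousLinearMap.isClosed_ker (innerSL ℂ G - b • innerSL ℂ ψ))
      rintro P ⟨m, hm⟩
      have hP : P = (hψ m).toLp _ := Lp.ext (hm.trans (hψ m).coeFn_toLp.symm)
      show ⟪G, P⟫_ℂ - b * ⟪ψ, P⟫_ℂ = 0
      by_cases hmn : m = n
      · subst hmn
        have h1 : ⟪ψ, P⟫_ℂ = 1 := by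
          rw [hP, inner_toLp_toLp]
          exact (isOrthonormalSet_zernike hd hf).norm_one (m, k)
        rw [h1, hb, mul_one, hP, sub_self]
      · rw [hP, inner_toLp_toLp, inner_toLp_toLp,
          integral_polarProd_mul_conj hd (hcR m) (hcf m) hDc (hcf n),
          integral_polarProd_mul_conj hd (hcR m) (hcf m) (hcR n) (hcf n), hA.ortho m n hmn]
        simp
    have := hle hF
    exact sub_eq_zero.1 this
  have hψF : ⟪ψ, F⟫_ℂ = c := by
    rw [inner_toLp_left, hc]
    exact integral_congr_ae (by filter_upwards [hFg] with x hx; rw [hx])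
  have hGF : ⟪G, F⟫_ℂ = ∫ r, H r * starRingEnd ℂ (D r) ∂radialMeasure d := by
    rw [inner_toLp_left, ← integral_polar_mul_conj hd hg hDc (hcf n)]
    exact integral_congr_ae (by filter_upwards [hFg] with x hx; rw [hx])
  have hint : ∀ {u : ℝ → ℂ}, Continuous u → Integrable u (radialMeasure d) := by
    intro u hu
    obtain ⟨M, hM⟩ := isCompact_Icc.exists_bound_of_continuousOn hu.continuousOn
      (s := Icc (0 : ℝ) 1)
    refine Integrable.of_bound hu.aestronglyMeasurable M ?_
    filter_upwards [ae_radialMeasure d] with r hr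
    exact hM r ⟨hr.1.le, hr.2⟩
  -- Since `D = H - c R`, the squared norm of `D` is `⟨G, F⟩ - c b`, which the two preceding
  -- computations make zero.
  have hzero : ∫ r, D r * starRingEnd ℂ (D r) ∂radialMeasure d = 0 := by
    have e : ∀ r, D r * starRingEnd ℂ (D r) = H r * starRingEnd ℂ (D r) -
        c * (radial d I n k r * starRingEnd ℂ (D r)) := fun r => by rw [hD]; ring
    have hcD := Complex.continuous_conj.comp hDc
    simp only [e]
    have hi1 : Integrable (fun r => H r * starRingEnd ℂ (D r)) (radialMeasure d) :=
      hint (hHc.mul hcD)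
    have hi2 : Integrable (fun r => c * (radial d I n k r * starRingEnd ℂ (D r)))
      (radialMeasure d) := (hint ((hcR n).mul hcD)).const_mul c
    rw [integral_sub hi1 hi2, integral_const_mul, ← hbI, ← hGF, hker, hψF]
    ring
  have hD1 : D 1 = 0 := by
    by_contra hne
    rw [integral_radialMeasure] at hzero
    have e : ∀ r : ℝ, r ^ (d - 1) • (D r * starRingEnd ℂ (D r)) =
        ((r ^ (d - 1) * ‖D r‖ ^ 2 : ℝ) : ℂ) := fun r => by
      rw [Complex.mul_conj', Complex.real_smul]; push_cast; rfl
    simp only [e] at hzero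
    rw [intervalIntegral.integral_ofReal, Complex.ofReal_eq_zero] at hzero
    -- The density `r^(d-1)` equals 1 at `r = 1`, so a nonzero value of `D` there would make the
    -- integral positive.
    have hpos : 0 < ∫ r in (0 : ℝ)..1, r ^ (d - 1) * ‖D r‖ ^ 2 := by
      refine intervalIntegral.integral_pos zero_lt_one ?_ (fun r hr => ?_) ⟨1, by simp, ?_⟩
      · exact ((continuous_pow _).mul (hDc.norm.pow 2)).continuousOn
      · have := hr.1.le; positivity
      · have := norm_pos_iff.2 hne; positivity
    exact hpos.ne' hzero
  have := sub_eq_zero.1 hD1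
  simpa [hH] using this

/-- The boundary coefficients are those in the ball times `R_{ℓ,k}(1)`, whose square is at least `4k
+ d`. Bessel's inequality on the sphere bounds their square sum by `|∂B| M²`, and Parseval in the
ball turns this into a bound for `‖F‖`. -/
lemma eLpNorm_le_of_boundary_bound (hd : 0 < d) (hf : ∀ ℓ, IsHarmonicONB d ℓ (f ℓ)) (k : ℕ)
    {g : Sp d → ℂ} (hg : Continuous g) {F : Lp ℂ 2 (ballMeasure d)}
    (hF : F ∈ spaceWk d (angular f) (radial d I) k) (hFg : F =ᵐ[ballMeasure d] g) {M : ℝ}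
    (hM0 : 0 ≤ M) (hM : ∀ᵐ θ : Sph d ∂sphereMeasure d, ‖g θ‖ ≤ M) :
    ‖F‖ ≤ √((sphereMeasure d).real univ / (4 * k + d)) * M := by
  have hA := isOrthonormalSet_angular hd hf
  have hgS : Continuous fun θ : Sph d => g θ := hg.comp continuous_subtype_val
  have hgm : MemLp (fun θ : Sph d => g θ) 2 (sphereMeasure d) :=
    hgS.memLp_of_hasCompactSupport (HasCompactSupport.of_compactSpace _)
  have hZ : IsOrthonormalSet (ballMeasure d)
      (fun n : Σ ℓ, I ℓ => polarProd (radial d I n k) (angular f n)) := by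
    have h := isOrthonormalSet_zernike hd hf
    exact ⟨fun n => h.memLp (n, k), fun n => h.norm_one (n, k),
      fun n m hnm => h.ortho (n, k) (m, k) (fun e => hnm (Prod.ext_iff.1 e).1)⟩
  have hpos : (0 : ℝ) < 4 * k + d := by positivity
  have hnorm : ‖hgm.toLp _‖ ^ 2 ≤ (sphereMeasure d).real univ * M ^ 2 := by
    have h2 : ‖hgm.toLp _‖ ^ 2 = ∫ θ, ‖g (θ : Sph d)‖ ^ 2 ∂sphereMeasure d := by
      refine Complex.ofReal_injective ?_
      rw [← integral_complex_ofReal]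
      push_cast
      simp only [← Complex.mul_conj']
      rw [← inner_toLp_toLp hgm hgm, inner_self_eq_norm_sq_to_K]
      rfl
    rw [h2]
    have h3 := integral_mono_ae (μ := sphereMeasure d) (f := fun θ => ‖g (θ : Sph d)‖ ^ 2)
      (g := fun _ => M ^ 2) (integrable_sphere (hgS.norm.pow 2)) (integrable_const _) (by
        filter_upwards [hM] with θ hθ
        exact pow_le_pow_left₀ (norm_nonneg _) hθ 2)
    rwa [integral_const, smul_eq_mul] at h3
  have key : ‖F‖ ^ 2 ≤ (sphereMeasure d).real univ * M ^ 2 / (4 * k + d) := by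
    rw [spaceWk, hZ.closedSpan_eq] at hF
    refine norm_sq_le_of_mem_topologicalClosure_span hZ.orthonormal hF fun s => ?_
    rw [le_div_iff₀ hpos, Finset.sum_mul]
    refine le_trans (Finset.sum_le_sum fun n _ => ?_)
      ((hA.orthonormal.sum_inner_products_le (hgm.toLp _) (s := s)).trans hnorm)
    have hF' : F ∈ spaceWk d (angular f) (radial d I) k := by
      rw [spaceWk, hZ.closedSpan_eq]; exact hF
    rw [inner_toLp_toLp, integral_sphere_mul_conj_eq hd hf k hg hF' hFg n, inner_toLp_left,
      norm_mul, norm_radial_one hd, mul_pow, Real.sq_sqrt (by positivity)]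
    have e : ∫ x, F x * starRingEnd ℂ (polarProd (radial d I n k) (angular f n) x)
        ∂ballMeasure d =
        ∫ x in ball 0 1, g x * starRingEnd ℂ (polarProd (radial d I n k) (angular f n) x) :=
      integral_congr_ae (by filter_upwards [hFg] with x hx; rw [hx])
    rw [e]
    -- Here `R_{ℓ,k}(1)² = 2ℓ + 4k + d` is bounded below by its value at `ℓ = 0`.
    refine mul_le_mul_of_nonneg_left ?_ (by positivity)
    have : (0 : ℝ) ≤ 2 * n.1 := by positivity
    linarith
  refine le_of_sq_le_sq ?_ (by positivity)
  rw [mul_pow, Real.sq_sqrt (by positivity)]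
  calc ‖F‖ ^ 2 ≤ _ := key
    _ = _ := by ring

/-- A continuous function on the closed unit ball extends continuously to the whole space. -/
lemma exists_continuous_extension {h : Sp d → ℝ} (hh : ContinuousOn h (closedBall 0 1)) :
    ∃ g : Sp d → ℝ, Continuous g ∧ ∀ x ∈ closedBall (0 : Sp d) 1, g x = h x := by
  -- The extension is composition with the radial retraction onto the closed ball.
  have hp : Continuous fun x : Sp d => (max 1 ‖x‖)⁻¹ • x := by
    refine Continuous.smul (Continuous.inv₀ (continuous_const.max continuous_norm) fun x => ?_)
      continuous_id
    exact (lt_of_lt_of_le one_pos (le_max_left _ _)).ne'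
  refine ⟨fun x => h ((max 1 ‖x‖)⁻¹ • x), hh.comp_continuous hp fun x => ?_, fun x hx => ?_⟩
  · rw [mem_closedBall_zero_iff, norm_smul, norm_inv, Real.norm_of_nonneg (by positivity),
      inv_mul_le_one₀ (by positivity)]
    exact le_max_right _ _
  · show h _ = h x
    rw [max_eq_left (mem_closedBall_zero_iff.1 hx), inv_one, one_smul]

lemma stability (hd : 0 < d) (hf : ∀ ℓ, IsHarmonicONB d ℓ (f ℓ)) {C : ℝ} (hC0 : 0 < C)
    (hC : IsBoundaryStabilityConstant d C) (k : ℕ) (γ₁ γ₂ : CPlus d)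
    {F : Lp ℂ 2 (ballMeasure d)} (hF : F ∈ spaceWk d (angular f) (radial d I) k)
    (hFg : F =ᵐ[ballMeasure d] fun x => ((γ₁.1 x - γ₂.1 x : ℝ) : ℂ)) :
    eLpNorm (fun x => γ₁.1 x - γ₂.1 x) 2 (ballMeasure d) ≤
      ENNReal.ofReal (√((sphereMeasure d).real univ / (4 * k + d)) * C * ‖dtn γ₁ - dtn γ₂‖) := by
  -- Conductivities are controlled only on the closed ball, so their difference is first replaced by
  -- a globally continuous function.
  obtain ⟨g, hgc, hg⟩ := exists_continuous_extension (γ₁.2.1.sub γ₂.2.1)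
  have hFg' : F =ᵐ[ballMeasure d] fun x => (g x : ℂ) := by
    filter_upwards [hFg, ae_restrict_mem measurableSet_ball] with x hx hxb
    rw [hx, hg x (ball_subset_closedBall hxb)]
    rfl
  have hM0 : 0 ≤ C * ‖dtn γ₁ - dtn γ₂‖ := by positivity
  have hM : ∀ᵐ θ : Sph d ∂sphereMeasure d, ‖(g θ : ℂ)‖ ≤ C * ‖dtn γ₁ - dtn γ₂‖ := by
    have h1 := ae_le_eLpNormEssSup (f := fun θ : Sph d => γ₁.1 θ - γ₂.1 θ) (μ := sphereMeasure d)
    filter_upwards [h1] with θ hθ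
    have h2 := hθ.trans (hC γ₁ γ₂)
    rw [← ofReal_norm, ENNReal.ofReal_le_ofReal_iff hM0] at h2
    rw [hg θ (sphere_subset_closedBall θ.2), Complex.norm_real]
    exact h2
  have h := eLpNorm_le_of_boundary_bound hd hf k (Complex.continuous_ofReal.comp hgc) hF hFg' hM0 hM
  have e : eLpNorm (fun x => γ₁.1 x - γ₂.1 x) 2 (ballMeasure d) = eLpNorm F 2 (ballMeasure d) := by
    rw [eLpNorm_congr_ae hFg]
    refine eLpNorm_congr_norm_ae (.of_forall fun x => ?_)
    rw [Complex.norm_real]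
  rw [e, ← ENNReal.ofReal_toReal (Lp.eLpNorm_ne_top F), ← Lp.norm_def, mul_assoc]
  exact ENNReal.ofReal_le_ofReal h

end

/-! ### Smooth functions with a pole outside the closed ball as elements of `H¹(B)` -/

section
variable {d : ℕ} {U : Sp d → ℂ} {p : Sp d}

lemma contDiffOn_pd (hU : ContDiffOn ℝ ∞ U {p}ᶜ) (i : Fin d) :
    ContDiffOn ℝ ∞ (pd i U) {p}ᶜ :=
  (hU.fderiv_of_isOpen isOpen_compl_singleton (m := ∞) (by simp)).clm_apply contDiffOn_const

lemma closedBall_subset_compl (hp : 1 < ‖p‖) : closedBall (0 : Sp d) 1 ⊆ {p}ᶜ := by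
  rintro x hx rfl
  exact absurd (mem_closedBall_zero_iff.1 hx) (not_le.2 hp)

lemma memLp_of_continuousOn {F : Type*} [NormedAddCommGroup F] {V : Sp d → F}
    (hV : ContinuousOn V (closedBall 0 1)) (q : ℝ≥0∞) : MemLp V q (ballMeasure d) := by
  obtain ⟨C, hC⟩ := (isCompact_closedBall (0 : Sp d) 1).exists_bound_of_continuousOn hV
  refine MemLp.of_bound ?_ C ?_
  · exact (hV.aestronglyMeasurable_of_isCompact (isCompact_closedBall 0 1)
      measurableSet_closedBall).mono_measure (Measure.restrict_mono_set _ ball_subset_closedBall)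
  · filter_upwards [ae_restrict_mem measurableSet_ball] with x hx
    exact hC x (ball_subset_closedBall hx)

/-- Integration by parts is legitimate because differentiability of `U` is needed only on the
support of the test function, which stays away from the pole. -/
lemma integral_mul_pd_test (hU : ContDiffOn ℝ ∞ U {p}ᶜ) (hp : 1 < ‖p‖) {φ : Sp d → ℂ}
    (hφ : IsTest φ) (i : Fin d) :
    ∫ x in ball 0 1, U x * pd i φ x = - ∫ x in ball 0 1, pd i U x * φ x := by
  have hsub := closedBall_subset_compl hp
  have hs0 : ∀ x ∉ ball (0 : Sp d) 1, φ x = 0 := fun x hx =>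
    image_eq_zero_of_notMem_tsupport fun h' => hx (hφ.supp h')
  have hsp : ∀ x ∉ ball (0 : Sp d) 1, pd i φ x = 0 := fun x hx => by
    have : x ∉ tsupport (fderiv ℝ φ) := fun h' => hx (hφ.supp (tsupport_fderiv_subset ℝ h'))
    simp [pd, image_eq_zero_of_notMem_tsupport this]
  have hint : ∀ {V ψ : Sp d → ℂ}, ContinuousOn V (closedBall 0 1) → Continuous ψ →
      (∀ x ∉ ball (0 : Sp d) 1, ψ x = 0) → Integrable fun x => V x * ψ x := by
    intro V ψ hV hψ h0
    have h := (memLp_of_continuousOn (hV.mul hψ.continuousOn) 1).integrable le_rfl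
    refine (integrableOn_iff_integrable_of_support_subset fun x hx => ?_).1 h
    by_contra hxb
    exact hx (by simp [h0 x hxb])
  have hUc : ContinuousOn U (closedBall 0 1) := hU.continuousOn.mono hsub
  have hUc' : ContinuousOn (pd i U) (closedBall 0 1) :=
    (contDiffOn_pd hU i).continuousOn.mono hsub
  rw [setIntegral_eq_integral_of_forall_compl_eq_zero (fun x hx => by simp [hsp x hx]),
    setIntegral_eq_integral_of_forall_compl_eq_zero (fun x hx => by simp [hs0 x hx])]
  refine integral_mul_fderiv_eq_neg_fderiv_mul_of_integrable ?_ ?_ ?_ ?_ ?_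
  · exact hint hUc' hφ.smooth.continuous hs0
  · exact hint hUc (hφ.continuous_pd i) hsp
  · exact hint hUc hφ.smooth.continuous hs0
  · intro x hx
    exact (hU.contDiffAt (isOpen_compl_singleton.mem_nhds
      (hsub (ball_subset_closedBall (hφ.supp hx))))).differentiableAt (by simp)
  · exact fun x _ => hφ.smooth.differentiable (by simp) x

lemma continuousOn_classGrad (hU : ContDiffOn ℝ ∞ U {p}ᶜ) : ContinuousOn (classGrad U) {p}ᶜ :=
  (PiLp.continuous_toLp 2 _).comp_continuousOn
    (continuousOn_pi.2 fun i => (contDiffOn_pd hU i).continuousOn)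

lemma exists_H1 (hU : ContDiffOn ℝ ∞ U {p}ᶜ) (hp : 1 < ‖p‖) :
    ∃ u : H1 d, valL d u =ᵐ[ballMeasure d] U ∧ gradL d u =ᵐ[ballMeasure d] classGrad U := by
  have hsub := closedBall_subset_compl hp
  have h1 := memLp_of_continuousOn (hU.continuousOn.mono hsub) 2
  have h2 := memLp_of_continuousOn ((continuousOn_classGrad hU).mono hsub) 2
  refine ⟨⟨WithLp.toLp 2 (h1.toLp _, h2.toLp _), ?_⟩, h1.coeFn_toLp, h2.coeFn_toLp⟩
  intro φ hφ i
  have e1 : ∫ x in ball 0 1, h1.toLp U x * pd i φ x = ∫ x in ball 0 1, U x * pd i φ x :=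
    integral_congr_ae (by filter_upwards [h1.coeFn_toLp] with x hx; rw [hx])
  have e2 : ∫ x in ball 0 1, h2.toLp (classGrad U) x i * φ x =
      ∫ x in ball 0 1, pd i U x * φ x :=
    integral_congr_ae (by filter_upwards [h2.coeFn_toLp] with x hx; rw [hx]; rfl)
  show ∫ x in ball 0 1, h1.toLp U x * pd i φ x = - ∫ x in ball 0 1, h2.toLp (classGrad U) x i * φ x
  rw [e1, e2, integral_mul_pd_test hU hp hφ]

/-- Harmonic functions are weakly harmonic. -/
lemma inner_gradL_eq_zero (hU : ContDiffOn ℝ ∞ U {p}ᶜ) (hp : 1 < ‖p‖)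
    (hharm : ∀ x ∈ ball (0 : Sp d) 1, ∑ i, pd i (pd i U) x = 0) {u : H1 d}
    (hu : gradL d u =ᵐ[ballMeasure d] classGrad U) 
    (hreal : ∀ i, ∀ x ∈ ball (0 : Sp d) 1, starRingEnd ℂ (pd i U x) = pd i U x)
    {v : H1 d} (hv : v ∈ H10 d) : ⟪gradL d v, gradL d u⟫_ℂ = 0 := by
  have hsub := closedBall_subset_compl hp
  set w := ContinuousLinearMap.adjoint (gradL d) (gradL d u) with hw
  -- Being orthogonal to `w` is a closed condition that expresses the claim, so it need only be
  -- checked on test functions.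
  suffices h : H10 d ≤ (ℂ ∙ w)ᗮ by
    have := (Submodule.mem_orthogonal_singleton_iff_inner_left).1 (h hv)
    rwa [hw, ContinuousLinearMap.adjoint_inner_right] at this
  refine Submodule.topologicalClosure_minimal _ (Submodule.span_le.2 ?_)
    (Submodule.isClosed_orthogonal _)
  rintro v ⟨φ, hφ, -, hv2⟩
  rw [SetLike.mem_coe, Submodule.mem_orthogonal_singleton_iff_inner_left, hw,
    ContinuousLinearMap.adjoint_inner_right, L2.inner_def]
  have hc : ∀ {V ψ : Sp d → ℂ}, ContDiffOn ℝ ∞ V {p}ᶜ → Continuous ψ →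
      Integrable (fun x => V x * ψ x) (ballMeasure d) := fun hV hψ =>
    (memLp_of_continuousOn ((hV.continuousOn.mono hsub).mul hψ.continuousOn) 1).integrable le_rfl
  -- The gradient of `U` is real, so the conjugate on the test function can be taken outside the
  -- whole integrand.
  have h1 : ∫ x, ⟪gradL d v x, gradL d u x⟫_ℂ ∂ballMeasure d =
      ∫ x, starRingEnd ℂ (∑ i, pd i U x * pd i φ x) ∂ballMeasure d := by
    refine integral_congr_ae ?_
    filter_upwards [hu, hv2, ae_restrict_mem measurableSet_ball] with x hx1 hx2 hx
    rw [hx1, hx2, PiLp.inner_apply, map_sum]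
    refine Finset.sum_congr rfl fun i _ => ?_
    simp only [classGrad, RCLike.inner_apply, map_mul, hreal i x hx]
  rw [h1, integral_conj, integral_finsetSum _ fun i _ =>
    hc (contDiffOn_pd hU i) (hφ.continuous_pd i)]
  have h2 : ∀ i, ∫ x, pd i U x * pd i φ x ∂ballMeasure d =
      - ∫ x in ball 0 1, pd i (pd i U) x * φ x := fun i =>
    integral_mul_pd_test (contDiffOn_pd hU i) hp hφ i
  simp only [h2]
  rw [Finset.sum_neg_distrib, ← integral_finsetSum _ fun i _ =>
    hc (contDiffOn_pd (contDiffOn_pd hU i) i) hφ.smooth.continuous]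
  have h3 : ∫ x in ball 0 1, ∑ i, pd i (pd i U) x * φ x = 0 := by
    refine integral_eq_zero_of_ae ?_
    filter_upwards [ae_restrict_mem measurableSet_ball] with x hx
    rw [← Finset.sum_mul, hharm x hx, zero_mul]
    rfl
  rw [h3]
  simp

end

/-! ### A dipole with pole outside the ball -/

section
variable {d : ℕ}

/-- The power `|x - p|^(2 β)`. -/
def powS (p : Sp d) (β : ℝ) (x : Sp d) : ℝ := (‖x - p‖ ^ 2) ^ β

/-- The dipole potential `(x - p)_i / |x - p|^d`. -/
def dipole (i : Fin d) (p : Sp d) (x : Sp d) : ℝ := (x i - p i) * powS p (-(d / 2 : ℝ)) x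

/-- The partial derivatives of the dipole potential. -/
def dipoleGrad (i : Fin d) (p : Sp d) (j : Fin d) (x : Sp d) : ℝ :=
  (if i = j then 1 else 0) * powS p (-(d / 2 : ℝ)) x -
    d * ((x i - p i) * (x j - p j) * powS p (-(d / 2 : ℝ) - 1) x)

lemma norm_sub_sq_ne_zero {p x : Sp d} (hx : x ≠ p) : ‖x - p‖ ^ 2 ≠ 0 :=
  pow_ne_zero 2 (norm_ne_zero_iff.2 (sub_ne_zero.2 hx))

lemma hasFDerivAt_powS {p x : Sp d} (hx : x ≠ p) (β : ℝ) : HasFDerivAt (powS p β)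
    ((β * powS p (β - 1) x) • (2 • innerSL ℝ (x - p) : Sp d →L[ℝ] ℝ)) x := by
  have h1 : HasFDerivAt (fun y : Sp d => ‖y - p‖ ^ 2) (2 • innerSL ℝ (x - p) : Sp d →L[ℝ] ℝ) x := by
    have := ((hasFDerivAt_id x).sub_const p).norm_sq
    simpa using this
  exact HasDerivAt.comp_hasFDerivAt (h₂ := fun s : ℝ => s ^ β) x
    (Real.hasDerivAt_rpow_const (Or.inl (norm_sub_sq_ne_zero hx))) h1

lemma hasFDerivAt_coord_sub (p x : Sp d) (i : Fin d) :
    HasFDerivAt (fun y : Sp d => y i - p i) (EuclideanSpace.proj (𝕜 := ℝ) i) x :=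
  (EuclideanSpace.proj (𝕜 := ℝ) i).hasFDerivAt.sub_const _

lemma pd_ofReal {f : Sp d → ℝ} {f' : Sp d →L[ℝ] ℝ} {x : Sp d} (h : HasFDerivAt f f' x) (j : Fin d) :
    pd j (fun y => (f y : ℂ)) x = (f' (EuclideanSpace.single j 1) : ℂ) := by
  have := Complex.ofRealCLM.hasFDerivAt.comp x h
  rw [pd, show (fun y => (f y : ℂ)) = Complex.ofRealCLM ∘ f from rfl, this.fderiv]
  rfl

lemma powS_sub_one {p x : Sp d} (hx : x ≠ p) (β : ℝ) :
    powS p (β - 1) x = powS p β x / ‖x - p‖ ^ 2 := by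
  rw [powS, powS, Real.rpow_sub_one (norm_sub_sq_ne_zero hx)]

lemma norm_sub_sq_eq_sum (p x : Sp d) : ‖x - p‖ ^ 2 = ∑ j, (x j - p j) ^ 2 := by
  rw [EuclideanSpace.norm_sq_eq]
  exact Finset.sum_congr rfl fun j _ => by rw [Real.norm_eq_abs, sq_abs]; rfl

lemma contDiffOn_dipole (i : Fin d) (p : Sp d) :
    ContDiffOn ℝ ∞ (fun x => (dipole i p x : ℂ)) {p}ᶜ := by
  refine Complex.ofRealCLM.contDiff.comp_contDiffOn (ContDiffOn.mul ?_ ?_)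
  · exact ((EuclideanSpace.proj (𝕜 := ℝ) i).contDiff.sub contDiff_const).contDiffOn
  · exact ((contDiff_id.sub contDiff_const).norm_sq ℝ).contDiffOn.rpow_const_of_ne
      fun x hx => norm_sub_sq_ne_zero hx

lemma pd_dipole (i j : Fin d) {p x : Sp d} (hx : x ≠ p) :
    pd j (fun y => (dipole i p y : ℂ)) x = dipoleGrad i p j x := by
  have h := (hasFDerivAt_coord_sub p x i).mul (hasFDerivAt_powS hx (-(d / 2 : ℝ)))
  rw [pd_ofReal (f := dipole i p) h]
  congr 1
  simp only [add_apply, smul_apply, smul_eq_mul, innerSL_apply_apply,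
    EuclideanSpace.inner_single_right, dipoleGrad]
  simp
  ring

lemma pd_pd_dipole (i j : Fin d) {p x : Sp d} (hx : x ≠ p) :
    pd j (pd j (fun y => (dipole i p y : ℂ))) x =
      ((-d * powS p (-(d / 2 : ℝ)) x / ‖x - p‖ ^ 2 * ((if i = j then 2 * (x i - p i) else 0) +
        (x i - p i) - (d + 2) * (x i - p i) * (x j - p j) ^ 2 / ‖x - p‖ ^ 2) : ℝ) : ℂ) := by
  have he : pd j (fun y => (dipole i p y : ℂ)) =ᶠ[nhds x] fun y => (dipoleGrad i p j y : ℂ) := by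
    filter_upwards [isOpen_compl_singleton.mem_nhds hx] with y hy
    exact pd_dipole i j hy
  have h := ((hasFDerivAt_powS hx (-(d / 2 : ℝ))).const_mul (if i = j then 1 else 0)).sub
    ((((hasFDerivAt_coord_sub p x i).mul (hasFDerivAt_coord_sub p x j)).mul
      (hasFDerivAt_powS hx (-(d / 2 : ℝ) - 1))).const_mul (d : ℝ))
  rw [pd, he.fderiv_eq, ← pd, pd_ofReal (f := dipoleGrad i p j) h]
  congr 1
  have hs := norm_sub_sq_ne_zero hx
  simp only [add_apply, sub_apply, smul_apply, smul_eq_mul, innerSL_apply_apply,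
    EuclideanSpace.inner_single_right, powS_sub_one hx]
  generalize ‖x - p‖ ^ 2 = s at *
  generalize powS p (-(d / 2 : ℝ)) x = A at *
  by_cases hij : i = j
  · subst hij
    simp
    field_simp
    ring
  · simp [hij]
    field_simp
    ring

/-- Up to a constant the dipole is a partial derivative of the fundamental solution of the
Laplacian. In the sum, the contributions `2`, `d` and `-(d + 2)` times `x_i - p_i` cancel. -/
lemma sum_pd_pd_dipole (i : Fin d) {p x : Sp d} (hx : x ≠ p) :
    ∑ j, pd j (pd j (fun y => (dipole i p y : ℂ))) x = 0 := by
  simp only [pd_pd_dipole i _ hx]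
  rw [← Complex.ofReal_sum, Complex.ofReal_eq_zero, ← Finset.mul_sum, Finset.sum_sub_distrib,
    Finset.sum_add_distrib, ← Finset.sum_div, ← Finset.mul_sum, ← norm_sub_sq_eq_sum,
    mul_div_cancel_right₀ _ (norm_sub_sq_ne_zero hx)]
  refine mul_eq_zero_of_right _ ?_
  simp
  ring

/-- The quotient in the last factor lies in `[0,1]`, so for `d ≥ 2` that factor is between 1 and
`(d-1)²`. Thus the gradient is comparable to `|x - p|^(-d)` in every direction. -/
lemma sum_sq_dipoleGrad (i : Fin d) {p x : Sp d} (hx : x ≠ p) :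
    ∑ j, dipoleGrad i p j x ^ 2 = powS p (-(d / 2 : ℝ)) x ^ 2 *
      (1 + (d ^ 2 - 2 * d) * ((x i - p i) ^ 2 / ‖x - p‖ ^ 2)) := by
  have hs := norm_sub_sq_ne_zero hx
  have h : ∀ j, dipoleGrad i p j x ^ 2 = powS p (-(d / 2 : ℝ)) x ^ 2 *
      ((if i = j then 1 - 2 * d * (x i - p i) ^ 2 / ‖x - p‖ ^ 2 else 0) +
        d ^ 2 * (x i - p i) ^ 2 / (‖x - p‖ ^ 2) ^ 2 * (x j - p j) ^ 2) := by
    intro j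
    rw [dipoleGrad, powS_sub_one hx]
    by_cases hij : i = j
    · subst hij; simp only [if_true]; field_simp; ring
    · simp only [if_neg hij]; field_simp; ring
  simp only [h]
  rw [← Finset.mul_sum, Finset.sum_add_distrib, ← Finset.mul_sum, ← norm_sub_sq_eq_sum]
  simp only [Finset.sum_ite_eq, Finset.mem_univ, if_true]
  congr 1
  field_simp
  ring

lemma sq_powS {p x : Sp d} : powS p (-(d / 2 : ℝ)) x ^ 2 = (‖x - p‖ ^ (2 * d))⁻¹ := by
  rw [powS, ← Real.rpow_natCast, ← Real.rpow_mul (by positivity)]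
  have : -(d / 2 : ℝ) * (2 : ℕ) = -(d : ℝ) := by push_cast; ring
  rw [this, Real.rpow_neg (by positivity), Real.rpow_natCast, pow_mul]

lemma norm_classGrad_dipole (i : Fin d) {p x : Sp d} (hx : x ≠ p) :
    ‖classGrad (fun y => (dipole i p y : ℂ)) x‖ ^ 2 = ∑ j, dipoleGrad i p j x ^ 2 := by
  rw [EuclideanSpace.norm_sq_eq]
  refine Finset.sum_congr rfl fun j _ => ?_
  rw [classGrad]
  simp only [pd_dipole i j hx, Complex.norm_real, Real.norm_eq_abs, sq_abs]

lemma sq_coord_div_le_one (i : Fin d) (p x : Sp d) :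
    (x i - p i) ^ 2 / ‖x - p‖ ^ 2 ≤ 1 := by
  refine div_le_one_of_le₀ ?_ (by positivity)
  rw [norm_sub_sq_eq_sum]
  exact Finset.single_le_sum (f := fun j => (x j - p j) ^ 2) (fun _ _ => sq_nonneg _)
    (Finset.mem_univ i)

lemma le_norm_classGrad_dipole (hd : 2 ≤ d) (i : Fin d) {p x : Sp d} (hx : x ≠ p) :
    (‖x - p‖ ^ (2 * d))⁻¹ ≤ ‖classGrad (fun y => (dipole i p y : ℂ)) x‖ ^ 2 := by
  rw [norm_classGrad_dipole i hx, sum_sq_dipoleGrad i hx, sq_powS]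
  have hd' : (2 : ℝ) ≤ d := by exact_mod_cast hd
  have h1 : 0 ≤ ((d : ℝ) ^ 2 - 2 * d) * ((x i - p i) ^ 2 / ‖x - p‖ ^ 2) :=
    mul_nonneg (by nlinarith) (by positivity)
  exact le_mul_of_one_le_right (by positivity) (by linarith)

lemma norm_classGrad_dipole_le (hd : 2 ≤ d) (i : Fin d) {p x : Sp d} (hx : x ≠ p) :
    ‖classGrad (fun y => (dipole i p y : ℂ)) x‖ ^ 2 ≤ d ^ 2 * (‖x - p‖ ^ (2 * d))⁻¹ := by
  rw [norm_classGrad_dipole i hx, sum_sq_dipoleGrad i hx, sq_powS, mul_comm]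
  have hd' : (2 : ℝ) ≤ d := by exact_mod_cast hd
  have h1 : ((d : ℝ) ^ 2 - 2 * d) * ((x i - p i) ^ 2 / ‖x - p‖ ^ 2) ≤ (d ^ 2 - 2 * d) * 1 :=
    mul_le_mul_of_nonneg_left (sq_coord_div_le_one i p x) (by nlinarith)
  exact mul_le_mul_of_nonneg_right (by linarith) (by positivity)

/-- This bounds the `L²` norm of the dipole by that of its gradient; Poincaré's inequality is not
available, as the dipole does not vanish on the boundary. -/
lemma norm_dipole_le (hd : 2 ≤ d) (i : Fin d) {p x : Sp d} (hx : x ≠ p) :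
    ‖(dipole i p x : ℂ)‖ ^ 2 ≤
      ‖x - p‖ ^ 2 * ‖classGrad (fun y => (dipole i p y : ℂ)) x‖ ^ 2 := by
  refine le_trans ?_ (mul_le_mul_of_nonneg_left (le_norm_classGrad_dipole hd i hx) (by positivity))
  rw [Complex.norm_real, Real.norm_eq_abs, sq_abs, dipole, mul_pow, sq_powS]
  refine mul_le_mul_of_nonneg_right ?_ (by positivity)
  exact (div_le_one (lt_of_le_of_ne (sq_nonneg _) (norm_sub_sq_ne_zero hx).symm)).1
    (sq_coord_div_le_one i p x)

end

/-! ### Existence of a boundary stability constant -/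

section
variable {d : ℕ}

lemma conj_energy (γ : Sp d → ℝ) (u v : H1 d) :
    starRingEnd ℂ (energy γ u v) = energy γ v u := by
  rw [energy, energy, ← integral_conj]
  refine integral_congr_ae (.of_forall fun x => ?_)
  simp only [map_mul, map_sum, Complex.conj_ofReal, Complex.conj_conj]
  congr 1
  exact Finset.sum_congr rfl fun i _ => mul_comm _ _

lemma energy_sub_left {γ : Sp d → ℝ} (h : γ ∈ CPlus d) (u w v : H1 d) :
    energy γ (u - w) v = energy γ u v - energy γ w v := by
  simp only [← inner_energyOp h, map_sub, inner_sub_right]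

/-- If `u` is weakly harmonic and `γ ∇u` is close to `c ∇u`, then the boundary form of `γ` at the
trace of `u` is close to `c ‖∇u‖²`. -/
lemma norm_dtn_sub_le (hd : 0 < d) (γ : CPlus d) {m : ℝ} (hm : 0 < m)
    (hmb : ∀ u : H1 d, m * ‖gradL d u‖ ^ 2 ≤ ‖energy γ.1 u u‖) {u : H1 d}
    (hu : ∀ v ∈ H10 d, ⟪gradL d v, gradL d u⟫_ℂ = 0) (c : ℝ) {η : ℝ}
    (hη : ‖mulL γ.2 (gradL d u) - (c : ℂ) • gradL d u‖ ≤ η) :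
    ‖dtn γ (trace d u) (trace d u) - ((c * ‖gradL d u‖ ^ 2 : ℝ) : ℂ)‖ ≤
      η * ‖gradL d u‖ + η ^ 2 / m := by
  obtain ⟨S, hS, hSu, -⟩ := exists_solution_operator hd γ.2
  have hη0 : 0 ≤ η := (norm_nonneg _).trans hη
  set w := u - S u with hw
  have hwm : w ∈ H10 d := hSu u
  have htr : trace d u = trace d (S u) := (Submodule.Quotient.eq _).2 hwm
  -- `S u` is the `γ`-solution with the trace of `u`, so the form is `energy γ (S u) u`; the
  -- correction `w = u - S u` lies in `H¹₀(B)`.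
  have hQ : dtn γ (trace d u) (trace d u) = energy γ.1 (S u) u := by
    conv_lhs => enter [1, 2]; rw [htr]
    exact dtn_spec γ _ _ (hS u)
  have hsplit : energy γ.1 (S u) u = energy γ.1 u u - energy γ.1 w u := by
    rw [hw, energy_sub_left γ.2]; ring
  have hpert : ∀ v : H1 d, ⟪gradL d v, mulL γ.2 (gradL d u) - (c : ℂ) • gradL d u⟫_ℂ =
      energy γ.1 u v - c * ⟪gradL d v, gradL d u⟫_ℂ := fun v => by
    rw [inner_sub_right, inner_smul_right, inner_mulL]
  have hle : ∀ v : H1 d, ‖energy γ.1 u v - c * ⟪gradL d v, gradL d u⟫_ℂ‖ ≤ η * ‖gradL d v‖ :=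
    fun v => by
      rw [← hpert, mul_comm]
      exact (norm_inner_le_norm _ _).trans (mul_le_mul_of_nonneg_left hη (norm_nonneg _))
  -- Harmonicity of `u` removes the main term `c ⟨∇w, ∇u⟩`, so only the perturbation is left.
  have huw : ‖energy γ.1 u w‖ ≤ η * ‖gradL d w‖ := by
    have := hle w
    rwa [hu w hwm, mul_zero, sub_zero] at this
  have hww : energy γ.1 w w = energy γ.1 u w := by
    conv_lhs => enter [2]; rw [hw]
    rw [energy_sub_left γ.2, hS u w hwm, sub_zero]
  -- Since `S u` is a weak solution, the energy of `w` equals `energy γ u w`; coercivity then gives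
  -- `m ‖∇w‖² ≤ η ‖∇w‖`.
  have hgw : ‖gradL d w‖ ≤ η / m := by
    rw [le_div_iff₀ hm]
    have h1 := (hmb w).trans (hww ▸ huw)
    rcases (norm_nonneg (gradL d w)).eq_or_lt with h0 | h0
    · rw [← h0, zero_mul]; exact hη0
    · nlinarith
  have hwu : ‖energy γ.1 w u‖ ≤ η ^ 2 / m := by
    rw [← conj_energy, RCLike.norm_conj]
    refine huw.trans ((mul_le_mul_of_nonneg_left hgw hη0).trans_eq ?_)
    ring
  have huu := hle u
  rw [inner_self_eq_norm_sq_to_K] at huu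
  rw [hQ, hsplit]
  have e : energy γ.1 u u - energy γ.1 w u - ((c * ‖gradL d u‖ ^ 2 : ℝ) : ℂ) =
      (energy γ.1 u u - c * (‖gradL d u‖ : ℂ) ^ 2) - energy γ.1 w u := by
    push_cast; ring
  rw [e]
  exact (norm_sub_le _ _).trans (add_le_add huu hwu)

/-- `u` is a weakly harmonic function on the ball whose gradient is comparable to
`|x - p|^(-d)`. -/
structure IsDipoleAt (p : Sp d) (u : H1 d) : Prop where
  harmonic : ∀ v ∈ H10 d, ⟪gradL d v, gradL d u⟫_ℂ = 0
  norm_le : ‖u‖ ^ 2 ≤ 10 * ‖gradL d u‖ ^ 2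
  lower : ∀ᵐ x ∂ballMeasure d, (‖x - p‖ ^ (2 * d))⁻¹ ≤ ‖gradL d u x‖ ^ 2
  upper : ∀ᵐ x ∂ballMeasure d, ‖gradL d u x‖ ^ 2 ≤ d ^ 2 * (‖x - p‖ ^ (2 * d))⁻¹

lemma exists_isDipoleAt (hd : 2 ≤ d) {p : Sp d} (hp : 1 < ‖p‖) (hp2 : ‖p‖ ≤ 2) :
    ∃ u : H1 d, IsDipoleAt p u := by
  have hne : ∀ x ∈ ball (0 : Sp d) 1, x ≠ p := fun x hx =>
    closedBall_subset_compl hp (ball_subset_closedBall hx)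
  set i : Fin d := ⟨0, by omega⟩
  have hU := contDiffOn_dipole i p
  obtain ⟨u, hu1, hu2⟩ := exists_H1 hU hp
  refine ⟨u, ?_, ?_, ?_, ?_⟩
  · intro v hv
    refine inner_gradL_eq_zero hU hp (fun x hx => sum_pd_pd_dipole i (hne x hx)) hu2 ?_ hv
    intro j x hx
    rw [pd_dipole i j (hne x hx), Complex.conj_ofReal]
  · have h1 : ‖u‖ ^ 2 = ‖valL d u‖ ^ 2 + ‖gradL d u‖ ^ 2 :=
      WithLp.prod_norm_sq_eq_of_L2 (show weakGradGraph d from u).1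
    -- The pole has norm at most 2, so `|x - p| ≤ 3` in the ball. The resulting 9, plus 1 for the
    -- gradient, is the 10 of the stability constant.
    have h2 : ‖valL d u‖ ^ 2 ≤ 9 * ‖gradL d u‖ ^ 2 := by
      rw [norm_sq_eq_integral, norm_sq_eq_integral, ← integral_const_mul]
      refine integral_mono_ae ((Lp.memLp (valL d u)).integrable_norm_pow (by simp))
        (((Lp.memLp (gradL d u)).integrable_norm_pow (by simp)).const_mul 9) ?_
      filter_upwards [hu1, hu2, ae_restrict_mem measurableSet_ball] with x hx1 hx2 hx
      rw [hx1, hx2]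
      refine (norm_dipole_le hd i (hne x hx)).trans ?_
      have h3 : ‖x - p‖ ≤ 3 := (norm_sub_le x p).trans (by
        have := mem_ball_zero_iff.1 hx; linarith)
      have h4 : ‖x - p‖ ^ 2 ≤ 9 := by nlinarith [norm_nonneg (x - p)]
      exact mul_le_mul_of_nonneg_right h4 (by positivity)
    linarith
  · filter_upwards [hu2, ae_restrict_mem measurableSet_ball] with x hx2 hx
    rw [hx2]
    exact le_norm_classGrad_dipole hd i (hne x hx)
  · filter_upwards [hu2, ae_restrict_mem measurableSet_ball] with x hx2 hx
    rw [hx2]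
    exact norm_classGrad_dipole_le hd i (hne x hx)

lemma integrable_norm_sq_gradL (u : H1 d) :
    Integrable (fun x => ‖gradL d u x‖ ^ 2) (ballMeasure d) :=
  (Lp.memLp (gradL d u)).integrable_norm_pow (by simp)

/-- The dipole energy blows up as the pole approaches the boundary. The ball of radius `ε` about
`(1-ε) x₀` lies in `B` within `3ε` of the pole, so it alone contributes at least `(3ε)^(-2d) ε^d
|B|`. -/
lemma IsDipoleAt.le_norm_sq (hd : 0 < d) {x₀ : Sp d} (hx₀ : ‖x₀‖ = 1) {ε : ℝ} (hε : 0 < ε)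
    (hε1 : ε ≤ 1) {u : H1 d} (hu : IsDipoleAt ((1 + ε) • x₀) u) :
    (volume : Measure (Sp d)).real (ball 0 1) / 9 ^ d / ε ≤ ‖gradL d u‖ ^ 2 := by
  set V := (volume : Measure (Sp d)).real (ball 0 1) with hV
  set b := ball ((1 - ε) • x₀) ε with hb
  have hsub : b ⊆ ball 0 1 := by
    intro x hx
    rw [mem_ball_zero_iff]
    have h1 : ‖x - (1 - ε) • x₀‖ < ε := by rwa [hb, mem_ball_iff_norm] at hx
    have h2 : ‖(1 - ε) • x₀‖ = 1 - ε := by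
      rw [norm_smul, hx₀, Real.norm_of_nonneg (by linarith), mul_one]
    have h3 : ‖x‖ ≤ ‖x - (1 - ε) • x₀‖ + ‖(1 - ε) • x₀‖ := by
      simpa using norm_add_le (x - (1 - ε) • x₀) ((1 - ε) • x₀)
    linarith
  have hdist : ∀ x ∈ b, ‖x - (1 + ε) • x₀‖ ≤ 3 * ε := by
    intro x hx
    have h1 : ‖x - (1 - ε) • x₀‖ < ε := by rwa [hb, mem_ball_iff_norm] at hx
    have h2 : x - (1 + ε) • x₀ = (x - (1 - ε) • x₀) - (2 * ε) • x₀ := by module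
    have h3 : ‖(2 * ε) • x₀‖ = 2 * ε := by
      rw [norm_smul, hx₀, Real.norm_of_nonneg (by linarith), mul_one]
    rw [h2]
    exact (norm_sub_le _ _).trans (by linarith)
  have hvol : (volume : Measure (Sp d)).real b = ε ^ d * V := by
    rw [hb, Measure.real, Measure.addHaar_ball_of_pos volume _ hε, ENNReal.toReal_mul,
      ENNReal.toReal_ofReal (by positivity), finrank_euclideanSpace_fin]
    rfl
  have hfin : volume b ≠ ⊤ := measure_ball_lt_top.ne
  have hI := integrable_norm_sq_gradL u
  have h1 : ((3 * ε) ^ (2 * d))⁻¹ * (ε ^ d * V) ≤ ∫ x in b, ‖gradL d u x‖ ^ 2 := by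
    rw [← hvol, mul_comm, ← smul_eq_mul, ← setIntegral_const]
    refine setIntegral_mono_ae_restrict (integrableOn_const hfin)
      (IntegrableOn.mono_set (t := ball 0 1) hI hsub) ?_
    have hl := ae_restrict_of_ae_restrict_of_subset hsub hu.lower
    have hI' : ∀ᵐ x ∂volume.restrict b, x ≠ (1 + ε) • x₀ := by
      filter_upwards [ae_restrict_mem measurableSet_ball] with x hx h
      have h5 := mem_ball_zero_iff.1 (hsub hx)
      rw [h, norm_smul, hx₀, Real.norm_of_nonneg (by linarith)] at h5
      linarith
    filter_upwards [hl, hI', ae_restrict_mem measurableSet_ball] with x hx hne hxb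
    refine le_trans ?_ hx
    have : 0 < ‖x - (1 + ε) • x₀‖ := norm_pos_iff.2 (sub_ne_zero.2 hne)
    exact inv_anti₀ (by positivity) (pow_le_pow_left₀ this.le (hdist x hxb) _)
  have h2 : ∫ x in b, ‖gradL d u x‖ ^ 2 ≤ ‖gradL d u‖ ^ 2 := by
    rw [norm_sq_eq_integral]
    exact setIntegral_mono_set hI (.of_forall fun x => by positivity) hsub.eventuallyLE
  refine le_trans ?_ (h1.trans h2)
  have h3 : ((3 * ε) ^ (2 * d))⁻¹ * (ε ^ d * V) = V / 9 ^ d / ε ^ d := by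
    have h9 : (9 : ℝ) ^ d = 3 ^ d * 3 ^ d := by rw [← mul_pow]; norm_num
    rw [two_mul, pow_add, mul_pow, h9]
    field_simp
  rw [h3]
  have hV0 : 0 ≤ V := measureReal_nonneg
  exact div_le_div_of_nonneg_left (by positivity) (by positivity)
    (pow_le_of_le_one hε.le hε1 hd.ne')

/-- The gradients of dipoles concentrate at a boundary point as the pole approaches it. -/
lemma IsDipoleAt.exists_concentration (hd : 0 < d) {γ : Sp d → ℝ} (hγ : γ ∈ CPlus d) {x₀ : Sp d}
    (hx₀ : ‖x₀‖ = 1) {σ : ℝ} (hσ : 0 < σ) :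
    ∃ ε₀ > (0 : ℝ), ∀ ε : ℝ, 0 < ε → ε ≤ ε₀ → ∀ u : H1 d, IsDipoleAt ((1 + ε) • x₀) u →
      ‖mulL hγ (gradL d u) - (γ x₀ : ℂ) • gradL d u‖ ≤ σ * ‖gradL d u‖ := by
  have hx₀m : x₀ ∈ closedBall (0 : Sp d) 1 := by simp [hx₀]
  obtain ⟨δ, hδ, hcont⟩ := Metric.continuousOn_iff.1 hγ.1 x₀ hx₀m (σ / 2) (by positivity)
  obtain ⟨M, hM⟩ := (isCompact_closedBall (0 : Sp d) 1).exists_bound_of_continuousOn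
    (hγ.1.sub (continuousOn_const (c := γ x₀)))
  set V := (volume : Measure (Sp d)).real (ball 0 1) with hV
  have hV0 : 0 < V := by
    rw [hV]
    exact ENNReal.toReal_pos (measure_ball_pos volume _ one_pos).ne' measure_ball_lt_top.ne
  -- A bound for `|γ(x) - γ(x₀)|² |∇u|²` at distance at least `δ` from `x₀`, independent of `ε`.
  set K := M ^ 2 * (d ^ 2 * ((δ / 2) ^ (2 * d))⁻¹) with hK
  have hK0 : 0 ≤ K := by positivity
  -- The bound `δ/2` keeps points at distance `δ` from `x₀` at least `δ/2` away from the pole. The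
  -- last bound makes the far contribution `K V` at most half of `σ² ‖∇u‖²`, because the energy is
  -- of order at least `1/ε`; the `+ 1` keeps the denominator positive.
  refine ⟨min (min 1 (δ / 2)) (σ ^ 2 / 2 * (V / 9 ^ d) / (K * V + 1)), by positivity,
    fun ε hε hεle u hu => ?_⟩
  have hε1 : ε ≤ 1 := hεle.trans ((min_le_left _ _).trans (min_le_left _ _))
  have hεδ : ε ≤ δ / 2 := hεle.trans ((min_le_left _ _).trans (min_le_right _ _))
  have hεK : ε ≤ σ ^ 2 / 2 * (V / 9 ^ d) / (K * V + 1) := hεle.trans (min_le_right _ _)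
  have hlow := hu.le_norm_sq hd hx₀ hε hε1
  have hI := integrable_norm_sq_gradL u
  have hcoe : ∀ᵐ x ∂ballMeasure d, (mulL hγ (gradL d u) - (γ x₀ : ℂ) • gradL d u : Lp _ 2 _) x =
      ((γ x - γ x₀ : ℝ) : ℂ) • gradL d u x := by
    filter_upwards [Lp.coeFn_sub (mulL hγ (gradL d u)) ((γ x₀ : ℂ) • gradL d u),
      Lp.coeFn_smul (γ x₀ : ℂ) (gradL d u), coeFn_mulL hγ (gradL d u)] with x h1 h2 h3
    rw [h1, Pi.sub_apply, h2, h3, Pi.smul_apply, Complex.ofReal_sub, sub_smul]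
  have hmain : ‖mulL hγ (gradL d u) - (γ x₀ : ℂ) • gradL d u‖ ^ 2 ≤
      σ ^ 2 / 2 * ‖gradL d u‖ ^ 2 + K * V := by
    have hVb : K * V = ∫ _ in ball (0 : Sp d) 1, K := by
      rw [setIntegral_const, smul_eq_mul, mul_comm]
    rw [norm_sq_eq_integral, norm_sq_eq_integral, ← integral_const_mul, hVb,
      ← integral_add (hI.const_mul _) (integrableOn_const measure_ball_lt_top.ne)]
    refine integral_mono_ae ((Lp.memLp _).integrable_norm_pow (by simp))
      ((hI.const_mul _).add (integrableOn_const measure_ball_lt_top.ne)) ?_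
    filter_upwards [hcoe, hu.upper, ae_restrict_mem measurableSet_ball] with x hx hup hxb
    have hxc := ball_subset_closedBall hxb
    rw [hx, norm_smul, Complex.norm_real, mul_pow]
    by_cases hxd : dist x x₀ < δ
    · have h1 : ‖γ x - γ x₀‖ ≤ σ / 2 := by
        rw [← dist_eq_norm]; exact (hcont x hxc hxd).le
      have h2 : ‖γ x - γ x₀‖ ^ 2 ≤ σ ^ 2 / 2 := by
        nlinarith [norm_nonneg (γ x - γ x₀)]
      have h3 := mul_le_mul_of_nonneg_right h2 (sq_nonneg ‖gradL d u x‖)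
      show _ ≤ σ ^ 2 / 2 * ‖gradL d u x‖ ^ 2 + K
      linarith
    · have h1 : δ / 2 ≤ ‖x - (1 + ε) • x₀‖ := by
        have h2 : x - x₀ = (x - (1 + ε) • x₀) + ε • x₀ := by module
        have h3 := norm_add_le (x - (1 + ε) • x₀) (ε • x₀)
        rw [← h2, norm_smul, hx₀, Real.norm_of_nonneg hε.le, mul_one, ← dist_eq_norm] at h3
        linarith [not_lt.1 hxd]
      have h2 : ‖gradL d u x‖ ^ 2 ≤ d ^ 2 * ((δ / 2) ^ (2 * d))⁻¹ := by
        refine hup.trans (mul_le_mul_of_nonneg_left ?_ (by positivity))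
        exact inv_anti₀ (by positivity) (pow_le_pow_left₀ (by positivity) h1 _)
      have h3 : ‖γ x - γ x₀‖ ^ 2 ≤ M ^ 2 := pow_le_pow_left₀ (norm_nonneg _) (hM x hxc) 2
      have h4 := mul_le_mul h3 h2 (by positivity) (by positivity)
      have h5 : 0 ≤ σ ^ 2 / 2 * ‖gradL d u x‖ ^ 2 := by positivity
      show _ ≤ σ ^ 2 / 2 * ‖gradL d u x‖ ^ 2 + K
      linarith
  have hKV : K * V ≤ σ ^ 2 / 2 * ‖gradL d u‖ ^ 2 := by
    have h1 := mul_le_mul_of_nonneg_left hlow (show 0 ≤ σ ^ 2 / 2 by positivity)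
    refine le_trans ?_ h1
    rw [← mul_div_assoc, le_div_iff₀ hε]
    have h2 := (le_div_iff₀ (by positivity : 0 < K * V + 1)).1 hεK
    nlinarith
  refine le_of_sq_le_sq ?_ (by positivity)
  rw [mul_pow]
  linarith

/-- One dipole near `x₀` serves both conductivities. Its two boundary forms differ by at most `N
‖u‖² ≤ 10 N ‖∇u‖²` and approximate `γ_i(x₀) ‖∇u‖²`; dividing by `‖∇u‖²` and letting `σ → 0` leaves
the constant 10. -/
lemma abs_sub_le_dtn (hd : 2 ≤ d) (γ₁ γ₂ : CPlus d) {x₀ : Sp d} (hx₀ : ‖x₀‖ = 1) :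
    |γ₁.1 x₀ - γ₂.1 x₀| ≤ 10 * ‖dtn γ₁ - dtn γ₂‖ := by
  have hd0 : 0 < d := by omega
  obtain ⟨m₁, hm₁, hb₁⟩ := energy_self_bound γ₁.2
  obtain ⟨m₂, hm₂, hb₂⟩ := energy_self_bound γ₂.2
  set N := ‖dtn γ₁ - dtn γ₂‖ with hN
  have key : ∀ σ : ℝ, 0 < σ →
      |γ₁.1 x₀ - γ₂.1 x₀| ≤ 10 * N + (σ + σ ^ 2 / m₁) + (σ + σ ^ 2 / m₂) := by
    intro σ hσ
    obtain ⟨ε₁, hε₁, h₁⟩ := IsDipoleAt.exists_concentration hd0 γ₁.2 hx₀ hσ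
    obtain ⟨ε₂, hε₂, h₂⟩ := IsDipoleAt.exists_concentration hd0 γ₂.2 hx₀ hσ
    set ε := min 1 (min ε₁ ε₂) with hε
    have hε0 : 0 < ε := by positivity
    have hn : ‖(1 + ε) • x₀‖ = 1 + ε := by
      rw [norm_smul, hx₀, Real.norm_of_nonneg (by positivity), mul_one]
    obtain ⟨u, hu⟩ := exists_isDipoleAt (p := (1 + ε) • x₀) hd (by rw [hn]; linarith)
      (by rw [hn]; linarith [min_le_left 1 (min ε₁ ε₂)])
    have hlow := hu.le_norm_sq hd0 hx₀ hε0 (min_le_left _ _)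
    set G := ‖gradL d u‖ with hG
    have hG2 : 0 < G ^ 2 := by
      refine lt_of_lt_of_le ?_ hlow
      have : 0 < (volume : Measure (Sp d)).real (ball 0 1) :=
        ENNReal.toReal_pos (measure_ball_pos volume _ one_pos).ne' measure_ball_lt_top.ne
      positivity
    have q₁ := norm_dtn_sub_le hd0 γ₁ hm₁ hb₁ hu.harmonic _
      (h₁ ε hε0 ((min_le_right _ _).trans (min_le_left _ _)) u hu)
    have q₂ := norm_dtn_sub_le hd0 γ₂ hm₂ hb₂ hu.harmonic _
      (h₂ ε hε0 ((min_le_right _ _).trans (min_le_right _ _)) u hu)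
    rw [← hG] at q₁ q₂
    -- The trace norm is a quotient norm, so no trace theorem is needed.
    have htr : ‖trace d u‖ ≤ ‖u‖ := Submodule.Quotient.norm_mk_le _ _
    have hΛ : ‖dtn γ₁ (trace d u) (trace d u) - dtn γ₂ (trace d u) (trace d u)‖ ≤
        N * (10 * G ^ 2) := by
      have h3 := (dtn γ₁ - dtn γ₂).le_opNorm₂ (trace d u) (trace d u)
      refine h3.trans ?_
      rw [mul_assoc]
      refine mul_le_mul_of_nonneg_left ?_ (ContinuousLinearMap.opNorm_nonneg _)
      refine le_trans ?_ hu.norm_le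
      rw [sq]
      exact mul_self_le_mul_self (norm_nonneg _) htr
    have htri : |γ₁.1 x₀ - γ₂.1 x₀| * G ^ 2 ≤ N * (10 * G ^ 2) +
        (σ * G * G + (σ * G) ^ 2 / m₁) + (σ * G * G + (σ * G) ^ 2 / m₂) := by
      have e : ((γ₁.1 x₀ * G ^ 2 : ℝ) : ℂ) - ((γ₂.1 x₀ * G ^ 2 : ℝ) : ℂ) =
          (dtn γ₁ (trace d u) (trace d u) - dtn γ₂ (trace d u) (trace d u)) -
          (dtn γ₁ (trace d u) (trace d u) - ((γ₁.1 x₀ * G ^ 2 : ℝ) : ℂ)) +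
          (dtn γ₂ (trace d u) (trace d u) - ((γ₂.1 x₀ * G ^ 2 : ℝ) : ℂ)) := by ring
      have e2 : |γ₁.1 x₀ - γ₂.1 x₀| * G ^ 2 =
          ‖((γ₁.1 x₀ * G ^ 2 : ℝ) : ℂ) - ((γ₂.1 x₀ * G ^ 2 : ℝ) : ℂ)‖ := by
        rw [← Complex.ofReal_sub, Complex.norm_real, ← sub_mul, norm_mul, Real.norm_eq_abs,
          Real.norm_of_nonneg hG2.le]
      rw [e2, e]
      exact (norm_add_le _ _).trans (add_le_add ((norm_sub_le _ _).trans (add_le_add hΛ q₁)) q₂)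
    refine le_of_mul_le_mul_right (htri.trans_eq ?_) hG2
    ring
  have hlim : Filter.Tendsto (fun σ : ℝ => 10 * N + (σ + σ ^ 2 / m₁) + (σ + σ ^ 2 / m₂))
      (nhdsWithin 0 (Ioi 0)) (nhds (10 * N)) := by
    have hc : Continuous fun σ : ℝ => 10 * N + (σ + σ ^ 2 / m₁) + (σ + σ ^ 2 / m₂) := by fun_prop
    have := (hc.tendsto 0).mono_left (nhdsWithin_le_nhds (s := Ioi 0))
    simpa using this
  refine ge_of_tendsto hlim ?_
  filter_upwards [self_mem_nhdsWithin] with σ hσ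
  exact key σ hσ

lemma isBoundaryStabilityConstant_ten (hd : 2 ≤ d) : IsBoundaryStabilityConstant d 10 := by
  intro γ₁ γ₂
  rw [eLpNorm_exponent_top]
  refine eLpNormEssSup_le_of_ae_bound (.of_forall fun θ => ?_)
  exact abs_sub_le_dtn hd γ₁ γ₂ (mem_sphere_zero_iff_norm.1 θ.2)

end

end Calderon

end

open Calderon

theorem mainTheorem4 (d : ℕ) (hd : 2 ≤ d) (I : ℕ → Type*)
    (f : (ℓ : ℕ) → I ℓ → Sph d → ℂ) (hf : ∀ ℓ, IsHarmonicONB d ℓ (f ℓ)) :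
    BasisAssumption d (angular f) (radial d I) (zernikeBound d I) ∧
    IsOrthonormalSet (ballMeasure d)
      (fun nk : (Σ ℓ, I ℓ) × ℕ => polarProd (radial d I nk.1 nk.2) (angular f nk.1)) ∧
    spaceW d (angular f) (radial d I) = ⊤ ∧
    (∀ n k, eLpNorm (polarProd (radial d I n k) (angular f n)) ∞ (ballMeasure d) ≤
      ENNReal.ofReal (zernikeBound d I n k)) ∧
    IsGLB (range fun nk : (Σ ℓ, I ℓ) × ℕ => ‖radial d I nk.1 nk.2 1‖) √(d : ℝ) ∧
    (∀ k : ℕ, IsGLB (range fun n : Σ ℓ, I ℓ => ‖radial d I n k 1‖) √(4 * (k : ℝ) + d)) ∧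
    (∃ C : ℝ, 0 < C ∧ IsBoundaryStabilityConstant d C) ∧
    ∀ C : ℝ, 0 < C → IsBoundaryStabilityConstant d C →
      ∀ a : (Σ ℓ, I ℓ) → ℕ → ℝ, BasisAssumption d (angular f) (radial d I) a →
      ∀ (k : ℕ) (γ₁ γ₂ : CPlus d),
        (fun x => ((γ₁.1 x - γ₂.1 x : ℝ) : ℂ)) ∈ classA d (angular f) (radial d I) a k →
        eLpNorm (fun x => γ₁.1 x - γ₂.1 x) 2 (ballMeasure d) ≤
          ENNReal.ofReal
            (√((sphereMeasure d).real univ / (4 * k + d)) * C * ‖dtn γ₁ - dtn γ₂‖) := by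
  refine ⟨basisAssumption_zernike hd hf, isOrthonormalSet_zernike (by omega) hf,
    spaceW_eq_top (by omega) hf, fun n k => ?_, isGLB_radial_one' (by omega) hf,
    fun k => isGLB_radial_one (by omega) hf k,
    ⟨10, by norm_num, isBoundaryStabilityConstant_ten hd⟩, ?_⟩
  · rw [eLpNorm_exponent_top]
    refine eLpNormEssSup_le_of_ae_bound ?_
    filter_upwards [ae_restrict_mem measurableSet_ball] with x hx
    exact norm_zernike_le hd hf n k (mem_ball_zero_iff.1 hx).le
  · rintro C hC0 hC a - k γ₁ γ₂ ⟨⟨F, hF, hFg⟩, -⟩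
    exact stability (by omega) hf hC0 hC k γ₁ γ₂ hF hFg
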